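/- **Setting.** Let $0<q<1$, let $m\ge 1$ be an integer, and put $\mu=1+q^{2-m}$. Indices run over $\{1,\dots,m\}$, $i'=m+1-i$, and repeated indices are summed. Let $\rho=(\tfrac m2-1,\dots,\tfrac12,0,-\tfrac12,\dots,1-\tfrac m2)$ for odd $m$ and $\rho=(\tfrac m2-1,\dots,1,0,0,-1,\dots,1-\tfrac m2)$ for even $m$. Let $C_{ij}=C^{ij}=q^{-\rho_i}\delta_{j,i'}$, and let $\hat R$ be the R-matrix of the quantum orthogonal group, $$\hat R^{ab}_{cd}=\alpha_{ab}\,\delta_{ad}\delta_{bc}+(q-q^{-1})[a<b]\,\delta_{ac}\delta_{bd}-(q-q^{-1})[c<a']\,C^{ab}C_{cd},$$ where $[\cdot]$ is $1$ if the condition holds and $0$ otherwise, and $\alpha_{ab}=q$ if $a=b\neq a'$, $\alpha_{ab}=q^{-1}$ if $b=a'\ne a$, and $\alpha_{ab}=1$ otherwise. Let $(P_1)^{ij}_{kl}=C^{ij}C_{kl}/(C^{ab}C_{ab})$, and define $P_A$ by $\hat R=qP_S-q^{-1}P_A+q^{1-m}P_1$, $P_S+P_A+P_1=1$. Let $\mathcal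 P$ be the unital associative $\mathbb C$-algebra generated by $x^1,\dots,x^m$ with the relations $(P_A)^{ab}_{ij}x^ix^j=0$, and let $\mathcal P_k$ be the span of the products of $k$ generators. The partial derivatives are the linear maps $\partial^i$ on $\mathcal P$ with $\partial^i1=0$ and $\partial^i(x^jp)=C^{ij}p+q(\hat R^{-1})^{ij}_{kl}\,x^k\,\partial^lp$. Let $\Delta=\partial^iC_{ij}\partial^j$ and $x^2=x^iC_{ij}x^j$. The spherical harmonics of degree $k$ are the elements of $\mathcal S_k=\mathcal P_k\cap\ker\Delta$. Let $[u]_p=\frac{p^u-1}{p-1}$, $[k]_p!=[1]_p\cdots[k]_p$, $(a;p)_\infty=\prod_{n\ge0}(1-ap^n)$ and $\Gamma_p(t)=\frac{(p;p)_\infty}{(p^t;p)_\infty}(1-p)^{1-t}$. The integral over the quantum sphere is the linear functional $$\int_{\mathbb S}p=\sum_{k\ge 0}\frac{2\,\Gamma_{q^2}(\frac12)^m}{\mu^{2k}\,[k]_{q^2}!\;\Gamma_{q^2}(k+\frac m2)}\,(\Delta^kp)(0)\qquad(p\in\mathcal P),$$ where evaluation at $0$ is the algebra homomorphism $x^i\mapsto0$,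 and the sum is finite for each $p$. For $\nu>-1$ and $0<x<\frac1{1-q}$ the first $q$-Bessel function is $$J^{(1)}_\nu(x|q^2)=\Big(\frac{x}{1+q}\Big)^{\nu}\sum_{i\ge0}\frac{(-1)^i}{[i]_{q^2}!\;\Gamma_{q^2}(i+\nu+1)}\Big(\frac{x}{1+q}\Big)^{2i}.$$ Let $y^1,\dots,y^m$ be the coordinates of a second copy of $\mathcal P$. Consider formal power series $E=\sum_{a,b\ge0}E_{a,b}$ with $E_{a,b}\in\mathcal P_a\otimes\mathcal P_b$, the first factor in the variables $x$ and the second in the variables $y$ (the $x$ written to the left of the $y$). **Theorem.** (1) There is exactly one such series, the braided exponential $\exp_R(x|y)$, with $$\partial_x^{\,j}\exp_R(x|y)=\exp_R(x|y)\,y^j\quad(1\le j\le m),\qquad \exp_R(0|y)=1 .$$ (2) For every $k\ge0$ and every $S_k\in\mathcal S_k$, $$\int_{\mathbb S,x}S_k(x)\,\exp_R(ix|y)\;=\;2\,\mu^{\frac m2-1}\,\Gamma_{q^2}(\tfrac12)^m\;i^k\;\frac{J^{(1)}_{\frac m2+k-1}\!\big(\tfrac{1+q}{\mu}\sqrt{y^2}\,\big|\,q^2\big)}{\big(\sqrt{y^2}\big)^{\frac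 m2+k-1}}\;S_k(y)$$ as formal power series in $y$. Here $\exp_R(ix|y)=\sum_{a,b}i^aE_{a,b}$, the integral is taken termwise in $x$, and the quotient on the right is the series $\sum_n\varphi_n\,(y^2)^n$ whose real coefficients $\varphi_n$ are the Taylor coefficients given by $J^{(1)}_{\frac m2+k-1}\big(\tfrac{1+q}{\mu}t\,\big|\,q^2\big)\big/t^{\frac m2+k-1}=\sum_n\varphi_n\,t^{2n}$ for all $t>0$ with $\tfrac{1+q}{\mu}t<\tfrac1{1-q}$. -/

import Mathlib

namespace QEuclid

set_option linter.unusedSimpArgs false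

open Finset

/-- The weights `(m/2 - 1, …, 1/2, 0, -1/2, …, 1 - m/2)` for odd `m` and
`(m/2 - 1, …, 1, 0, 0, -1, …, 1 - m/2)` for even `m`. -/
noncomputable def rho (m : ℕ) (i : Fin m) : ℝ :=
  if 2 * (i : ℕ) + 1 < m then (m : ℝ) / 2 - 1 - (i : ℕ)
  else if 2 * (i : ℕ) + 1 = m then 0
  else (m : ℝ) / 2 - (i : ℕ)

/-- The numbers `q ^ (-ρ_i)`. -/
noncomputable def wt (q : ℝ) (m : ℕ) (i : Fin m) : ℝ := q ^ (-rho m i)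

/-- The metric `C_{ij} = C^{ij} = q ^ (-ρ_i) δ_{j, i'}`, where `i'` is the mirror image of `i`. -/
noncomputable def metric (q : ℝ) (m : ℕ) (i j : Fin m) : ℝ := if j = i.rev then wt q m i else 0

/-- The R-matrix of the quantum orthogonal group in braid form; `rmat q m (a, b) (c, d)` is
`R̂^{ab}_{cd}`, with first (upper) index pair the row. -/
noncomputable def rmat (q : ℝ) (m : ℕ) : Matrix (Fin m × Fin m) (Fin m × Fin m) ℝ := Matrix.of fun x y =>
  (if x.1 = y.2 ∧ x.2 = y.1 then
    (if x.2 = x.1.rev then (if x.1 = x.2 then 1 else q⁻¹) else (if x.1 = x.2 then q else 1)) else 0)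
  + (if x = y ∧ x.1 < x.2 then q - q⁻¹ else 0)
  - (if y.1 < x.1.rev then (q - q⁻¹) * (metric q m x.1 x.2 * metric q m y.1 y.2) else 0)

/-- The rank one matrix `C^{ij} C_{kl}`. -/
noncomputable def kmat (q : ℝ) (m : ℕ) : Matrix (Fin m × Fin m) (Fin m × Fin m) ℝ := Matrix.of fun x y =>
  metric q m x.1 x.2 * metric q m y.1 y.2

/-- The projector `P_1`, with entries `C^{ij} C_{kl} / (C^{ab} C_{ab})`. -/
noncomputable def proj1 (q : ℝ) (m : ℕ) : Matrix (Fin m × Fin m) (Fin m × Fin m) ℝ := Matrix.of fun x y =>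
  metric q m x.1 x.2 * metric q m y.1 y.2 / ∑ i, ∑ j, metric q m i j * metric q m i j

/-- The antisymmetrizer: the matrix `P_A` in the decomposition
`R̂ = q P_S - q⁻¹ P_A + q ^ (1 - m) P_1` with `P_S + P_A + P_1 = 1`. -/
noncomputable def projA (q : ℝ) (m : ℕ) : Matrix (Fin m × Fin m) (Fin m × Fin m) ℝ :=
  (q + q⁻¹)⁻¹ • (q • (1 - proj1 q m) + q ^ (1 - (m : ℝ)) • proj1 q m - rmat q m)

namespace YB

/-! Proof of the braid relation for the R-matrix, from the properties of the weights that it needs. -/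

section
variable {m : ℕ}

/-- The weights and the relations between them; the instance used is `wtData` below. -/
structure Wt (m : ℕ) where
  q : ℝ
  z : ℝ
  l : ℝ
  hl : l = q - z
  hq : q * z = 1
  c : Fin m → ℝ
  hc : ∀ i, c i * c i.rev = 1
  hmid : ∀ i, i = i.rev → c i = 1
  hS : ∀ lo hi : Fin m, lo < hi → l * ∑ s ∈ Ioo lo hi, c s ^ 2 =
    z * c hi ^ 2 - q * c lo ^ 2 + (if hi.rev < hi then l else if hi = hi.rev then 1 - z else 0)
     - (if lo.rev < lo then l else if lo = lo.rev then 1 - z else 0)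

variable (D : Wt m)

noncomputable def al (a b : Fin m) : ℝ :=
  if b = a.rev then (if a = b then 1 else D.z) else (if a = b then D.q else 1)

noncomputable def sg (n : Fin m) (f : Fin m → ℝ) : ℝ := ∑ s ∈ Iio n, D.c s * f s

noncomputable def R12 (F : Fin m → Fin m → Fin m → ℝ) (a b d : Fin m) : ℝ :=
  al D a b * F b a d + (if a < b then D.l * F a b d else 0)
   - (if b = a.rev then D.l * (D.c a * sg D a.rev (fun s => F s s.rev d)) else 0)

noncomputable def R23 (F : Fin m → Fin m → Fin m → ℝ) (d a b : Fin m) : ℝ :=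
  al D a b * F d b a + (if a < b then D.l * F d a b else 0)
   - (if b = a.rev then D.l * (D.c a * sg D a.rev (fun s => F d s s.rev)) else 0)

theorem R12_apply (F : Fin m → Fin m → Fin m → ℝ) (a b d : Fin m) : R12 D F a b d =
    al D a b * F b a d + (if a < b then D.l * F a b d else 0)
     - (if b = a.rev then D.l * (D.c a * sg D a.rev (fun s => F s s.rev d)) else 0) := rfl

theorem R23_apply (F : Fin m → Fin m → Fin m → ℝ) (d a b : Fin m) : R23 D F d a b =
    al D a b * F d b a + (if a < b then D.l * F d a b else 0)
     - (if b = a.rev then D.l * (D.c a * sg D a.rev (fun s => F d s s.rev)) else 0) := rfl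

noncomputable def H (F : Fin m → Fin m → Fin m → ℝ) := R23 D (R12 D F)

theorem al_mul (s d : Fin m) : al D s.rev d * al D s d = 1 := by
  have := D.hq
  unfold al; simp only [Fin.rev_rev]
  by_cases h1 : d = s <;> by_cases h2 : d = s.rev
  · subst h1; simp [← h2]
  · subst h1; simp [h2, Ne.symm h2]; grind
  · subst h2; simp [h1, Ne.symm h1]; grind
  · simp [h1, h2, Ne.symm h1, Ne.symm h2]

/-- coefficient of F t t' d in T(n) -/
noncomputable def u (n d t : Fin m) : ℝ :=
  (if t.rev < n ∧ t < d then D.l * al D t t.rev * D.c t.rev else 0)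
  + (if t < n ∧ t.rev < d ∧ t < t.rev then D.l ^ 2 * D.c t else 0)
  - D.l ^ 2 * D.c t * ∑ s ∈ Iio n, (if s.rev < d ∧ t < s.rev then D.c s ^ 2 else 0)
  - (if d.rev < n ∧ t < d then D.l * al D d d * D.c d.rev ^ 2 * D.c t else 0)
  + (if d < n ∧ d.rev < d ∧ t < d.rev then D.l ^ 2 * D.c t else 0)

theorem sg_ite (n : Fin m) (f : Fin m → ℝ) : sg D n f = ∑ s, if s < n then D.c s * f s else 0 := by
  unfold sg
  rw [← Finset.sum_filter]
  congr 1; ext; simp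

theorem sum_ite_one (P : Fin m → Prop) [DecidablePred P] (x : Fin m) (g : Fin m → ℝ) (hP : ∀ s, P s → s = x) :
    (∑ s, if P s then g s else 0) = if P x then g x else 0 := by
  rw [Finset.sum_eq_single x]
  · intro b _ hb; rw [if_neg]; exact fun h => hb (hP b h)
  · simp

theorem A1 (F : Fin m → Fin m → Fin m → ℝ) (n d : Fin m) :
    sg D n (fun s => al D s.rev d * R12 D F s d s.rev) =
      sg D n (fun s => F d s s.rev)
      + D.l * sg D n (fun s => if s < d then al D s.rev d * F s d s.rev else 0)
      - (if d.rev < n then D.l * al D d d * D.c d.rev ^ 2 * sg D d (fun s => F s s.rev d) else 0) := by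
  have h : ∀ s, al D s.rev d * R12 D F s d s.rev = F d s s.rev
     + D.l * (if s < d then al D s.rev d * F s d s.rev else 0)
     - (if s = d.rev then D.l * al D d d * D.c d.rev * sg D d (fun s => F s s.rev d) else 0) := by
    intro s
    unfold R12
    have := al_mul D s d
    by_cases h : s = d.rev
    · subst h; simp only [Fin.rev_rev, if_true] at *
      split_ifs <;> linear_combination this * (F d d.rev d)
    · have h' : d ≠ s.rev := by rintro rfl; simp at h
      simp only [h, h', if_false]
      split_ifs <;> linear_combination this * (F d s s.rev)
  simp only [h]
  generalize sg D d (fun s => F s s.rev d) = X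
  have e : (if d.rev < n then D.l * al D d d * D.c d.rev ^ 2 * X else 0) =
      ∑ s, if s = d.rev ∧ d.rev < n then D.l * al D d d * D.c d.rev ^ 2 * X else 0 := by
    rw [sum_ite_one (fun s => s = d.rev ∧ d.rev < n) d.rev _ (by simp)]; simp
  rw [e, sg_ite, sg_ite, sg_ite, Finset.mul_sum, ← Finset.sum_add_distrib, ← Finset.sum_sub_distrib]
  refine Finset.sum_congr rfl fun s _ => ?_
  by_cases h1 : s = d.rev
  · subst h1; simp only [true_and, if_true]; split_ifs <;> ring
  · simp only [h1, false_and, if_false]; split_ifs <;> ring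

theorem A3 (F : Fin m → Fin m → Fin m → ℝ) (n d : Fin m) :
    sg D n (fun s => if d = s.rev.rev then D.l * (D.c s.rev * sg D s.rev.rev (fun u => R12 D F s u u.rev)) else 0) =
      (if d < n then D.l * sg D d (fun s => al D d s * F s d s.rev) else 0)
      - (if d < n ∧ d.rev < d then D.l ^ 2 * sg D d.rev (fun s => F s s.rev d) else 0) := by
  have e : ∀ d, sg D d (fun u => R12 D F d u u.rev) = sg D d (fun s => al D d s * F s d s.rev)
      - if d.rev < d then D.c d.rev * (D.l * (D.c d * sg D d.rev (fun s => F s s.rev d))) else 0 := by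
    intro d
    have e' : (if d.rev < d then D.c d.rev * (D.l * (D.c d * sg D d.rev (fun s => F s s.rev d))) else 0) =
      ∑ s, if s = d.rev ∧ d.rev < d then D.c d.rev * (D.l * (D.c d * sg D d.rev (fun s => F s s.rev d))) else 0 := by
      rw [sum_ite_one (fun s => s = d.rev ∧ d.rev < d) d.rev _ (by simp)]; simp
    rw [e', sg_ite D d, sg_ite D d, ← Finset.sum_sub_distrib]
    refine Finset.sum_congr rfl fun s _ => ?_
    unfold R12
    by_cases h1 : s = d.rev
    · subst h1; simp only [true_and, if_true, Fin.rev_rev]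
      by_cases h : d.rev < d
      · simp [h, h.not_gt]; ring
      · simp [h]
    · simp only [h1, false_and, if_false]
      by_cases h : s < d
      · simp [h, h.not_gt]
      · simp [h]
  simp only [Fin.rev_rev]
  rw [sg_ite]
  have : ∀ s, (if s < n then D.c s * (if d = s then D.l * (D.c s.rev * sg D s (fun u => R12 D F s u u.rev)) else 0) else 0)
      = if d = s ∧ s < n then D.c s * (D.l * (D.c s.rev * sg D s (fun u => R12 D F s u u.rev))) else 0 := by
    intro s; split_ifs <;> simp_all
  simp only [this]
  rw [sum_ite_one _ d _ (by rintro s ⟨rfl, -⟩; rfl)]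
  have h := D.hc d
  simp only [e, true_and]
  by_cases h1 : d < n <;> by_cases h2 : d.rev < d <;> simp only [h1, h2, if_true, if_false, and_self, and_true, and_false, false_and]
  · linear_combination h * (D.l * (sg D d fun s => al D d s * F s d s.rev) ) - h * (D.c d * D.c d.rev + 1) * D.l^2 * sg D d.rev fun s => F s s.rev d
  · linear_combination h * (D.l * (sg D d fun s => al D d s * F s d s.rev) )
  · simp
  · simp

theorem A2 (F : Fin m → Fin m → Fin m → ℝ) (n d : Fin m) :
    sg D n (fun s => if s.rev < d then D.l * R12 D F s s.rev d else 0) =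
     ∑ t, ((if t.rev < n ∧ t < d then D.l * al D t t.rev * D.c t.rev else 0)
  + (if t < n ∧ t.rev < d ∧ t < t.rev then D.l ^ 2 * D.c t else 0)
  - D.l ^ 2 * D.c t * ∑ s ∈ Iio n, (if s.rev < d ∧ t < s.rev then D.c s ^ 2 else 0)) * F t t.rev d := by
  have al_rev : ∀ t, al D t.rev t = al D t t.rev := by
    intro t; unfold al; simp only [Fin.rev_rev]; simp [eq_comm]
  simp only [add_mul, sub_mul, Finset.sum_add_distrib, Finset.sum_sub_distrib]
  have e1 : ∑ t : Fin m, (if t.rev < n ∧ t < d then D.l * al D t t.rev * D.c t.rev else 0) * F t t.rev d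
     = ∑ t, (if t < n ∧ t.rev < d then D.l * al D t t.rev * D.c t else 0) * F t.rev t d := by
    rw [← Equiv.sum_comp Fin.revPerm]
    simp [al_rev]
  have e2 : ∑ t, (D.l ^ 2 * D.c t * ∑ s ∈ Iio n, (if s.rev < d ∧ t < s.rev then D.c s ^ 2 else 0)) * F t t.rev d
     = ∑ s, if s < n ∧ s.rev < d then D.l ^ 2 * D.c s ^ 2 * sg D s.rev (fun t => F t t.rev d) else 0 := by
    simp only [sg_ite, Finset.mul_sum, Finset.sum_mul]
    rw [Finset.sum_comm]
    rw [← Finset.sum_subset (Finset.subset_univ (Iio n)) (by intro x _ hx; rw [if_neg]; simp at hx; omega)]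
    refine Finset.sum_congr rfl fun s hs => ?_
    simp only [Finset.mem_Iio] at hs
    by_cases h : s.rev < d
    · simp only [h, hs, true_and, and_true, if_true]
      refine Finset.sum_congr rfl fun t _ => ?_
      split_ifs <;> ring
    · simp [h]
  rw [e1, e2, sg_ite, ← Finset.sum_add_distrib, ← Finset.sum_sub_distrib]
  refine Finset.sum_congr rfl fun s _ => ?_
  unfold R12
  by_cases h1 : s < n <;> by_cases h2 : s.rev < d <;> simp only [h1, h2, if_true, true_and, if_false, false_and, and_false]
  · split_ifs <;> ring
  all_goals simp

theorem T_eq (F : Fin m → Fin m → Fin m → ℝ) (n d : Fin m) :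
    sg D n (fun s => H D F s s.rev d) =
      sg D n (fun s => F d s s.rev)
      + D.l * sg D n (fun s => if s < d then al D s.rev d * F s d s.rev else 0)
      - (if d < n then D.l * sg D d (fun s => al D d s * F s d s.rev) else 0)
      + ∑ t, u D n d t * F t t.rev d := by
  have h : sg D n (fun s => H D F s s.rev d) = sg D n (fun s => al D s.rev d * R12 D F s d s.rev)
    + sg D n (fun s => if s.rev < d then D.l * R12 D F s s.rev d else 0)
    - sg D n (fun s => if d = s.rev.rev then D.l * (D.c s.rev * sg D s.rev.rev (fun u => R12 D F s u u.rev)) else 0) := by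
    unfold sg; rw [← Finset.sum_add_distrib, ← Finset.sum_sub_distrib]
    refine Finset.sum_congr rfl fun s _ => ?_
    unfold H R23; unfold sg; ring
  rw [h, A1, A2, A3]
  have e1 : (if d.rev < n then D.l * al D d d * D.c d.rev ^ 2 * sg D d (fun s => F s s.rev d) else 0)
    = ∑ t, (if d.rev < n ∧ t < d then D.l * al D d d * D.c d.rev ^ 2 * D.c t else 0) * F t t.rev d := by
    rw [sg_ite]
    by_cases h : d.rev < n
    · simp only [h, if_true, true_and, Finset.mul_sum]
      refine Finset.sum_congr rfl fun t _ => ?_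
      split_ifs <;> ring
    · simp [h]
  have e2 : (if d < n ∧ d.rev < d then D.l ^ 2 * sg D d.rev (fun s => F s s.rev d) else 0)
    = ∑ t, (if d < n ∧ d.rev < d ∧ t < d.rev then D.l ^ 2 * D.c t else 0) * F t t.rev d := by
    rw [sg_ite]
    by_cases h : d < n ∧ d.rev < d
    · simp only [h, and_self, if_true, true_and, Finset.mul_sum]
      refine Finset.sum_congr rfl fun t _ => ?_
      split_ifs <;> ring
    · rw [if_neg h, Finset.sum_eq_zero]; intro t _; rw [if_neg (fun h' => h ⟨h'.1, h'.2.1⟩)]; ring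
  rw [e1, e2]
  unfold u
  simp only [add_mul, sub_mul, Finset.sum_add_distrib, Finset.sum_sub_distrib]
  ring

noncomputable def th (n : Fin m) : ℝ := if n.rev < n then D.l else if n = n.rev then 1 - D.z else 0

theorem sumS (n d t : Fin m) :
    D.l * ∑ s ∈ Iio n, (if s.rev < d ∧ t < s.rev then D.c s ^ 2 else 0) =
      if d.rev < n ∧ t < d then
        (if t.rev < n then D.z * D.c t.rev ^ 2 + th D t.rev else D.z * D.c n ^ 2 + th D n)
          - D.q * D.c d.rev ^ 2 - th D d.rev
      else 0 := by
  have e : ∑ s ∈ Iio n, (if s.rev < d ∧ t < s.rev then D.c s ^ 2 else 0) =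
      ∑ s ∈ Ioo d.rev (min n t.rev), D.c s ^ 2 := by
    rw [← Finset.sum_filter]
    congr 1; ext s
    simp only [Finset.mem_filter, Finset.mem_Iio, Finset.mem_Ioo, lt_min_iff, Fin.lt_def, Fin.val_rev]
    omega
  rw [e]
  split_ifs with h1 h2
  · rw [min_eq_right h2.le, D.hS _ _ (Fin.rev_lt_rev.2 h1.2)]
    simp only [th]; ring
  · rw [min_eq_left (not_lt.1 h2), D.hS _ _ h1.1]
    simp only [th]; ring
  · rw [Finset.Ioo_eq_empty, Finset.sum_empty, mul_zero]
    rw [lt_min_iff, Fin.rev_lt_rev]; exact h1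

theorem Vpart (F : Fin m → Fin m → Fin m → ℝ) (n d : Fin m) :
    D.l * sg D n (fun s => if s < d then al D s.rev d * F s d s.rev else 0)
      - (if d < n then D.l * sg D d (fun s => al D d s * F s d s.rev) else 0) =
    if d < n then (if d.rev < d then D.l ^ 2 * D.c d.rev * F d.rev d d else 0)
    else D.l * (sg D n (fun s => F s d s.rev) + if d.rev < n then (D.q - 1) * D.c d.rev * F d.rev d d else 0) := by
  have hl := D.hl
  split_ifs with h1 h2 h2
  · have e : D.l ^ 2 * D.c d.rev * F d.rev d d = ∑ s, if s = d.rev then D.l ^ 2 * D.c d.rev * F d.rev d d else 0 := by simp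
    rw [e, sg_ite, sg_ite, Finset.mul_sum, Finset.mul_sum, ← Finset.sum_sub_distrib]
    refine Finset.sum_congr rfl fun s _ => ?_
    by_cases hs : s = d.rev
    · subst hs
      have : d ≠ d.rev := h2.ne'
      simp only [h2, (h2.trans h1), if_true, al, Fin.rev_rev, this, if_false, hl]; ring
    · have hs' : d ≠ s.rev := by rintro rfl; simp at hs
      by_cases h3 : s < d
      · simp [h3, h3.trans h1, al, hs, hs', h3.ne', h3.ne, Ne.symm hs', Ne.symm hs]
      · simp [h3, hs]
  · rw [sg_ite, sg_ite, Finset.mul_sum, Finset.mul_sum, ← Finset.sum_sub_distrib]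
    refine Finset.sum_eq_zero fun s _ => ?_
    by_cases h3 : s < d
    · have hs : s ≠ d.rev := by rintro rfl; exact h2 h3
      have hs' : d ≠ s.rev := by rintro rfl; simp at hs
      simp [h3, h3.trans h1, al, hs, hs', h3.ne', h3.ne, Ne.symm hs', Ne.symm hs]
    · simp [h3]
  · have e : (D.q - 1) * D.c d.rev * F d.rev d d = ∑ s, if s = d.rev then (D.q - 1) * D.c d.rev * F d.rev d d else 0 := by simp
    rw [e, sg_ite, sg_ite, ← Finset.sum_add_distrib, sub_zero]
    congr 1
    refine Finset.sum_congr rfl fun s _ => ?_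
    by_cases hs : s = d.rev
    · subst hs
      have : d ≠ d.rev := by rintro h; rw [← h] at h2; exact h1 h2
      have h3 : d.rev < d := by omega
      simp only [h2, h3, if_true, al, Fin.rev_rev, this, if_false]; ring
    · have hs' : d ≠ s.rev := by rintro rfl; simp at hs
      by_cases h3 : s < n
      · have h4 : s < d := by omega
        simp [h3, h4, al, hs, hs', h4.ne', h4.ne, Ne.symm hs', Ne.symm hs]
      · simp [h3, hs]
  · rw [sg_ite, sg_ite, sub_zero, add_zero]
    congr 1
    refine Finset.sum_congr rfl fun s _ => ?_
    by_cases h3 : s < n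
    · have hs : s ≠ d.rev := by rintro rfl; exact h2 h3
      have hs' : d ≠ s.rev := by rintro rfl; simp at hs
      have h4 : s < d := by omega
      simp [h3, h4, al, hs, hs', h4.ne', h4.ne, Ne.symm hs', Ne.symm hs]
    · simp [h3]

theorem u_eq (n d t : Fin m) : u D n d t =
  (if d < n ∧ d.rev < d ∧ t = d.rev then - D.l ^ 2 * D.c d.rev else 0)
  + (if d.rev < n ∧ t ≤ n.rev then D.c t * (D.l * (-D.z * D.c n ^ 2 - th D n) + 
       (if d < n then D.l ^ 2 else if d.rev < t ∧ t < n then D.l ^ 2 else 0)) else 0) := by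
  have hl := D.hl
  have e : D.l ^ 2 * D.c t * ∑ s ∈ Iio n, (if s.rev < d ∧ t < s.rev then D.c s ^ 2 else 0)
     = D.l * D.c t * (D.l * ∑ s ∈ Iio n, (if s.rev < d ∧ t < s.rev then D.c s ^ 2 else 0)) := by ring
  unfold u
  rw [e, sumS]
  have ht := D.hc t
  have htm := D.hmid t
  have hdm := D.hmid d
  have hD := D.hq
  have hdm' : d = d.rev → D.c d.rev = 1 := fun h => h ▸ D.hmid d h
  by_cases hB : t < d
  swap
  · have h1 : ¬ (d < n ∧ d.rev < d ∧ t = d.rev) := by rintro ⟨_, h, rfl⟩; exact hB h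
    have h2 : ¬ (d.rev < n ∧ t ≤ n.rev) := by
      simp only [Fin.lt_def, Fin.le_def, Fin.val_rev] at *; omega
    have h3 : ¬ (t < n ∧ t.rev < d ∧ t < t.rev) := by
      simp only [Fin.lt_def, Fin.le_def, Fin.val_rev] at *; omega
    have h4 : ¬ (d < n ∧ d.rev < d ∧ t < d.rev) := by
      simp only [Fin.lt_def, Fin.le_def, Fin.val_rev] at *; omega
    simp only [h1, h2, h3, h4, hB, and_false, if_false]; ring
  by_cases hA : d.rev < n
  swap
  · have h1 : ¬ (d < n ∧ d.rev < d ∧ t = d.rev) := by rintro ⟨h, h', rfl⟩; exact hA (h'.trans h)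
    have h2 : ¬ (t.rev < n ∧ t < d) := by
      simp only [Fin.lt_def, Fin.le_def, Fin.val_rev] at *; omega
    have h3 : ¬ (t < n ∧ t.rev < d ∧ t < t.rev) := by
      simp only [Fin.lt_def, Fin.le_def, Fin.val_rev] at *; omega
    have h4 : ¬ (d < n ∧ d.rev < d ∧ t < d.rev) := by
      simp only [Fin.lt_def, Fin.le_def, Fin.val_rev] at *; omega
    simp only [h1, h2, h3, h4, hA, false_and, if_false]; ring
  simp only [hA, hB, and_true, true_and, if_true]
  have hdd : D.l * al D d d * D.c d.rev ^ 2 - D.l * D.q * D.c d.rev ^ 2 - D.l * th D d.rev =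
      if d ≤ d.rev then - D.l ^ 2 else 0 := by
    rcases lt_trichotomy d d.rev with h | h | h
    · simp only [al, th, Fin.rev_rev, h, h.ne, h.le, if_true, if_false]; ring
    · simp only [al, th, Fin.rev_rev, ← h, lt_irrefl, le_refl, if_true, if_false, hdm h]
      rw [hl]; linear_combination 0 * hD
    · simp only [al, th, Fin.rev_rev, h.not_gt, h.not_ge, h.ne, h.ne', if_true, if_false]; ring
  have htt : D.l * al D t t.rev * D.c t.rev - D.l * D.c t * (D.z * D.c t.rev ^ 2 + th D t.rev) =
      if t < t.rev then - D.l ^ 2 * D.c t else 0 := by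
    rcases lt_trichotomy t t.rev with h | h | h
    · simp only [al, th, Fin.rev_rev, h, h.ne, if_true, if_false]
      linear_combination (- D.l * D.z * D.c t.rev) * ht
    · simp only [al, th, Fin.rev_rev, ← h, lt_irrefl, if_true, if_false, htm h]
      ring
    · simp only [al, th, Fin.rev_rev, h.not_gt, h.ne, h.ne', if_true, if_false]
      linear_combination (- D.l * D.z * D.c t.rev) * ht
  by_cases hC : t.rev < n
  · have h2 : ¬ (t ≤ n.rev) := by
      simp only [Fin.lt_def, Fin.le_def, Fin.val_rev] at *; omega
    simp only [hC, h2, if_true, if_false]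
    have key : (if t < t.rev then - D.l ^ 2 * D.c t else 0) + (if t < n ∧ t.rev < d ∧ t < t.rev then D.l ^ 2 * D.c t else 0)
      - (if d ≤ d.rev then - D.l ^ 2 else 0) * D.c t + (if d < n ∧ d.rev < d ∧ t < d.rev then D.l ^ 2 * D.c t else 0)
      = (if d < n ∧ d.rev < d ∧ t = d.rev then -D.l ^ 2 * D.c d.rev else 0) := by
      by_cases h5 : t = d.rev
      · subst h5
        simp only [Fin.rev_rev] at *
        by_cases h6 : d.rev < d
        · simp [h6, hC, h6.not_ge]
        · exact absurd hB h6
      · have h5' : (t : ℕ) ≠ d.rev := fun h => h5 (Fin.ext h)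
        simp only [h5, and_false, if_false]
        by_cases g1 : d ≤ d.rev
        · have g2 : t < t.rev := by
            simp only [Fin.lt_def, Fin.le_def, Fin.val_rev] at *; omega
          have g3 : ¬ (t < n ∧ t.rev < d ∧ t < t.rev) := by
            simp only [Fin.lt_def, Fin.le_def, Fin.val_rev] at *; omega
          have g4 : ¬ (d < n ∧ d.rev < d ∧ t < d.rev) := by
            simp only [Fin.lt_def, Fin.le_def, Fin.val_rev] at *; omega
          rw [if_neg g3, if_neg g4, if_pos g1, if_pos g2]; ring
        · have g1' : d.rev < d := not_le.1 g1
          by_cases g2 : t < d.rev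
          · have g3 : t < t.rev := by
              simp only [Fin.lt_def, Fin.le_def, Fin.val_rev] at *; omega
            have g4 : ¬ (t < n ∧ t.rev < d ∧ t < t.rev) := by
              simp only [Fin.lt_def, Fin.le_def, Fin.val_rev] at *; omega
            have g5 : d < n := by
              simp only [Fin.lt_def, Fin.le_def, Fin.val_rev] at *; omega
            rw [if_neg g4]
            simp only [g1, g1', g2, g3, g5, and_true, if_true, if_false]; ring
          · have g4 : (t < n ∧ t.rev < d ∧ t < t.rev) ↔ t < t.rev := by
              simp only [Fin.lt_def, Fin.le_def, Fin.val_rev] at *; omega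
            simp only [g1, g2, g4, and_false, if_false]
            split_ifs <;> ring
    linear_combination key + htt - D.c t * hdd
  · have h2 : t ≤ n.rev := by
      simp only [Fin.lt_def, Fin.le_def, Fin.val_rev] at *; omega
    have h3 : ¬ (d < n ∧ d.rev < d ∧ t = d.rev) := by
      rintro ⟨h, h', rfl⟩; rw [Fin.rev_rev] at hC; exact hC h
    simp only [hC, h2, h3, if_true, if_false]
    have key : (if t < n ∧ t.rev < d ∧ t < t.rev then D.l ^ 2 * D.c t else 0)
      - (if d ≤ d.rev then - D.l ^ 2 else 0) * D.c t + (if d < n ∧ d.rev < d ∧ t < d.rev then D.l ^ 2 * D.c t else 0)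
      = D.c t * (if d < n then D.l ^ 2 else if d.rev < t ∧ t < n then D.l ^ 2 else 0) := by
      by_cases g1 : d < n
      · have g3 : ¬ (t < n ∧ t.rev < d ∧ t < t.rev) := by
          simp only [Fin.lt_def, Fin.le_def, Fin.val_rev] at *; omega
        have g4 : (d < n ∧ d.rev < d ∧ t < d.rev) ↔ ¬ (d ≤ d.rev) := by
          simp only [Fin.lt_def, Fin.le_def, Fin.val_rev] at *; omega
        simp only [g1, g3, if_true, if_false, g4]
        simp only [g1, true_and] at g4
        by_cases g5 : d ≤ d.rev
        · have : ¬ (d.rev < d ∧ t < d.rev) := by rw [g4]; simpa using g5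
          simp only [g5, this, true_and, if_true, if_false]; ring
        · have : (d.rev < d ∧ t < d.rev) := by rw [g4]; exact g5
          simp only [g5, this, true_and, and_self, if_true, if_false]; ring
      · have g3 : (t < n ∧ t.rev < d ∧ t < t.rev) ↔ (d.rev < t ∧ t < n) := by
          simp only [Fin.lt_def, Fin.le_def, Fin.val_rev] at *; omega
        have g4 : ¬ d ≤ d.rev := by
          simp only [Fin.lt_def, Fin.le_def, Fin.val_rev] at *; omega
        simp only [g1, g3, g4, false_and, if_false]
        split_ifs <;> ring
    linear_combination key - D.c t * hdd

theorem T4 (F : Fin m → Fin m → Fin m → ℝ) (n d : Fin m) :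
    sg D n (fun s => H D F s s.rev d) =
      sg D n (fun s => F d s s.rev)
      + (if d < n then 0 else D.l * (sg D n (fun s => F s d s.rev) +
          if d.rev < n then (D.q - 1) * D.c d.rev * F d.rev d d else 0))
      + (if d.rev < n then
          D.l * (-D.z * D.c n ^ 2 - th D n) * (sg D n.rev (fun s => F s s.rev d) + D.c n.rev * F n.rev n d) +
          (if d < n then D.l ^ 2 * (sg D n.rev (fun s => F s s.rev d) + D.c n.rev * F n.rev n d)
            else D.l ^ 2 * ((if n ≤ n.rev then sg D n (fun s => F s s.rev d)
              else sg D n.rev (fun s => F s s.rev d) + D.c n.rev * F n.rev n d)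
               - (sg D d.rev (fun s => F s s.rev d) + D.c d.rev * F d.rev d d)))
         else 0) := by
  have sgle : ∀ x : Fin m, sg D x.rev (fun s => F s s.rev d) + D.c x.rev * F x.rev x d
      = ∑ t, if t ≤ x.rev then D.c t * F t t.rev d else 0 := by
    intro x
    have e : D.c x.rev * F x.rev x d = ∑ t, if t = x.rev then D.c t * F t t.rev d else 0 := by simp
    rw [e, sg_ite, ← Finset.sum_add_distrib]
    refine Finset.sum_congr rfl fun s _ => ?_
    rcases lt_trichotomy s x.rev with h | h | h
    · simp [h, h.le, h.ne]
    · simp [h]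
    · simp [h.not_gt, h.not_ge, h.ne']
  have e1 : ∑ t, u D n d t * F t t.rev d =
      (if d < n ∧ d.rev < d then - D.l ^ 2 * D.c d.rev * F d.rev d d else 0)
      + if d.rev < n then D.l * (-D.z * D.c n ^ 2 - th D n) * (sg D n.rev (fun s => F s s.rev d) + D.c n.rev * F n.rev n d) +
          (if d < n then D.l ^ 2 * (sg D n.rev (fun s => F s s.rev d) + D.c n.rev * F n.rev n d)
            else D.l ^ 2 * ((if n ≤ n.rev then sg D n (fun s => F s s.rev d)
              else sg D n.rev (fun s => F s s.rev d) + D.c n.rev * F n.rev n d)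
               - (sg D d.rev (fun s => F s s.rev d) + D.c d.rev * F d.rev d d))) else 0 := by
    simp only [u_eq, add_mul, Finset.sum_add_distrib]
    congr 1
    · have : ∀ t, (if d < n ∧ d.rev < d ∧ t = d.rev then -D.l ^ 2 * D.c d.rev else 0) * F t t.rev d =
        if t = d.rev then (if d < n ∧ d.rev < d then - D.l ^ 2 * D.c d.rev * F d.rev d d else 0) else 0 := by
        intro t
        by_cases h : t = d.rev
        · subst h; simp only [Fin.rev_rev, and_true, if_true]; split_ifs <;> ring
        · simp [h]
      simp only [this]; simp
    · by_cases h1 : d.rev < n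
      swap
      · simp [h1]
      simp only [h1, true_and, if_true]
      rw [sgle n, sgle d]
      have e2 : (if d < n then D.l ^ 2 * ∑ t, (if t ≤ n.rev then D.c t * F t t.rev d else 0)
          else D.l ^ 2 * ((if n ≤ n.rev then sg D n (fun s => F s s.rev d)
              else ∑ t, (if t ≤ n.rev then D.c t * F t t.rev d else 0))
               - ∑ t, (if t ≤ d.rev then D.c t * F t t.rev d else 0)))
         = ∑ t, if t ≤ n.rev then (if d < n then D.l ^ 2 else if d.rev < t ∧ t < n then D.l ^ 2 else 0) * (D.c t * F t t.rev d) else 0 := by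
        split_ifs with h2 h3
        · rw [Finset.mul_sum]; refine Finset.sum_congr rfl fun s _ => ?_
          split_ifs <;> ring
        · rw [sg_ite, ← Finset.sum_sub_distrib, Finset.mul_sum]
          refine Finset.sum_congr rfl fun s _ => ?_
          by_cases g1 : s ≤ d.rev
          · have g2 : s < n := lt_of_le_of_lt g1 h1
            have g3 : s ≤ n.rev := by omega
            simp [g1, g2, g3, g1.not_gt]
          · by_cases g2 : s < n
            · have g3 : s ≤ n.rev := by omega
              simp [g1, g2, g3, not_le.1 g1]
            · simp [g1, g2]
        · rw [← Finset.sum_sub_distrib, Finset.mul_sum]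
          refine Finset.sum_congr rfl fun s _ => ?_
          by_cases g1 : s ≤ d.rev
          · have g3 : s ≤ n.rev := by
              simp only [Fin.lt_def, Fin.le_def, Fin.val_rev] at *; omega
            simp [g1, g3, g1.not_gt]
          · by_cases g3 : s ≤ n.rev
            · have g2 : s < n := by omega
              simp [g1, g2, g3, not_le.1 g1]
            · simp [g1, g3]
      rw [e2, Finset.mul_sum, ← Finset.sum_add_distrib]
      refine Finset.sum_congr rfl fun s _ => ?_
      by_cases g : s ≤ n.rev
      · simp only [g, if_true]; ring
      · simp only [g, if_false]; ring
  rw [T_eq, e1]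
  have := Vpart D F n d
  split_ifs at this ⊢ <;> first | (exfalso; omega) | linear_combination this

theorem K_eq (F : Fin m → Fin m → Fin m → ℝ) (n d : Fin m) :
    sg D n (fun s => R23 D F s s.rev d) =
      sg D n (fun s => F s d s.rev)
      + (if d.rev < n then (al D d d - 1) * D.c d.rev * F d.rev d d else 0)
      + (if d < n then (al D d.rev d - 1) * D.c d * F d d d.rev else 0)
      + (if d.rev < n then D.l * (sg D n (fun s => F s s.rev d) - (sg D d.rev (fun s => F s s.rev d) + D.c d.rev * F d.rev d d)) else 0)
      - (if d < n then D.l * sg D d (fun s => F d s s.rev) else 0) := by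
  have sgle : ∀ x : Fin m, sg D x.rev (fun s => F s s.rev d) + D.c x.rev * F x.rev x d
      = ∑ t, if t ≤ x.rev then D.c t * F t t.rev d else 0 := by
    intro x
    have e : D.c x.rev * F x.rev x d = ∑ t, if t = x.rev then D.c t * F t t.rev d else 0 := by simp
    rw [e, sg_ite, ← Finset.sum_add_distrib]
    refine Finset.sum_congr rfl fun s _ => ?_
    rcases lt_trichotomy s x.rev with h | h | h
    · simp [h, h.le, h.ne]
    · simp [h]
    · simp [h.not_gt, h.not_ge, h.ne']
  have e1 : (if d.rev < n then (al D d d - 1) * D.c d.rev * F d.rev d d else 0) =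
      ∑ s, if s = d.rev then (if s < n then D.c s * ((al D s.rev d - 1) * F s d s.rev) else 0) else 0 := by
    simp only [Finset.sum_ite_eq', Finset.mem_univ, if_true, Fin.rev_rev]
    split_ifs <;> ring
  have e2 : (if d < n then (al D d.rev d - 1) * D.c d * F d d d.rev else 0) =
      ∑ s, if s = d then (if s < n then D.c s * ((al D s.rev d - 1) * F s d s.rev) else 0) else 0 := by
    simp only [Finset.sum_ite_eq', Finset.mem_univ, if_true]
    split_ifs <;> ring
  have e3 : (if d.rev < n then D.l * (sg D n (fun s => F s s.rev d) - (sg D d.rev (fun s => F s s.rev d) + D.c d.rev * F d.rev d d)) else 0)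
    = ∑ s, if s < n ∧ d.rev < s then D.c s * (D.l * F s s.rev d) else 0 := by
    by_cases h : d.rev < n
    · rw [if_pos h, sgle, sg_ite, ← Finset.sum_sub_distrib, Finset.mul_sum]
      refine Finset.sum_congr rfl fun s _ => ?_
      by_cases g1 : s ≤ d.rev
      · have g2 : s < n := lt_of_le_of_lt g1 h
        simp [g1, g2, g1.not_gt]
      · simp only [g1, not_le.1 g1, and_true, if_false]; split_ifs <;> ring
    · rw [if_neg h, Finset.sum_eq_zero]; intro s _
      rw [if_neg]; omega
  have e4 : (if d < n then D.l * sg D d (fun s => F d s s.rev) else 0) =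
      ∑ s, if s = d then (if s < n then D.l * sg D d (fun s => F d s s.rev) else 0) else 0 := by
    simp only [Finset.sum_ite_eq', Finset.mem_univ, if_true]
  have al1 : ∀ s, s ≠ d → s ≠ d.rev → al D s.rev d = 1 := by
    intro s h1 h2
    have h3 : s.rev ≠ d := by rintro rfl; simp at h2
    simp [al, h1, h3, Ne.symm h1]
  have hmm : d = d.rev → al D d d = 1 := fun h => by simp [al, ← h]
  rw [e1, e2, e3, e4, sg_ite, sg_ite D n, ← Finset.sum_add_distrib, ← Finset.sum_add_distrib,
    ← Finset.sum_add_distrib, ← Finset.sum_sub_distrib]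
  refine Finset.sum_congr rfl fun s _ => ?_
  by_cases h : s < n
  swap
  · simp [h]
  simp only [h, if_true, true_and]
  have hc := D.hc s
  have h3 : s.rev < d ↔ d.rev < s := by
    simp only [Fin.lt_def, Fin.val_rev] at *; omega
  simp only [R23, Fin.rev_rev, h3]
  by_cases h1 : s = d
  · subst h1
    simp only [if_true]
    by_cases h2 : s = s.rev
    · have := hmm h2
      simp only [← h2, this, lt_irrefl, if_true, if_false]
      rw [← h2] at hc
      linear_combination (-D.l * sg D s (fun t => F s t t.rev)) * hc
    · simp only [h2, if_false]
      split_ifs <;> linear_combination (-D.l * sg D s (fun t => F s t t.rev)) * hc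
  · by_cases h2 : s = d.rev
    · subst h2
      simp only [h1, Ne.symm h1, lt_irrefl, Fin.rev_rev, if_true, if_false]
      ring
    · simp only [h1, Ne.symm h1, h2, if_false, al1 s h1 h2]
      split_ifs <;> ring

def fl (F : Fin m → Fin m → Fin m → ℝ) : Fin m → Fin m → Fin m → ℝ :=
  fun x y w => F w.rev y.rev x.rev

theorem fl_fl (F : Fin m → Fin m → Fin m → ℝ) : fl (fl F) = F := by
  funext x y w; simp [fl]

theorem al_fl (a b : Fin m) : al D b.rev a.rev = al D a b := by
  unfold al
  simp only [Fin.rev_rev, Fin.rev_inj]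
  simp only [eq_comm (a := a.rev), eq_comm (a := b) (b := a)]

theorem R12_fl (F : Fin m → Fin m → Fin m → ℝ) : R12 D (fl F) = fl (R23 D F) := by
  funext a b d
  have h1 : a.rev = b ↔ b = a.rev := eq_comm
  simp only [R12, R23, fl, Fin.rev_rev, Fin.rev_lt_rev, al_fl, h1]
  split_ifs with h1 h2 h2
  all_goals first | rfl | skip
  all_goals subst h2
  all_goals simp only [Fin.rev_rev]

theorem R23_fl (F : Fin m → Fin m → Fin m → ℝ) : R23 D (fl F) = fl (R12 D F) := by
  rw [← fl_fl (R23 D (fl F)), ← R12_fl, fl_fl]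

def YBE (F : Fin m → Fin m → Fin m → ℝ) (a b d : Fin m) : Prop :=
  R12 D (R23 D (R12 D F)) a b d = R23 D (R12 D (R23 D F)) a b d

theorem YBE_fl (F : Fin m → Fin m → Fin m → ℝ) (a b d : Fin m) (h : YBE D (fl F) d.rev b.rev a.rev) :
    YBE D F a b d := by
  unfold YBE at *
  rw [R12_fl, R23_fl, R12_fl, R23_fl, R12_fl, R23_fl] at h
  simpa [fl] using h.symm

theorem rowI (F : Fin m → Fin m → Fin m → ℝ) (a b d : Fin m) (h1 : b ≠ a.rev) (h2 : d ≠ b.rev) (h3 : d ≠ a.rev) :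
    YBE D F a b d := by
  have h1' : a ≠ b.rev := by rintro rfl; simp at h1
  have h2' : b ≠ d.rev := by rintro rfl; simp at h2
  have h3' : a ≠ d.rev := by rintro rfl; simp at h3
  have hq := D.hq
  have hl := D.hl
  unfold YBE
  simp only [R12, R23, al, h1, h2, h3, h1', h2', h3', if_false, sub_zero]
  rcases lt_trichotomy a b with hab | hab | hab <;> rcases lt_trichotomy b d with hbc | hbc | hbc <;>
   rcases lt_trichotomy a d with hac | hac | hac
  all_goals first | (exfalso; omega) | skip
  all_goals try subst hab
  all_goals try subst hbc
  all_goals try subst hac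
  all_goals simp only [*, lt_irrefl, if_true, if_false, not_lt_of_gt, ne_of_lt, ne_of_gt, hl]
  all_goals grind

theorem rowII (F : Fin m → Fin m → Fin m → ℝ) (a d : Fin m) (h2 : d ≠ a) (h3 : d ≠ a.rev) :
    YBE D F a a.rev d := by
  have h2' : d.rev ≠ a.rev := by simpa using h2
  have h3' : a ≠ d.rev := by rintro rfl; simp at h3
  have hq := D.hq
  have hl := D.hl
  have hca := D.hc a
  have hcd := D.hc d
  have hma := D.hmid a
  have hdd : d.rev < a.rev ↔ a < d := by simp
  have hdd' : d.rev < a ↔ a.rev < d := by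
    simp only [Fin.lt_def, Fin.val_rev] at *; omega
  have e1 : R12 D (R23 D (R12 D F)) a a.rev d = al D a a.rev * R23 D (R12 D F) a.rev a d
     + (if a < a.rev then D.l * R23 D (R12 D F) a a.rev d else 0)
     - D.l * (D.c a * sg D a.rev (fun s => H D F s s.rev d)) := by
    rw [R12_apply, if_pos rfl]; rfl
  have e2 : R12 D (R23 D F) a a.rev d = al D a a.rev * R23 D F a.rev a d
     + (if a < a.rev then D.l * R23 D F a a.rev d else 0)
     - D.l * (D.c a * sg D a.rev (fun s => R23 D F s s.rev d)) := by
    rw [R12_apply, if_pos rfl]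
  have e3 : R23 D (R12 D (R23 D F)) a a.rev d = al D a.rev d * R12 D (R23 D F) a d a.rev
     + (if a.rev < d then D.l * R12 D (R23 D F) a a.rev d else 0) := by
    rw [R23_apply, Fin.rev_rev, if_neg h2, sub_zero]
  unfold YBE
  rw [e1, e3, e2, T4, K_eq]
  simp only [R12_apply, R23_apply, al, th, Fin.rev_rev, h2, h3, h2', h3', h2.symm, h3.symm, h2'.symm, h3'.symm, if_false, sub_zero, if_true, hdd, hdd', lt_irrefl]
  clear e1 e2 e3
  have hz : D.z = D.q⁻¹ := by rw [eq_comm]; exact inv_eq_of_mul_eq_one_right hq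
  have hq0 : D.q ≠ 0 := left_ne_zero_of_mul_eq_one hq
  have hca0 : D.c a ≠ 0 := left_ne_zero_of_mul_eq_one hca
  have hca' : D.c a.rev = (D.c a)⁻¹ := by rw [eq_comm]; exact inv_eq_of_mul_eq_one_right hca
  by_cases hdm : d = d.rev
  · have hcd1 := D.hmid d hdm
    rcases lt_trichotomy a a.rev with g | g | g
    all_goals rcases lt_or_gt_of_ne h2 with g1 | g1 <;> rcases lt_or_gt_of_ne h3 with g2 | g2
    all_goals first | (exfalso; simp only [Fin.lt_def, Fin.ext_iff, Fin.val_rev] at *; omega) | skip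
    · simp only [← hdm, hcd1, g, g1, g2, g1.not_gt, g2.not_gt, g.not_gt, g.not_ge, g.ne, g.ne', if_true, if_false]
      simp only [hl, hz, hca']
      field_simp
      ring
    · simp only [← hdm, hcd1, g, g1, g2, g1.not_gt, g2.not_gt, g.not_gt, g.le, g.ne, g.ne', if_true, if_false]
      simp only [hl, hz, hca']
      field_simp
      ring
  simp only [Ne.symm hdm, hdm, if_false]
  rcases lt_trichotomy a a.rev with g | g | g
  · rcases lt_or_gt_of_ne h2 with g1 | g1 <;> rcases lt_or_gt_of_ne h3 with g2 | g2
    all_goals first | (exfalso; omega) | skip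
    all_goals simp only [g, g1, g2, g1.not_gt, g2.not_gt, g.not_gt, g.not_ge, g.ne, g.ne', if_true, if_false]
    all_goals simp only [hl, hz, hca']
    all_goals field_simp
    all_goals ring
  · rcases lt_or_gt_of_ne h2 with g1 | g1
    all_goals simp only [← g, hma g, g1, g1.not_gt, lt_irrefl, le_refl, if_true, if_false]
    all_goals simp only [hl, hz]
    all_goals field_simp
    all_goals ring
  · rcases lt_or_gt_of_ne h2 with g1 | g1 <;> rcases lt_or_gt_of_ne h3 with g2 | g2
    all_goals first | (exfalso; omega) | skip
    all_goals simp only [g, g1, g2, g1.not_gt, g2.not_gt, g.not_gt, g.le, g.ne, g.ne', if_true, if_false]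
    all_goals simp only [hl, hz, hca']
    all_goals field_simp
    all_goals ring

theorem E_eq (F : Fin m → Fin m → Fin m → ℝ) (n b : Fin m) :
    sg D n (fun s => R12 D F b s s.rev) = sg D n (fun s => R23 D (fl F) s s.rev b.rev) := by
  congr 1; funext s; rw [R23_fl]; simp [fl]

theorem G_eq (F : Fin m → Fin m → Fin m → ℝ) (n b : Fin m) :
    sg D n (fun s => R12 D (R23 D F) b s s.rev) = sg D n (fun s => H D (fl F) s s.rev b.rev) := by
  congr 1; funext s; unfold H; rw [R12_fl, R23_fl]; simp [fl]

theorem rowIII (F : Fin m → Fin m → Fin m → ℝ) (a b : Fin m) (h2 : b ≠ a) (h3 : b ≠ a.rev) :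
    YBE D F a b a.rev := by
  have h2' : b.rev ≠ a.rev := by simpa using h2
  have h3' : a ≠ b.rev := by rintro rfl; simp at h3
  have hq := D.hq
  have hl := D.hl
  have hca := D.hc a
  have hcd := D.hc b
  have hma := D.hmid a
  have hdd : b.rev < a.rev ↔ a < b := by simp
  have e1 : R12 D (R23 D (R12 D F)) a b a.rev = al D a b * R23 D (R12 D F) b a a.rev
     + (if a < b then D.l * R23 D (R12 D F) a b a.rev else 0) := by
    rw [R12_apply, if_neg h3, sub_zero]
  have e2 : R23 D (R12 D F) b a a.rev = al D a a.rev * R12 D F b a.rev a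
     + (if a < a.rev then D.l * R12 D F b a a.rev else 0)
     - D.l * (D.c a * sg D a.rev (fun s => R12 D F b s s.rev)) := by
    rw [R23_apply, if_pos rfl]
  have e3 : R23 D (R12 D (R23 D F)) a b a.rev = al D b a.rev * R12 D (R23 D F) a a.rev b
     + (if b < a.rev then D.l * R12 D (R23 D F) a b a.rev else 0) := by
    rw [R23_apply, if_neg h2'.symm, sub_zero]
  have e4 : R12 D (R23 D F) a a.rev b = al D a a.rev * R23 D F a.rev a b
     + (if a < a.rev then D.l * R23 D F a a.rev b else 0)
     - D.l * (D.c a * sg D a.rev (fun s => R23 D F s s.rev b)) := by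
    rw [R12_apply, if_pos rfl]
  unfold YBE
  rw [e1, e3, e2, e4, E_eq, K_eq, K_eq]
  simp only [R12_apply, R23_apply, al, fl, Fin.rev_rev, h2, h3, h2', h3', h2.symm, h3.symm, h2'.symm, h3'.symm, if_false, sub_zero, if_true, hdd, lt_irrefl]
  clear e1 e2 e3 e4
  have hz : D.z = D.q⁻¹ := by rw [eq_comm]; exact inv_eq_of_mul_eq_one_right hq
  have hq0 : D.q ≠ 0 := left_ne_zero_of_mul_eq_one hq
  have hca0 : D.c a ≠ 0 := left_ne_zero_of_mul_eq_one hca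
  by_cases hdm : b = b.rev
  · have hcd1 := D.hmid b hdm
    simp only [← hdm, hcd1, if_true, if_false, hl, hz]
    rcases lt_trichotomy a a.rev with g | g | g
    all_goals rcases lt_or_gt_of_ne h2 with g1 | g1 <;> rcases lt_or_gt_of_ne h3 with g2 | g2
    all_goals first | (exfalso; simp only [Fin.lt_def, Fin.ext_iff, Fin.val_rev] at *; omega) | skip
    all_goals simp only [g1, g2, g1.not_gt, g2.not_gt, g, g.not_gt, if_true, if_false]
    all_goals field_simp
    all_goals ring
  simp only [Ne.symm hdm, hdm, if_false, hl, hz]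
  rcases lt_trichotomy a a.rev with g | g | g
  · rcases lt_or_gt_of_ne h2 with g1 | g1 <;> rcases lt_or_gt_of_ne h3 with g2 | g2
    all_goals first | (exfalso; omega) | skip
    all_goals simp only [g, g1, g2, g1.not_gt, g2.not_gt, g.not_gt, g.ne, g.ne', if_true, if_false]
    all_goals field_simp
    all_goals ring
  · rcases lt_or_gt_of_ne h2 with g1 | g1
    all_goals simp only [← g, hma g, g1, g1.not_gt, lt_irrefl, if_true, if_false]
    all_goals field_simp
    all_goals ring
  · rcases lt_or_gt_of_ne h2 with g1 | g1 <;> rcases lt_or_gt_of_ne h3 with g2 | g2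
    all_goals first | (exfalso; omega) | skip
    all_goals simp only [g, g1, g2, g1.not_gt, g2.not_gt, g.not_gt, g.ne, g.ne', if_true, if_false]
    all_goals field_simp
    all_goals ring

theorem rowV (F : Fin m → Fin m → Fin m → ℝ) (a : Fin m) (h : a ≠ a.rev) :
    YBE D F a a.rev a.rev := by
  have hq := D.hq
  have hl := D.hl
  have hca := D.hc a
  have e1 : R12 D (R23 D (R12 D F)) a a.rev a.rev = al D a a.rev * R23 D (R12 D F) a.rev a a.rev
     + (if a < a.rev then D.l * R23 D (R12 D F) a a.rev a.rev else 0)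
     - D.l * (D.c a * sg D a.rev (fun s => H D F s s.rev a.rev)) := by
    rw [R12_apply, if_pos rfl]; rfl
  have e2 : R23 D (R12 D F) a.rev a a.rev = al D a a.rev * R12 D F a.rev a.rev a
     + (if a < a.rev then D.l * R12 D F a.rev a a.rev else 0)
     - D.l * (D.c a * sg D a.rev (fun s => R12 D F a.rev s s.rev)) := by
    rw [R23_apply, if_pos rfl]
  have e3 : R23 D (R12 D (R23 D F)) a a.rev a.rev = al D a.rev a.rev * R12 D (R23 D F) a a.rev a.rev := by
    rw [R23_apply, Fin.rev_rev, if_neg h.symm, if_neg (lt_irrefl _), sub_zero, add_zero]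
  have e4 : R12 D (R23 D F) a a.rev a.rev = al D a a.rev * R23 D F a.rev a a.rev
     + (if a < a.rev then D.l * R23 D F a a.rev a.rev else 0)
     - D.l * (D.c a * sg D a.rev (fun s => R23 D F s s.rev a.rev)) := by
    rw [R12_apply, if_pos rfl]
  unfold YBE
  rw [e1, e3, e2, e4, E_eq, K_eq, K_eq, T4]
  simp only [R12_apply, R23_apply, al, th, fl, Fin.rev_rev, h, h.symm, if_false, sub_zero, if_true, lt_irrefl]
  clear e1 e2 e3 e4
  have hz : D.z = D.q⁻¹ := by rw [eq_comm]; exact inv_eq_of_mul_eq_one_right hq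
  have hq0 : D.q ≠ 0 := left_ne_zero_of_mul_eq_one hq
  have hca0 : D.c a ≠ 0 := left_ne_zero_of_mul_eq_one hca
  have hca' : D.c a.rev = (D.c a)⁻¹ := by rw [eq_comm]; exact inv_eq_of_mul_eq_one_right hca
  simp only [hl, hz, hca']
  rcases lt_or_gt_of_ne h with g | g
  all_goals simp only [g, g.not_gt, g.le, g.not_ge, if_true, if_false]
  all_goals field_simp
  all_goals ring

theorem rowIV (F : Fin m → Fin m → Fin m → ℝ) (a : Fin m) :
    YBE D F a a.rev a := by
  have hq := D.hq
  have hl := D.hl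
  have hca := D.hc a
  have hz : D.z = D.q⁻¹ := by rw [eq_comm]; exact inv_eq_of_mul_eq_one_right hq
  have hq0 : D.q ≠ 0 := left_ne_zero_of_mul_eq_one hq
  have hca0 : D.c a ≠ 0 := left_ne_zero_of_mul_eq_one hca
  have hca' : D.c a.rev = (D.c a)⁻¹ := by rw [eq_comm]; exact inv_eq_of_mul_eq_one_right hca
  have e1 : R12 D (R23 D (R12 D F)) a a.rev a = al D a a.rev * R23 D (R12 D F) a.rev a a
     + (if a < a.rev then D.l * R23 D (R12 D F) a a.rev a else 0)
     - D.l * (D.c a * sg D a.rev (fun s => H D F s s.rev a)) := by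
    rw [R12_apply, if_pos rfl]; rfl
  have e2 : R23 D (R12 D F) a a.rev a = al D a.rev a * R12 D F a a a.rev
     + (if a.rev < a then D.l * R12 D F a a.rev a else 0)
     - D.l * (D.c a.rev * sg D a (fun s => R12 D F a s s.rev)) := by
    rw [R23_apply, Fin.rev_rev, if_pos rfl]
  have e3 : R23 D (R12 D (R23 D F)) a a.rev a = al D a.rev a * R12 D (R23 D F) a a a.rev
     + (if a.rev < a then D.l * R12 D (R23 D F) a a.rev a else 0)
     - D.l * (D.c a.rev * sg D a (fun s => R12 D (R23 D F) a s s.rev)) := by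
    rw [R23_apply, Fin.rev_rev, if_pos rfl]
  have e4 : R12 D (R23 D F) a a.rev a = al D a a.rev * R23 D F a.rev a a
     + (if a < a.rev then D.l * R23 D F a a.rev a else 0)
     - D.l * (D.c a * sg D a.rev (fun s => R23 D F s s.rev a)) := by
    rw [R12_apply, if_pos rfl]
  unfold YBE
  by_cases h : a = a.rev
  · have hca1 := D.hmid a h
    rw [← h] at e1 e2 e3 e4
    rw [← h, e1, e3, G_eq, e2, e4, E_eq, K_eq, K_eq, T4, T4]
    simp only [R12_apply, R23_apply, al, th, fl, ← h, Fin.rev_rev, if_true, lt_irrefl, le_refl, if_false, hca1, hl, hz]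
    field_simp
    ring
  · rw [e1, e3, G_eq, e2, e4, E_eq, K_eq, K_eq, T4, T4]
    simp only [R12_apply, R23_apply, al, th, fl, Fin.rev_rev, h, Ne.symm h, if_false, sub_zero, if_true, lt_irrefl]
    simp only [hl, hz, hca']
    rcases lt_or_gt_of_ne h with g | g
    all_goals simp only [g, g.not_gt, g.le, g.not_ge, if_true, if_false]
    all_goals field_simp
    all_goals ring

theorem ybe (F : Fin m → Fin m → Fin m → ℝ) : R12 D (R23 D (R12 D F)) = R23 D (R12 D (R23 D F)) := by
  funext a b d
  change YBE D F a b d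
  by_cases h1 : b = a.rev
  · subst h1
    by_cases h2 : d = a
    · subst h2; exact rowIV D F d
    by_cases h3 : d = a.rev
    · subst h3; exact rowV D F a (Ne.symm h2)
    exact rowII D F a d h2 h3
  by_cases h2 : d = b.rev
  · subst h2
    apply YBE_fl
    rw [Fin.rev_rev]
    by_cases h3 : a = b
    · subst h3
      exact rowV D _ a (fun h => h1 h)
    exact rowII D _ b a.rev (by rintro rfl; simp at h1) (by simpa using h3)
  by_cases h3 : d = a.rev
  · subst h3
    exact rowIII D F a b (fun h => h2 (by rw [h])) h1
  exact rowI D F a b d h1 h2 h3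
end
end YB

section
variable {q : ℝ} {m : ℕ}

theorem rho_rev (i : Fin m) : rho m i.rev = - rho m i := by
  have h := i.2
  unfold rho
  have e : ((i.rev : ℕ) : ℝ) = m - 1 - (i : ℕ) := by
    rw [Fin.val_rev, Nat.cast_sub (by omega)]; push_cast; ring
  rw [e]
  simp only [Fin.val_rev]
  split_ifs <;> first | (exfalso; omega) | ring

theorem wt_rev (hq : 0 < q) (i : Fin m) : wt q m i * wt q m i.rev = 1 := by
  unfold wt; rw [rho_rev, ← Real.rpow_add hq]; simp

theorem wt_mid (i : Fin m) (h : i = i.rev) : wt q m i = 1 := by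
  have h2 := congrArg Fin.val h
  have h3 := i.2
  rw [Fin.val_rev] at h2
  unfold wt rho
  rw [if_neg (by omega), if_pos (by omega)]; simp

noncomputable def tht (q : ℝ) (n : Fin m) : ℝ :=
  if n.rev < n then q - q⁻¹ else if n = n.rev then 1 - q⁻¹ else 0

theorem wt_sq (hq : 0 < q) (i : Fin m) : wt q m i ^ 2 = q ^ (-2 * rho m i) := by
  unfold wt; rw [← Real.rpow_natCast, ← Real.rpow_mul hq.le]; congr 1; push_cast; ring

theorem prefix_sum (hq : 0 < q) (k : ℕ) (hk : k < m) :
    (q - q⁻¹) * ∑ s ∈ Iio (⟨k, hk⟩ : Fin m), wt q m s ^ 2 =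
      q⁻¹ * wt q m ⟨k, hk⟩ ^ 2 + tht q ⟨k, hk⟩ - q ^ (1 - (m : ℝ)) := by
  induction k with
  | zero =>
    have : Iio (⟨0, hk⟩ : Fin m) = ∅ := by ext s; simp [Fin.lt_def]
    rw [this, sum_empty, mul_zero, wt_sq hq]
    have e1 : q⁻¹ = q ^ (-1 : ℝ) := (Real.rpow_neg_one q).symm
    unfold tht rho
    simp only [Fin.lt_def, Fin.ext_iff, Fin.val_rev]
    by_cases h : m = 1
    · subst h; simp
    · rw [if_pos (by omega), if_neg (by omega), if_neg (by omega), e1, ← Real.rpow_add hq]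
      simp only [CharP.cast_eq_zero]
      ring_nf
  | succ k ih =>
    have hk' : k < m := by omega
    have e : Iio (⟨k + 1, hk⟩ : Fin m) = insert ⟨k, hk'⟩ (Iio ⟨k, hk'⟩) := by
      ext s; simp only [mem_Iio, mem_insert, Fin.lt_def, Fin.ext_iff]; omega
    rw [e, sum_insert (by simp), mul_add, ih hk', wt_sq hq, wt_sq hq]
    have hq0 := hq.ne'
    have step : ∀ r : ℝ, q⁻¹ * q ^ (-2 * (r - 1)) = q * q ^ (-2 * r) := by
      intro r
      rw [show -2 * (r - 1) = -2 * r + 1 + 1 by ring, Real.rpow_add hq, Real.rpow_add hq]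
      simp; field_simp
    unfold tht rho
    simp only [Fin.lt_def, Fin.ext_iff, Fin.val_rev]
    rcases lt_trichotomy (2 * k + 2) m with h | h | h
    · by_cases h2 : 2 * k + 3 = m
      · subst h2
        split_ifs
        all_goals first | (exfalso; omega) | skip
        have : (-2 * (((2 * k + 3 : ℕ) : ℝ) / 2 - 1 - (k : ℝ))) = -1 := by push_cast; ring
        rw [this, Real.rpow_neg_one]
        simp only [mul_zero, Real.rpow_zero]
        linear_combination mul_inv_cancel₀ hq0
      · split_ifs
        all_goals first | (exfalso; omega) | skip
        have := step ((m : ℝ) / 2 - 1 - (k : ℕ))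
        rw [show (m : ℝ) / 2 - 1 - ((k + 1 : ℕ) : ℝ) = (m : ℝ) / 2 - 1 - (k : ℕ) - 1 by push_cast; ring, this]
        ring
    · subst h
      split_ifs
      all_goals first | (exfalso; omega) | skip
      have h1 : (-2 * (((2 * k + 2 : ℕ) : ℝ) / 2 - 1 - (k : ℝ))) = 0 := by push_cast; ring
      have h2 : (-2 * (((2 * k + 2 : ℕ) : ℝ) / 2 - ((k + 1 : ℕ) : ℝ))) = 0 := by push_cast; ring
      rw [h1, h2]; simp
    · by_cases h2 : 2 * k + 1 = m
      · subst h2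
        split_ifs
        all_goals first | (exfalso; omega) | skip
        have h1 : (-2 * (((2 * k + 1 : ℕ) : ℝ) / 2 - ((k + 1 : ℕ) : ℝ))) = 1 := by push_cast; ring
        rw [h1]
        simp only [mul_zero, Real.rpow_zero, Real.rpow_one]
        linear_combination - mul_inv_cancel₀ hq0
      · split_ifs
        all_goals first | (exfalso; omega) | skip
        have := step ((m : ℝ) / 2 - (k : ℕ))
        rw [show (m : ℝ) / 2 - ((k + 1 : ℕ) : ℝ) = (m : ℝ) / 2 - (k : ℕ) - 1 by push_cast; ring, this]
        ring

theorem prefix_sum' (hq : 0 < q) (n : Fin m) :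
    (q - q⁻¹) * ∑ s ∈ Iio n, wt q m s ^ 2 =
      q⁻¹ * wt q m n ^ 2 + tht q n - q ^ (1 - (m : ℝ)) := prefix_sum hq n.1 n.2

noncomputable def wtData (hq : 0 < q) (m : ℕ) : YB.Wt m where
  q := q
  z := q⁻¹
  l := q - q⁻¹
  hl := rfl
  hq := mul_inv_cancel₀ hq.ne'
  c := wt q m
  hc := wt_rev hq
  hmid := wt_mid
  hS := by
    intro lo hi h
    have e : Iio hi = Ioo lo hi ∪ insert lo (Iio lo) := by
      ext s; simp only [mem_Iio, mem_union, mem_Ioo, mem_insert]; omega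
    have h1 := prefix_sum' hq hi
    have h2 := prefix_sum' hq lo
    rw [e, sum_union, sum_insert (by simp)] at h1
    · unfold tht at h1 h2
      linear_combination h1 - h2
    · rw [disjoint_left]; intro s; simp only [mem_Ioo, mem_insert, mem_Iio]; omega

theorem sum_metric (hm : 0 < m) (hq : 0 < q) :
    (q - q⁻¹) * ∑ i, ∑ j, metric q m i j * metric q m i j = q ^ ((m : ℝ) - 1) + q - q⁻¹ - q ^ (1 - (m : ℝ)) := by
  have e : ∑ i, ∑ j, metric q m i j * metric q m i j = ∑ i, wt q m i ^ 2 := by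
    refine sum_congr rfl fun i _ => ?_
    simp [metric, pow_two]
  have hl : m - 1 < m := by omega
  have e2 : (univ : Finset (Fin m)) = insert ⟨m - 1, hl⟩ (Iio ⟨m - 1, hl⟩) := by
    ext s; have := s.2; simp only [mem_univ, mem_insert, mem_Iio, Fin.lt_def, Fin.ext_iff, true_iff]; omega
  rw [e, e2, sum_insert (by simp), mul_add, prefix_sum hq, wt_sq hq]
  have hq0 := hq.ne'
  unfold tht rho
  simp only [Fin.lt_def, Fin.ext_iff, Fin.val_rev]
  by_cases h : m = 1
  · subst h; simp; ring
  · rw [if_neg (by omega), if_neg (by omega), if_pos (by omega)]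
    rw [show (-2 * ((m : ℝ) / 2 - ((m - 1 : ℕ) : ℝ))) = (m : ℝ) - 1 - 1 by
      rw [Nat.cast_sub (by omega)]; push_cast; ring]
    rw [Real.rpow_sub_one hq0]
    field_simp; ring

end
section
variable {q : ℝ} {m : ℕ}

theorem wtData_q (hq : 0 < q) : (wtData hq m).q = q := rfl

theorem wtData_z (hq : 0 < q) : (wtData hq m).z = q⁻¹ := rfl

theorem wtData_l (hq : 0 < q) : (wtData hq m).l = q - q⁻¹ := rfl

theorem wtData_c (hq : 0 < q) (i : Fin m) : (wtData hq m).c i = wt q m i := rfl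

theorem sum_rmat (hq : 0 < q) (f : Fin m → Fin m → ℝ) (a b d : Fin m) :
    ∑ y : Fin m × Fin m, rmat q m (a, b) y * f y.1 y.2 = YB.R12 (wtData hq m) (fun s t _ => f s t) a b d := by
  have e : ∀ y : Fin m × Fin m, rmat q m (a, b) y * f y.1 y.2 =
      (if y = (b, a) then YB.al (wtData hq m) a b * f b a else 0)
      + (if y = (a, b) then (if a < b then (q - q⁻¹) * f a b else 0) else 0)
      - (if y.2 = y.1.rev then (if b = a.rev then (if y.1 < a.rev then (q - q⁻¹) * (wt q m a * (wt q m y.1 * f y.1 y.1.rev)) else 0) else 0) else 0) := by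
    rintro ⟨s, t⟩
    unfold rmat metric YB.al
    simp only [Matrix.of_apply, wtData_q, wtData_z, Prod.mk.injEq, sub_mul, add_mul]
    congr 1
    · congr 1
      · by_cases h : s = b ∧ t = a
        · obtain ⟨rfl, rfl⟩ := h; simp
        · rw [if_neg h, if_neg (by tauto), zero_mul]
      · by_cases h : s = a ∧ t = b
        · obtain ⟨rfl, rfl⟩ := h; simp only [and_self, true_and, if_true]; split_ifs <;> ring
        · rw [if_neg h, if_neg (by rintro ⟨⟨rfl, rfl⟩, -⟩; simp at h), zero_mul]
    · by_cases h : t = s.rev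
      · subst h
        split_ifs <;> ring
      · simp [h]
  simp only [e, sum_add_distrib, sum_sub_distrib, sum_ite_eq', mem_univ, if_true]
  rw [YB.R12_apply]
  congr 1
  rw [Fintype.sum_prod_type]
  simp only [sum_ite_eq', mem_univ, if_true]
  by_cases h : b = a.rev
  · simp only [h, if_true]
    rw [YB.sg_ite]
    simp only [mul_sum]
    refine sum_congr rfl fun s _ => ?_
    simp only [wtData_q, wtData_z, wtData_l, wtData_c]
    split_ifs <;> ring
  · simp [h]

theorem rmul (hq : 0 < q) (M : Matrix (Fin m × Fin m) (Fin m × Fin m) ℝ) (a b d : Fin m) (y : Fin m × Fin m) :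
    (rmat q m * M) (a, b) y = YB.R12 (wtData hq m) (fun s t _ => M (s, t) y) a b d := by
  rw [Matrix.mul_apply, ← sum_rmat hq]

theorem rmat_kmat (hq : 0 < q) : rmat q m * kmat q m = q ^ (1 - (m : ℝ)) • kmat q m := by
  ext ⟨a, b⟩ y
  rw [rmul hq _ a b a, YB.R12_apply, Matrix.smul_apply, smul_eq_mul]
  unfold kmat metric
  simp only [Matrix.of_apply]
  have hca := wt_rev (m := m) hq a
  have hp := prefix_sum' hq a.rev
  by_cases h : b = a.rev
  · subst h
    have e : YB.sg (wtData hq m) a.rev (fun s => (if s.rev = s.rev then wt q m s else 0) *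
        (if y.2 = y.1.rev then wt q m y.1 else 0)) =
        (∑ s ∈ Iio a.rev, wt q m s ^ 2) * (if y.2 = y.1.rev then wt q m y.1 else 0) := by
      unfold YB.sg
      rw [sum_mul]; refine sum_congr rfl fun s _ => ?_
      simp only [if_true, wtData_q, wtData_z, wtData_l, wtData_c]; ring
    simp only [Fin.rev_rev, if_true] at e ⊢
    rw [e]
    simp only [wtData_q, wtData_z, wtData_l, wtData_c, YB.al, if_true]
    generalize (if y.2 = y.1.rev then wt q m y.1 else 0) = w
    unfold tht at hp
    simp only [Fin.rev_rev] at hp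
    have hm := wt_mid (q := q) a
    rcases lt_trichotomy a a.rev with g | g | g
    · simp only [g, g.ne, if_true, if_false] at hp ⊢
      linear_combination (- wt q m a * w) * hp - q⁻¹ * wt q m a.rev * w * hca
    · have h1 := hm g
      simp only [← g, lt_irrefl, if_true, if_false, h1] at hp ⊢
      linear_combination (- w) * hp
    · simp only [g.not_gt, g.ne', g.ne, if_true, if_false] at hp ⊢
      linear_combination (- wt q m a * w) * hp - q⁻¹ * wt q m a.rev * w * hca
  · have h' : a ≠ b.rev := by rintro rfl; simp at h
    simp [h, h']

theorem rmat_transpose : (rmat q m).transpose = rmat q m := by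
  ext ⟨a, b⟩ ⟨c, d⟩
  rw [Matrix.transpose_apply]
  unfold rmat metric
  simp only [Matrix.of_apply, Prod.mk.injEq]
  have e1 : a < c.rev ↔ c < a.rev := by simp only [Fin.lt_def, Fin.val_rev]; omega
  have e2 : (c = b ∧ d = a) ↔ (a = d ∧ b = c) := by
    rw [eq_comm (a := c), eq_comm (a := d), and_comm]
  have e3 : (c = a ∧ d = b) ↔ (a = c ∧ b = d) := by
    rw [eq_comm (a := c), eq_comm (a := d)]
  simp only [e1, e2, e3]
  have e4 : (if a = d ∧ b = c then (if d = c.rev then (if c = d then 1 else q⁻¹) else if c = d then q else 1) else 0)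
      = (if a = d ∧ b = c then (if b = a.rev then (if a = b then 1 else q⁻¹) else if a = b then q else 1) else 0) := by
    by_cases h : a = d ∧ b = c
    · obtain ⟨rfl, rfl⟩ := h
      have : a = b.rev ↔ b = a.rev := by
        constructor <;> (intro h; rw [h]; simp)
      simp only [this, eq_comm (a := a) (b := b)]
    · rw [if_neg h, if_neg h]
  have e5 : (if (a = c ∧ b = d) ∧ c < d then q - q⁻¹ else 0) = if (a = c ∧ b = d) ∧ a < b then q - q⁻¹ else 0 := by
    by_cases h : a = c ∧ b = d
    · obtain ⟨rfl, rfl⟩ := h; rfl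
    · rw [if_neg (by tauto), if_neg (by tauto)]
  rw [e4, e5]
  congr 1
  split_ifs <;> ring

theorem kmat_transpose : (kmat q m).transpose = kmat q m := by
  ext x y
  simp only [kmat, Matrix.transpose_apply, Matrix.of_apply]; ring

theorem kmat_rmat (hq : 0 < q) : kmat q m * rmat q m = q ^ (1 - (m : ℝ)) • kmat q m := by
  have := congrArg Matrix.transpose (rmat_kmat (m := m) hq)
  rwa [Matrix.transpose_mul, rmat_transpose, Matrix.transpose_smul, kmat_transpose] at this

theorem sg_R12 (hq : 0 < q) (f : Fin m → Fin m → ℝ) (n d : Fin m) :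
    YB.sg (wtData hq m) n (fun s => YB.R12 (wtData hq m) (fun s t _ => f s t) s s.rev d) =
      q ^ (1 - (m : ℝ)) * (∑ t, wt q m t * f t t.rev)
      - YB.al (wtData hq m) n n.rev * wt q m n * f n.rev n
      + (q - q⁻¹) * (if n ≤ n.rev then YB.sg (wtData hq m) n (fun s => f s s.rev)
          else YB.sg (wtData hq m) n.rev (fun s => f s s.rev))
      - (q⁻¹ * wt q m n ^ 2 + tht q n) * YB.sg (wtData hq m) n.rev (fun s => f s s.rev) := by
  have hp : ∀ n t : Fin m, (q - q⁻¹) * ∑ s ∈ Iio n, (if t < s.rev then wt q m s ^ 2 else 0) =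
      (if t.rev < n then q⁻¹ * wt q m t.rev ^ 2 + tht q t.rev else q⁻¹ * wt q m n ^ 2 + tht q n)
        - q ^ (1 - (m : ℝ)) := by
    intro n t
    have e : ∑ s ∈ Iio n, (if t < s.rev then wt q m s ^ 2 else 0) = ∑ s ∈ Iio (min n t.rev), wt q m s ^ 2 := by
      rw [← Finset.sum_filter]; congr 1; ext s
      simp only [mem_filter, mem_Iio, lt_min_iff, Fin.lt_def, Fin.val_rev]; omega
    rw [e]
    split_ifs with h
    · rw [min_eq_right h.le, prefix_sum' hq]
    · rw [min_eq_left (not_lt.1 h), prefix_sum' hq]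
  have e0 : YB.sg (wtData hq m) n (fun s => YB.R12 (wtData hq m) (fun s t _ => f s t) s s.rev d) =
      (∑ s, if s < n then wt q m s * (YB.al (wtData hq m) s s.rev * f s.rev s) else 0)
      + (∑ s, if s < n ∧ s < s.rev then (q - q⁻¹) * wt q m s * f s s.rev else 0)
      - ∑ t, wt q m t * f t t.rev * ((q - q⁻¹) * ∑ s ∈ Iio n, (if t < s.rev then wt q m s ^ 2 else 0)) := by
    have e1 : ∑ t, wt q m t * f t t.rev * ((q - q⁻¹) * ∑ s ∈ Iio n, (if t < s.rev then wt q m s ^ 2 else 0))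
        = ∑ s, if s < n then (q - q⁻¹) * wt q m s ^ 2 * YB.sg (wtData hq m) s.rev (fun s => f s s.rev) else 0 := by
      simp only [mul_sum]
      rw [sum_comm, ← Finset.sum_filter]
      have : (univ.filter fun s => s < n) = Iio n := by ext; simp
      rw [this]
      refine sum_congr rfl fun s _ => ?_
      rw [YB.sg_ite, mul_sum]
      refine sum_congr rfl fun t _ => ?_
      simp only [wtData_q, wtData_z, wtData_l, wtData_c]; split_ifs <;> ring
    rw [e1, YB.sg_ite, ← sum_add_distrib, ← sum_sub_distrib]
    refine sum_congr rfl fun s _ => ?_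
    rw [YB.R12_apply]
    by_cases h1 : s < n <;> by_cases h2 : s < s.rev <;> simp only [h1, h2, and_true, and_false, if_true, if_false, wtData_q, wtData_z, wtData_l, wtData_c] <;> ring
  have e1 : (∑ s, if s < n then wt q m s * (YB.al (wtData hq m) s s.rev * f s.rev s) else 0)
     = ∑ t, if t.rev < n then wt q m t.rev * (YB.al (wtData hq m) t.rev t * f t t.rev) else 0 := by
    rw [← Equiv.sum_comp Fin.revPerm]; simp
  have e2 : YB.al (wtData hq m) n n.rev * wt q m n * f n.rev n =
      ∑ t, if t = n.rev then YB.al (wtData hq m) n n.rev * wt q m n * f n.rev n else 0 := by simp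
  have e3 : (if n ≤ n.rev then YB.sg (wtData hq m) n (fun s => f s s.rev)
          else YB.sg (wtData hq m) n.rev (fun s => f s s.rev)) =
      ∑ t, if t < n ∧ t < n.rev then wt q m t * f t t.rev else 0 := by
    split_ifs with h
    · rw [YB.sg_ite]; refine sum_congr rfl fun s _ => ?_
      by_cases h1 : s < n
      · simp [h1, h1.trans_le h, wtData_q, wtData_z, wtData_l, wtData_c]
      · simp [h1]
    · rw [YB.sg_ite]; refine sum_congr rfl fun s _ => ?_
      by_cases h1 : s < n.rev
      · simp [h1, h1.trans (not_le.1 h), wtData_q, wtData_z, wtData_l, wtData_c]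
      · simp [h1]
  rw [e0, e1, e2, e3, YB.sg_ite, mul_sum, mul_sum, mul_sum, ← sum_add_distrib, ← sum_sub_distrib, ← sum_sub_distrib,
    ← sum_add_distrib, ← sum_sub_distrib]
  refine sum_congr rfl fun t _ => ?_
  rw [hp]
  have ht := wt_rev (m := m) hq t
  have hmt := wt_mid (q := q) t
  have hmn := wt_mid (q := q) n
  have hn := wt_rev (m := m) hq n
  simp only [wtData_q, wtData_z, wtData_l, wtData_c, YB.al, Fin.rev_rev, tht, if_true]
  rcases lt_trichotomy t n.rev with h | h | h
  · have h1 : ¬ t.rev < n := by simp only [Fin.lt_def, Fin.le_def, Fin.val_rev] at *; omega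
    have h2 : t < n ∧ t < t.rev ↔ t < n := by simp only [Fin.lt_def, Fin.le_def, Fin.val_rev] at *; omega
    simp only [h1, h2, h, h.ne, and_true, if_true, if_false]
    split_ifs <;> ring
  · subst h
    simp only [Fin.rev_rev, lt_irrefl, and_false, if_true, if_false]
    rcases lt_trichotomy n n.rev with g | g | g
    · simp only [g.not_gt, g.ne, false_and, if_false]; linear_combination (-q⁻¹ * wt q m n * f n.rev n) * hn
    · simp only [← g, lt_irrefl, and_false, if_true, if_false, hmn g]; ring
    · simp only [g, g.ne', and_self, if_true, if_false]; linear_combination (-q⁻¹ * wt q m n * f n.rev n) * hn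
  · have h1 : t.rev < n := by simp only [Fin.lt_def, Fin.le_def, Fin.val_rev] at *; omega
    have h2 : t < n ∧ t < t.rev ↔ t < t.rev := by simp only [Fin.lt_def, Fin.le_def, Fin.val_rev] at *; omega
    simp only [h1, h2, h.not_gt, h.ne', and_false, if_true, if_false]
    rcases lt_trichotomy t t.rev with g | g | g
    · simp only [g, g.ne', if_true, if_false]; linear_combination (-q⁻¹ * wt q m t.rev * f t t.rev) * ht
    · simp only [← g, lt_irrefl, if_true, if_false, hmt g]; ring
    · simp only [g.not_gt, g.ne, if_true, if_false]; linear_combination (-q⁻¹ * wt q m t.rev * f t t.rev) * ht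

theorem skein (hq : 0 < q) :
    rmat q m * rmat q m = 1 + (q - q⁻¹) • rmat q m - ((q - q⁻¹) * q ^ (1 - (m : ℝ))) • kmat q m := by
  ext ⟨a, b⟩ y
  have hr : ∀ a b, rmat q m (a, b) y = YB.R12 (wtData hq m)
      (fun s t _ => (1 : Matrix (Fin m × Fin m) (Fin m × Fin m) ℝ) (s, t) y) a b a := by
    intro a b; rw [← rmul hq _ a b a, mul_one]
  have hr' : ∀ a b d, rmat q m (a, b) y = YB.R12 (wtData hq m)
      (fun s t _ => (1 : Matrix (Fin m × Fin m) (Fin m × Fin m) ℝ) (s, t) y) a b d := fun a b d => hr a b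
  have hk : kmat q m (a, b) y = metric q m a b * ∑ t, wt q m t * (1 : Matrix (Fin m × Fin m) (Fin m × Fin m) ℝ) (t, t.rev) y := by
    unfold kmat
    simp only [Matrix.of_apply]
    congr 1
    rw [Finset.sum_eq_single y.1]
    · obtain ⟨c, d⟩ := y
      simp only [metric, Matrix.one_apply, Prod.mk.injEq, true_and, eq_comm (a := d)]
      split_ifs <;> simp
    · intro s _ hs
      rw [Matrix.one_apply_ne, mul_zero]; rintro rfl; simp at hs
    · simp
  rw [rmul hq _ a b a, Matrix.sub_apply, Matrix.add_apply, Matrix.smul_apply, Matrix.smul_apply, hk]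
  generalize hf : (fun s t => (1 : Matrix (Fin m × Fin m) (Fin m × Fin m) ℝ) (s, t) y) = f at *
  have hf' : ∀ s t, (1 : Matrix (Fin m × Fin m) (Fin m × Fin m) ℝ) (s, t) y = f s t := fun s t => by rw [← hf]
  simp only [hf'] at *
  have hsg : YB.sg (wtData hq m) a.rev (fun s => rmat q m (s, s.rev) y) =
     YB.sg (wtData hq m) a.rev (fun s => YB.R12 (wtData hq m) (fun s t _ => f s t) s s.rev a) := by
    congr 1; funext s; exact hr' _ _ _
  have hqq := mul_inv_cancel₀ hq.ne'
  have hca := wt_rev (m := m) hq a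
  rw [YB.R12_apply, hsg, sg_R12]
  simp only [hr, smul_eq_mul]
  simp only [YB.R12_apply, metric]
  by_cases h : b = a.rev
  · subst h
    have hm := wt_mid (q := q) a
    simp only [wtData_q, wtData_z, wtData_l, wtData_c, YB.al, Fin.rev_rev, tht, if_true]
    rcases lt_trichotomy a a.rev with g | g | g
    · simp only [g, g.ne, g.ne', g.not_gt, g.not_ge, if_true, if_false]
      linear_combination ((q - q⁻¹) * q⁻¹ * f a a.rev) * hca + (f a a.rev) * hqq
        + ((q - q⁻¹) * q⁻¹ * YB.sg (wtData hq m) a (fun s => f s s.rev) * wt q m a.rev) * hca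
    · simp only [← g, lt_irrefl, le_refl, if_true, if_false, hm g]
      ring
    · simp only [g, g.le, g.ne, g.ne', g.not_gt, if_true, if_false]
      linear_combination ((q - q⁻¹) * q⁻¹ * f a a.rev) * hca + (f a a.rev) * hqq
        + ((q - q⁻¹) * q⁻¹ * YB.sg (wtData hq m) a (fun s => f s s.rev) * wt q m a.rev) * hca
  · have h' : a ≠ b.rev := by rintro rfl; simp at h
    simp only [h, h', wtData_q, wtData_z, wtData_l, wtData_c, YB.al, if_false]
    rcases lt_trichotomy a b with g | g | g
    · simp only [g, g.ne, g.ne', g.not_gt, if_true, if_false]; ring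
    · subst g
      simp only [lt_irrefl, if_true, if_false]; linear_combination (f a a) * hqq
    · simp only [g, g.ne, g.ne', g.not_gt, if_true, if_false]; ring

end
section
variable {q : ℝ} {m : ℕ}

theorem rmat_mul_inv (hq : 0 < q) :
    rmat q m * (rmat q m - (q - q⁻¹) • 1 + (q - q⁻¹) • kmat q m) = 1 := by
  rw [mul_add, mul_sub, skein hq, mul_smul_comm, mul_smul_comm, rmat_kmat hq, mul_one, smul_smul]
  abel

theorem rmat_inv (hq : 0 < q) :
    (rmat q m)⁻¹ = rmat q m - (q - q⁻¹) • 1 + (q - q⁻¹) • kmat q m :=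
  Matrix.inv_eq_right_inv (rmat_mul_inv hq)

theorem rmat_mul_rinv (hq : 0 < q) : rmat q m * (rmat q m)⁻¹ = 1 := by
  rw [rmat_inv hq, rmat_mul_inv hq]

theorem rinv_mul_rmat (hq : 0 < q) : (rmat q m)⁻¹ * rmat q m = 1 :=
  mul_eq_one_comm.1 (rmat_mul_rinv hq)

noncomputable def csum (q : ℝ) (m : ℕ) : ℝ := ∑ i, ∑ j, metric q m i j * metric q m i j

theorem proj1_eq : proj1 q m = (csum q m)⁻¹ • kmat q m := by
  ext x y
  simp only [proj1, kmat, csum, Matrix.of_apply, Matrix.smul_apply, smul_eq_mul]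
  ring

theorem projA_eq : projA q m = (q + q⁻¹)⁻¹ • (q • 1 + ((q ^ (1 - (m : ℝ)) - q) * (csum q m)⁻¹) • kmat q m - rmat q m) := by
  rw [projA, proj1_eq]
  congr 2
  rw [smul_sub, smul_smul, smul_smul, sub_mul, sub_smul]
  abel

theorem csum_eq (hm : 0 < m) (hq : 0 < q) (hq1 : q < 1) : csum q m ≠ 0 ∧
    q * ((q - q⁻¹) * q ^ (1 - (m : ℝ))) * csum q m = (q - q ^ (1 - (m : ℝ))) * (1 + q * q ^ (1 - (m : ℝ))) := by
  have h := sum_metric hm hq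
  have hl : q - q⁻¹ ≠ 0 := by
    have := (one_lt_inv₀ hq).2 hq1; linarith
  have hs : csum q m ≠ 0 := by
    have e : csum q m = ∑ i, wt q m i ^ 2 := by
      refine sum_congr rfl fun i _ => ?_
      simp [metric, pow_two]
    rw [e]
    have : Nonempty (Fin m) := ⟨⟨0, hm⟩⟩
    refine (sum_pos (fun i _ => ?_) univ_nonempty).ne'
    exact pow_pos (Real.rpow_pos_of_pos hq _) 2
  refine ⟨hs, ?_⟩
  change (q - q⁻¹) * csum q m = _ at h
  have e : q ^ ((m : ℝ) - 1) * q ^ (1 - (m : ℝ)) = 1 := by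
    rw [← Real.rpow_add hq]; simp
  have h2 := mul_inv_cancel₀ hq.ne'
  linear_combination (q * q ^ (1 - (m : ℝ))) * h + q * e - q ^ (1 - (m : ℝ)) * h2

theorem projA_mul (hm : 0 < m) (hq : 0 < q) (hq1 : q < 1) : projA q m * (1 + q • rmat q m) = 0 := by
  obtain ⟨h0, h1⟩ := csum_eq hm hq hq1
  rw [projA_eq, smul_mul_assoc]
  have : (q • 1 + ((q ^ (1 - (m : ℝ)) - q) * (csum q m)⁻¹) • kmat q m - rmat q m) * (1 + q • rmat q m) = 0 := by
    rw [mul_add, mul_one, mul_smul_comm, sub_mul (_ + _), add_mul (q • _), smul_mul_assoc, smul_mul_assoc, one_mul, skein hq, kmat_rmat hq]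
    have e : (q ^ (1 - (m : ℝ)) - q) * (csum q m)⁻¹ * (1 + q * q ^ (1 - (m : ℝ))) =
        - (q * ((q - q⁻¹) * q ^ (1 - (m : ℝ)))) := by
      field_simp
      linear_combination h1 + (q ^ (1 - (m : ℝ)) * csum q m) * mul_inv_cancel₀ hq.ne'
    have h2 := mul_inv_cancel₀ hq.ne'
    ext x y
    simp only [Matrix.add_apply, Matrix.sub_apply, Matrix.smul_apply, smul_eq_mul, Matrix.zero_apply]
    linear_combination (kmat q m x y) * e + (rmat q m x y) * h2
  rw [this, smul_zero]

/-- compatibility -/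
theorem cross (hq : 0 < q) (n i j k : Fin m) :
    ∑ l, (rmat q m)⁻¹ (n, i) (k, l) * metric q m l j = ∑ l, metric q m n l * rmat q m (i, j) (l, k) := by
  have e1 : ∀ l, (rmat q m)⁻¹ (n, i) (k, l) * metric q m l j = if l = j.rev then (rmat q m)⁻¹ (n, i) (k, l) * wt q m j.rev else 0 := by
    intro l; unfold metric
    have : j = l.rev ↔ l = j.rev := by constructor <;> (intro h; rw [h]; simp)
    simp only [this]; split_ifs with h
    · rw [h]
    · simp
  have e2 : ∀ l, metric q m n l * rmat q m (i, j) (l, k) = if l = n.rev then wt q m n * rmat q m (i, j) (l, k) else 0 := by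
    intro l; unfold metric; split_ifs <;> simp
  simp only [e1, e2, sum_ite_eq', mem_univ, if_true]
  rw [rmat_inv hq, Matrix.add_apply, Matrix.sub_apply, Matrix.smul_apply, Matrix.smul_apply, Matrix.one_apply]
  have hn := wt_rev (m := m) hq n
  have hj := wt_rev (m := m) hq j
  have hi := wt_rev (m := m) hq i
  have hni := fun h : n = n.rev => wt_mid (q := q) n h
  have hji := fun h : j = j.rev => wt_mid (q := q) j h
  have hii := fun h : i = i.rev => wt_mid (q := q) i h
  unfold rmat kmat metric
  simp only [Matrix.of_apply, Prod.mk.injEq, Fin.rev_rev, smul_eq_mul, Fin.rev_inj, Fin.rev_lt_rev]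
  clear e1 e2
  have rr : ∀ x y : Fin m, x = y.rev ↔ y = x.rev := fun x y => by
    constructor <;> (intro h; rw [h]; simp)
  by_cases h1 : i = n.rev
  · subst h1
    by_cases h2 : k = j
    swap
    · have h3 : ¬ (n = j.rev ∧ n.rev = k) := by rintro ⟨rfl, rfl⟩; simp at h2
      have h4 : ¬ (n = k ∧ n = j) := by rintro ⟨rfl, rfl⟩; simp at h2
      have h4' : ¬ (n = k ∧ n.rev = j.rev) := by simpa using h4
      have h5 : ¬ (n.rev = k ∧ j = n.rev) := by rintro ⟨rfl, rfl⟩; simp at h2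
      have h7 : ¬ (j = k) := fun h => h2 h.symm
      have h8 : (if j = n then wt q m n.rev else 0) * (if k = n then wt q m n.rev else 0) = 0 := by
        by_cases h : j = n
        · rw [if_neg (fun h' : k = n => h2 (h'.trans h.symm)), mul_zero]
        · rw [if_neg h, zero_mul]
      simp only [h3, h4', h5, h7, h8, and_false, false_and, if_false, mul_zero, Fin.rev_rev, ite_self, sub_zero, add_zero, zero_mul]
    subst h2
    by_cases h3 : k = n
    · subst h3
      rcases lt_trichotomy k k.rev with g | g | g
      · simp only [g, g.ne, g.ne', g.not_gt, and_false, and_self, if_true, if_false]; ring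
      · simp only [← g, lt_irrefl, and_false, and_self, if_true, if_false, hni g]; ring
      · simp only [g, g.ne, g.ne', g.not_gt, Fin.rev_rev, false_and, and_false, and_self, if_true, if_false]
        linear_combination ((q - q⁻¹) * (wt q m k + wt q m k.rev)) * hn
    · have h3' : ¬ n = k := fun h => h3 h.symm
      by_cases h4 : k = n.rev
      · subst h4
        simp only [h3, h3', Fin.rev_rev, lt_irrefl, false_and, and_self, true_and, if_true, if_false, mul_zero, zero_mul, ite_self]
        linear_combination (wt q m n * (q - q⁻¹)) * hn
      · have h5 : ¬ n = k.rev := by rw [rr]; exact h4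
        have h6 : ¬ n.rev = k := fun h => h4 h.symm
        simp only [h3, h3', h4, h5, h6, Fin.rev_rev, false_and, and_self, true_and, if_true, if_false, mul_zero, zero_mul, ite_self]
        rcases lt_or_gt_of_ne h4 with g | g
        · simp only [g, g.not_gt, if_true, if_false]; ring
        · simp only [g, g.not_gt, if_true, if_false]
          linear_combination ((q - q⁻¹) * wt q m n) * hj
  · have h1' : ¬ n = i.rev := by rw [rr]; exact h1
    have h1'' : ¬ n.rev = i := fun h => h1 h.symm
    by_cases hA : j = n.rev ∧ k = i
    · obtain ⟨rfl, rfl⟩ := hA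
      by_cases h2 : k = n
      · subst h2
        simp only [h1, Fin.rev_rev, lt_irrefl, false_and, and_false, and_self, if_true, if_false, mul_zero, zero_mul, ite_self]
        ring
      · have h2' : ¬ n = k := fun h => h2 h.symm
        simp only [h1, h2, h2', Fin.rev_rev, Fin.rev_inj, false_and, and_self, if_true, if_false, mul_zero, zero_mul, ite_self]
        ring
    · have hA1 : ¬ (n = j.rev ∧ i = k) := by rintro ⟨rfl, rfl⟩; simp at hA
      have hA2 : ¬ (i = k ∧ j = n.rev) := by rintro ⟨rfl, rfl⟩; simp at hA
      by_cases hB : k = n ∧ i = j.rev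
      · obtain ⟨rfl, rfl⟩ := hB
        have g : ¬ k = j.rev := fun h => hA1 ⟨h, h.symm⟩
        have g' : ¬ j.rev = k := fun h => g h.symm
        simp only [g, g', h1, Fin.rev_rev, and_false, false_and, and_self, true_and, if_true, if_false, mul_zero, zero_mul, ite_self]
        rcases lt_or_gt_of_ne g with f | f
        · simp only [f, f.not_gt, if_true, if_false]; ring
        · simp only [f, f.not_gt, if_true, if_false]
          linear_combination ((q - q⁻¹) * wt q m j.rev) * hn
      · have hB1 : ¬ (n = k ∧ i = j.rev) := fun h => hB ⟨h.1.symm, h.2⟩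
        have hB2 : (if j = i.rev then wt q m i else 0) * (if k = n then wt q m n.rev else 0) = 0 := by
          rw [rr i] at hB
          by_cases h : k = n
          · rw [if_neg (fun h' => hB ⟨h, h'⟩), zero_mul]
          · rw [if_neg h, mul_zero]
        simp only [h1, hA1, hA2, hB1, hB2, false_and, if_false, mul_zero, zero_mul, ite_self, sub_zero, add_zero]

/-- The operator on functions of three indices that a matrix on pairs induces on the first two. -/
def op12 (M : Matrix (Fin m × Fin m) (Fin m × Fin m) ℝ) : Module.End ℝ (Fin m → Fin m → Fin m → ℝ) where
  toFun F a b d := ∑ y : Fin m × Fin m, M (a, b) y * F y.1 y.2 d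
  map_add' F G := by
    funext a b d; simp only [Pi.add_apply, mul_add, sum_add_distrib]
  map_smul' r F := by
    funext a b d
    simp only [Pi.smul_apply, smul_eq_mul, RingHom.id_apply, mul_sum]
    exact sum_congr rfl fun y _ => by ring

/-- The operator that a matrix on pairs induces on the last two indices. -/
def op23 (M : Matrix (Fin m × Fin m) (Fin m × Fin m) ℝ) : Module.End ℝ (Fin m → Fin m → Fin m → ℝ) where
  toFun F d a b := ∑ y : Fin m × Fin m, M (a, b) y * F d y.1 y.2
  map_add' F G := by
    funext a b d; simp only [Pi.add_apply, mul_add, sum_add_distrib]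
  map_smul' r F := by
    funext a b d
    simp only [Pi.smul_apply, smul_eq_mul, RingHom.id_apply, mul_sum]
    exact sum_congr rfl fun y _ => by ring

theorem op12_apply (M : Matrix (Fin m × Fin m) (Fin m × Fin m) ℝ) (F : Fin m → Fin m → Fin m → ℝ) (a b d : Fin m) :
    op12 M F a b d = ∑ y : Fin m × Fin m, M (a, b) y * F y.1 y.2 d := rfl

theorem op23_apply (M : Matrix (Fin m × Fin m) (Fin m × Fin m) ℝ) (F : Fin m → Fin m → Fin m → ℝ) (d a b : Fin m) :
    op23 M F d a b = ∑ y : Fin m × Fin m, M (a, b) y * F d y.1 y.2 := rfl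

theorem op12_mul (M N : Matrix (Fin m × Fin m) (Fin m × Fin m) ℝ) : op12 (M * N) = op12 M * op12 N := by
  refine LinearMap.ext fun F => ?_
  funext a b d
  rw [Module.End.mul_apply, op12_apply, op12_apply]
  simp only [op12_apply, Matrix.mul_apply, sum_mul, mul_sum, Prod.mk.eta]
  rw [sum_comm]
  exact sum_congr rfl fun y _ => sum_congr rfl fun z _ => by ring

theorem op23_mul (M N : Matrix (Fin m × Fin m) (Fin m × Fin m) ℝ) : op23 (M * N) = op23 M * op23 N := by
  refine LinearMap.ext fun F => ?_
  funext a b d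
  rw [Module.End.mul_apply, op23_apply, op23_apply]
  simp only [op23_apply, Matrix.mul_apply, sum_mul, mul_sum, Prod.mk.eta]
  rw [sum_comm]
  exact sum_congr rfl fun y _ => sum_congr rfl fun z _ => by ring

theorem op12_one : op12 (1 : Matrix (Fin m × Fin m) (Fin m × Fin m) ℝ) = 1 := by
  refine LinearMap.ext fun F => ?_
  funext a b d
  rw [op12_apply]; simp [Matrix.one_apply]

theorem op23_one : op23 (1 : Matrix (Fin m × Fin m) (Fin m × Fin m) ℝ) = 1 := by
  refine LinearMap.ext fun F => ?_
  funext a b d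
  rw [op23_apply]; simp [Matrix.one_apply]

theorem op12_lin (r s t : ℝ) (L M N : Matrix (Fin m × Fin m) (Fin m × Fin m) ℝ) :
    op12 (r • L + s • M + t • N) = r • op12 L + s • op12 M + t • op12 N := by
  refine LinearMap.ext fun F => ?_
  funext a b d
  simp only [LinearMap.add_apply, LinearMap.smul_apply, Pi.add_apply, Pi.smul_apply, op12_apply, Matrix.add_apply,
    Matrix.smul_apply, smul_eq_mul, add_mul, sum_add_distrib, mul_assoc, mul_sum]

theorem op23_lin (r s t : ℝ) (L M N : Matrix (Fin m × Fin m) (Fin m × Fin m) ℝ) :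
    op23 (r • L + s • M + t • N) = r • op23 L + s • op23 M + t • op23 N := by
  refine LinearMap.ext fun F => ?_
  funext a b d
  simp only [LinearMap.add_apply, LinearMap.smul_apply, Pi.add_apply, Pi.smul_apply, op23_apply, Matrix.add_apply,
    Matrix.smul_apply, smul_eq_mul, add_mul, sum_add_distrib, mul_assoc, mul_sum]

theorem op12_rmat (hq : 0 < q) (F : Fin m → Fin m → Fin m → ℝ) : op12 (rmat q m) F = YB.R12 (wtData hq m) F := by
  funext a b d
  rw [op12_apply]
  exact sum_rmat hq (fun s t => F s t d) a b d

theorem op23_rmat (hq : 0 < q) (F : Fin m → Fin m → Fin m → ℝ) : op23 (rmat q m) F = YB.R23 (wtData hq m) F := by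
  funext d a b
  rw [op23_apply]
  exact sum_rmat hq (fun s t => F d s t) a b d

/-- The quantum Yang-Baxter (braid) relation. -/
theorem braid (hq : 0 < q) : op12 (rmat q m) * (op23 (rmat q m) * op12 (rmat q m)) =
    op23 (rmat q m) * (op12 (rmat q m) * op23 (rmat q m)) := by
  refine LinearMap.ext fun F => ?_
  simp only [Module.End.mul_apply, op12_rmat hq, op23_rmat hq]
  exact YB.ybe _ F

theorem braid_aux {S : Type*} [Ring S] (A B A' B' : S) (h1 : A * A' = 1) (h2 : A' * A = 1)
    (h3 : B * B' = 1) (h4 : B' * B = 1) (h : A * (B * A) = B * (A * B)) :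
    B * (A' * B') = A' * (B' * A) ∧ B' * (A' * B') = A' * (B' * A') := by
  constructor
  · calc B * (A' * B') = A' * (B' * (B * (A * B)) * (A' * B')) := by
          rw [← mul_assoc B', h4, one_mul, mul_assoc A, ← mul_assoc A', h2, one_mul]
      _ = A' * (B' * A) := by
          rw [← h, mul_assoc B', mul_assoc A, mul_assoc B, ← mul_assoc A A', h1, one_mul, h3, mul_one]
  · calc B' * (A' * B') = B' * (A' * B') * (A * (B * A) * (A' * (B' * A'))) := by
          rw [mul_assoc A, mul_assoc B, ← mul_assoc A A', h1, one_mul, ← mul_assoc B, h3, one_mul, h1, mul_one]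
      _ = A' * (B' * A') := by
          rw [h]
          simp only [mul_assoc]
          rw [← mul_assoc B' B, h4, one_mul, ← mul_assoc A' A, h2, one_mul, ← mul_assoc B' B, h4, one_mul]

theorem projA_poly (hq : 0 < q) (hq1 : q < 1) : ∃ r s t : ℝ,
    projA q m = r • 1 + s • rmat q m + t • (rmat q m)⁻¹ := by
  have hl : q - q⁻¹ ≠ 0 := by
    have := (one_lt_inv₀ hq).2 hq1; linarith
  have hk : kmat q m = (q - q⁻¹)⁻¹ • ((rmat q m)⁻¹ - rmat q m + (q - q⁻¹) • 1) := by
    rw [rmat_inv hq, eq_inv_smul_iff₀ hl]; abel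
  rw [projA_eq, hk]
  set u := (q ^ (1 - (m : ℝ)) - q) * (csum q m)⁻¹ * (q - q⁻¹)⁻¹ with hu
  refine ⟨(q + q⁻¹)⁻¹ * (q + u * (q - q⁻¹)), (q + q⁻¹)⁻¹ * (- u - 1), (q + q⁻¹)⁻¹ * u, ?_⟩
  ext x y
  simp only [Matrix.add_apply, Matrix.sub_apply, Matrix.smul_apply, smul_eq_mul]
  rw [hu]; ring

theorem projA_braid (hq : 0 < q) (hq1 : q < 1) :
    op23 (projA q m) * (op12 (rmat q m)⁻¹ * op23 (rmat q m)⁻¹) =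
      op12 (rmat q m)⁻¹ * (op23 (rmat q m)⁻¹ * op12 (projA q m)) := by
  obtain ⟨r, s, t, h⟩ := projA_poly (m := m) hq hq1
  have h1 := braid_aux (op12 (rmat q m)) (op23 (rmat q m)) (op12 (rmat q m)⁻¹) (op23 (rmat q m)⁻¹)
    (by rw [← op12_mul, rmat_mul_rinv hq, op12_one]) (by rw [← op12_mul, rinv_mul_rmat hq, op12_one])
    (by rw [← op23_mul, rmat_mul_rinv hq, op23_one]) (by rw [← op23_mul, rinv_mul_rmat hq, op23_one]) (braid hq)
  rw [h, op23_lin, op12_lin, op12_one, op23_one]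
  simp only [add_mul, mul_add, smul_mul_assoc, mul_smul_comm, one_mul, mul_one, h1.1, h1.2]

/-- The braid relation in coordinates. -/
theorem projA_braid_apply (hq : 0 < q) (hq1 : q < 1) (n a b k r s : Fin m) :
    ∑ i, ∑ j, projA q m (a, b) (i, j) * ∑ l, (rmat q m)⁻¹ (n, i) (k, l) * (rmat q m)⁻¹ (l, j) (r, s) =
      ∑ v, ∑ u, ∑ w, (rmat q m)⁻¹ (n, a) (u, v) * (rmat q m)⁻¹ (v, b) (w, s) * projA q m (u, w) (k, r) := by
  have h := congrFun (congrFun (congrFun (LinearMap.congr_fun (projA_braid (m := m) hq hq1)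
    (fun x y z => if x = k then if y = r then if z = s then 1 else 0 else 0 else 0)) n) a) b
  simp only [Module.End.mul_apply, op12_apply, op23_apply, Fintype.sum_prod_type] at h
  have e1 : ∀ x l j : Fin m, ∑ y, ∑ z, (rmat q m)⁻¹ (l, j) (y, z) *
      (if x = k then if y = r then if z = s then (1 : ℝ) else 0 else 0 else 0) =
      if x = k then (rmat q m)⁻¹ (l, j) (r, s) else 0 := by
    intro x l j; by_cases hx : x = k <;> simp [hx]
  have e2 : ∀ i j, ∑ x, ∑ l, (rmat q m)⁻¹ (n, i) (x, l) * (if x = k then (rmat q m)⁻¹ (l, j) (r, s) else 0) =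
      ∑ l, (rmat q m)⁻¹ (n, i) (k, l) * (rmat q m)⁻¹ (l, j) (r, s) := by
    intro i j
    rw [sum_comm]; exact sum_congr rfl fun l _ => by simp
  have e3 : ∀ u w z : Fin m, ∑ x, ∑ y, projA q m (u, w) (x, y) *
      (if x = k then if y = r then if z = s then (1 : ℝ) else 0 else 0 else 0) =
      if z = s then projA q m (u, w) (k, r) else 0 := by
    intro u w z
    rw [sum_eq_single k (by intro x _ hx; simp [hx]) (by simp), sum_eq_single r (by intro x _ hx; simp [hx]) (by simp)]
    simp
  have e4 : ∀ u v, ∑ w, ∑ z, (rmat q m)⁻¹ (v, b) (w, z) * (if z = s then projA q m (u, w) (k, r) else 0) =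
      ∑ w, (rmat q m)⁻¹ (v, b) (w, s) * projA q m (u, w) (k, r) := by
    intro u v; exact sum_congr rfl fun w _ => by simp
  simp only [e1, e2, e3, e4] at h
  rw [h, sum_comm]
  simp only [mul_sum, mul_assoc]

end
/-- The relations `(P_A)^{ab}_{ij} x^i x^j = 0`. -/
inductive Rel (q : ℝ) (m : ℕ) : FreeAlgebra ℂ (Fin m) → FreeAlgebra ℂ (Fin m) → Prop
  | antisymm (a b : Fin m) : Rel q m
      (∑ i, ∑ j, ((projA q m (a, b) (i, j) : ℝ) : ℂ) • (FreeAlgebra.ι ℂ i * FreeAlgebra.ι ℂ j)) 0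

/-- The algebra of polynomials on the quantum Euclidean space. -/
abbrev Poly (q : ℝ) (m : ℕ) : Type := RingQuot (Rel q m)

/-- The coordinate `x^i`. -/
noncomputable def coord (q : ℝ) (m : ℕ) (i : Fin m) : Poly q m :=
  RingQuot.mkAlgHom ℂ (Rel q m) (FreeAlgebra.ι ℂ i)

theorem coord_rel (q : ℝ) (m : ℕ) (a b : Fin m) :
    ∑ i, ∑ j, ((projA q m (a, b) (i, j) : ℝ) : ℂ) • (coord q m i * coord q m j) = 0 := by
  have h := RingQuot.mkAlgHom_rel ℂ (Rel.antisymm (q := q) a b)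
  simpa only [map_sum, map_smul, map_mul, map_zero, coord] using h

/-- The operator `(p, (v^i)_i) ↦ (x^j p, (C^{ij} p + q (R̂⁻¹)^{ij}_{kl} x^k v^l)_i)`: left
multiplication by `x^j` on a polynomial together with its gradient. -/
noncomputable def leibniz (q : ℝ) (m : ℕ) (j : Fin m) : Module.End ℂ (Poly q m × (Fin m → Poly q m)) where
  toFun v := (coord q m j * v.1, fun i => ((metric q m i j : ℝ) : ℂ) • v.1 +
    (q : ℂ) • ∑ k, ∑ l, (((rmat q m)⁻¹ (i, j) (k, l) : ℝ) : ℂ) • (coord q m k * v.2 l))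
  map_add' v w := by
    refine Prod.ext (mul_add _ _ _) (funext fun i => ?_)
    simp only [Prod.fst_add, Prod.snd_add, Pi.add_apply, mul_add, smul_add, sum_add_distrib]
    abel
  map_smul' r v := by
    refine Prod.ext (mul_smul_comm _ _ _) (funext fun i => ?_)
    simp only [Prod.smul_fst, Prod.smul_snd, Pi.smul_apply, RingHom.id_apply, smul_add, smul_sum, mul_smul_comm]
    congr 1
    · rw [smul_comm]
    · refine sum_congr rfl fun k _ => sum_congr rfl fun l _ => ?_
      rw [smul_comm _ r, smul_comm _ r]

theorem leibniz_fst (q : ℝ) (m : ℕ) (j : Fin m) (v : Poly q m × (Fin m → Poly q m)) :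
    (leibniz q m j v).1 = coord q m j * v.1 := rfl

theorem leibniz_snd (q : ℝ) (m : ℕ) (j i : Fin m) (v : Poly q m × (Fin m → Poly q m)) :
    (leibniz q m j v).2 i = ((metric q m i j : ℝ) : ℂ) • v.1 +
    (q : ℂ) • ∑ k, ∑ l, (((rmat q m)⁻¹ (i, j) (k, l) : ℝ) : ℂ) • (coord q m k * v.2 l) := rfl

theorem leibniz_rel (q : Set.Ioo (0 : ℝ) 1) (m : ℕ) (a b : Fin m) :
    ∑ i, ∑ j, ((projA q m (a, b) (i, j) : ℝ) : ℂ) • (leibniz q m i * leibniz q m j) = 0 := by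
  obtain ⟨q, hq, hq1⟩ := q
  have hm : 0 < m := a.pos
  refine LinearMap.ext fun v => ?_
  simp only [LinearMap.sum_apply, LinearMap.smul_apply, Module.End.mul_apply, LinearMap.zero_apply]
  refine Prod.ext ?_ (funext fun n => ?_)
  · simp only [Prod.fst_sum, Prod.smul_fst, leibniz_fst, Prod.fst_zero]
    have := congrArg (· * v.1) (coord_rel q m a b)
    simpa only [sum_mul, smul_mul_assoc, mul_assoc, zero_mul] using this
  · simp only [Prod.snd_sum, Prod.smul_snd, Finset.sum_apply, Pi.smul_apply, leibniz_fst, leibniz_snd, Prod.snd_zero, Pi.zero_apply]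
    have e1 : ∀ i j, (((projA q m (a, b) (i, j) : ℝ) : ℂ)) • (((metric q m n i : ℝ) : ℂ) • (coord q m j * v.1) +
        (q : ℂ) • ∑ k, ∑ l, (((rmat q m)⁻¹ (n, i) (k, l) : ℝ) : ℂ) • (coord q m k *
          (((metric q m l j : ℝ) : ℂ) • v.1 + (q : ℂ) • ∑ r, ∑ s, (((rmat q m)⁻¹ (l, j) (r, s) : ℝ) : ℂ) • (coord q m r * v.2 s))))
        = ((metric q m n i * projA q m (a, b) (i, j) : ℝ) : ℂ) • (coord q m j * v.1)
        + ∑ k, ∑ l, ((metric q m n l * (q * (projA q m (a, b) (i, j) * rmat q m (i, j) (l, k))) : ℝ) : ℂ) • (coord q m k * v.1)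
        + ((q : ℂ) * q) • ∑ k, ∑ r, ∑ s, ((projA q m (a, b) (i, j) * ∑ l, (rmat q m)⁻¹ (n, i) (k, l) * (rmat q m)⁻¹ (l, j) (r, s) : ℝ) : ℂ)
            • (coord q m k * coord q m r * v.2 s) := by
      intro i j
      have c := cross (m := m) hq n i j
      simp only [mul_add, smul_add, sum_add_distrib]
      rw [← add_assoc]
      congr 1
      · congr 1
        · rw [smul_smul, mul_comm]; push_cast; rfl
        · rw [smul_sum, smul_sum]
          refine sum_congr rfl fun k _ => ?_
          simp only [mul_smul_comm, smul_smul, ← sum_smul]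
          congr 1
          have := congrArg (fun t : ℝ => (t : ℂ)) (c k)
          simp only [Complex.ofReal_sum, Complex.ofReal_mul] at this
          rw [this]
          push_cast
          simp only [mul_sum]
          refine sum_congr rfl fun l _ => by ring
      · simp only [mul_smul_comm, smul_sum, mul_sum, smul_smul]
        refine sum_congr rfl fun k _ => ?_
        rw [sum_comm]
        refine sum_congr rfl fun r _ => ?_
        rw [sum_comm]
        refine sum_congr rfl fun s _ => ?_
        rw [← sum_smul, mul_assoc (coord q m k)]
        congr 1
        push_cast
        simp only [mul_sum]
        refine sum_congr rfl fun l _ => by ring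
    simp only [e1, sum_add_distrib]
    have f1 : ∀ k, ∑ l, ((metric q m n l * ((projA q m * (1 + q • rmat q m)) (a, b) (l, k)) : ℝ) : ℂ) • (coord q m k * v.1) = 0 := by
      intro k; rw [projA_mul hm hq hq1]; simp
    have g3 : ∀ g : Fin m → Fin m → Fin m → Poly q m, ∑ i, ∑ j, ∑ k, g i j k = ∑ k, ∑ i, ∑ j, g i j k :=
      fun g => (sum_congr rfl fun i _ => sum_comm).trans sum_comm
    have e2 : ∑ i, ∑ j, ∑ k, ∑ l, ((metric q m n l * (q * (projA q m (a, b) (i, j) * rmat q m (i, j) (l, k))) : ℝ) : ℂ) • (coord q m k * v.1)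
       = ∑ k, ∑ l, ((metric q m n l * (q * ∑ i, ∑ j, (projA q m (a, b) (i, j) * rmat q m (i, j) (l, k))) : ℝ) : ℂ) • (coord q m k * v.1) := by
      rw [g3]
      refine sum_congr rfl fun k _ => ?_
      rw [g3]
      refine sum_congr rfl fun l _ => ?_
      simp only [← sum_smul, mul_sum]
      push_cast; rfl
    have e3 : ∑ i, ∑ j, ((q : ℂ) * q) • ∑ k, ∑ r, ∑ s, ((projA q m (a, b) (i, j) * ∑ l, (rmat q m)⁻¹ (n, i) (k, l) * (rmat q m)⁻¹ (l, j) (r, s) : ℝ) : ℂ)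
            • (coord q m k * coord q m r * v.2 s) = 0 := by
      have : ∀ k r s, ∑ i, ∑ j, ((projA q m (a, b) (i, j) * ∑ l, (rmat q m)⁻¹ (n, i) (k, l) * (rmat q m)⁻¹ (l, j) (r, s) : ℝ) : ℂ)
            • (coord q m k * coord q m r * v.2 s) =
          ∑ c, ∑ u, ∑ w, (((rmat q m)⁻¹ (n, a) (u, c) * (rmat q m)⁻¹ (c, b) (w, s) : ℝ) : ℂ) •
            ((((projA q m (u, w) (k, r) : ℝ) : ℂ) • (coord q m k * coord q m r)) * v.2 s) := by
        intro k r s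
        have := congrArg (fun t : ℝ => (t : ℂ) • (coord q m k * coord q m r * v.2 s)) (projA_braid_apply (m := m) hq hq1 n a b k r s)
        simp only [Complex.ofReal_sum, sum_smul] at this
        rw [this]
        refine sum_congr rfl fun c _ => sum_congr rfl fun u _ => sum_congr rfl fun w _ => ?_
        rw [smul_mul_assoc, smul_smul]; push_cast; rfl
      simp only [← smul_sum]
      rw [g3]
      have g4 : ∀ k, ∑ i, ∑ j, ∑ r, ∑ s, ((projA q m (a, b) (i, j) * ∑ l, (rmat q m)⁻¹ (n, i) (k, l) * (rmat q m)⁻¹ (l, j) (r, s) : ℝ) : ℂ)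
            • (coord q m k * coord q m r * v.2 s) = ∑ r, ∑ s, ∑ c, ∑ u, ∑ w, (((rmat q m)⁻¹ (n, a) (u, c) * (rmat q m)⁻¹ (c, b) (w, s) : ℝ) : ℂ) •
            ((((projA q m (u, w) (k, r) : ℝ) : ℂ) • (coord q m k * coord q m r)) * v.2 s) := by
        intro k
        rw [g3]
        refine sum_congr rfl fun r _ => ?_
        rw [g3]
        exact sum_congr rfl fun s _ => this k r s
      rw [sum_congr rfl fun k _ => g4 k, g3, sum_eq_zero, smul_zero]
      intro s _
      rw [g3]
      refine sum_eq_zero fun c _ => ?_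
      rw [g3]
      refine sum_eq_zero fun u _ => ?_
      rw [g3]
      refine sum_eq_zero fun w _ => ?_
      simp only [← smul_sum, ← sum_mul, coord_rel, zero_mul, smul_zero]
    rw [e2, e3, add_zero, sum_comm, ← sum_add_distrib]
    refine sum_eq_zero fun k _ => ?_
    rw [← f1 k, ← sum_add_distrib]
    refine sum_congr rfl fun l _ => ?_
    rw [← add_smul]
    congr 1
    rw [Matrix.mul_add, mul_one, mul_smul_comm, Matrix.add_apply, Matrix.smul_apply, Matrix.mul_apply, Fintype.sum_prod_type, smul_eq_mul]
    push_cast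
    ring

/-- The action of all polynomials that extends `leibniz`. -/
noncomputable def leibnizHom (q : Set.Ioo (0 : ℝ) 1) (m : ℕ) :
    Poly q m →ₐ[ℂ] Module.End ℂ (Poly q m × (Fin m → Poly q m)) :=
  RingQuot.liftAlgHom ℂ ⟨FreeAlgebra.lift ℂ (leibniz q m), by
    rintro x y ⟨a, b⟩
    simp only [map_sum, map_smul, map_mul, map_zero, FreeAlgebra.lift_ι_apply]
    exact leibniz_rel q m a b⟩

theorem leibnizHom_coord (q : Set.Ioo (0 : ℝ) 1) (m : ℕ) (j : Fin m) :
    leibnizHom q m (coord q m j) = leibniz q m j := by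
  simp [leibnizHom, coord]

/-- The partial derivative `∂^i`. It is the operator with `∂^i 1 = 0` and
`∂^i x^j = C^{ij} + q (R̂⁻¹)^{ij}_{kl} x^k ∂^l`, see `partialD_one` and `partialD_coord_mul`. -/
noncomputable def partialD (q : Set.Ioo (0 : ℝ) 1) (m : ℕ) (i : Fin m) : Poly q m →ₗ[ℂ] Poly q m where
  toFun p := (leibnizHom q m p (1, 0)).2 i
  map_add' p r := by simp
  map_smul' c p := by simp

theorem leibnizHom_fst (q : Set.Ioo (0 : ℝ) 1) (m : ℕ) (p : Poly q m) :
    ∀ v, (leibnizHom q m p v).1 = p * v.1 := by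
  obtain ⟨a, rfl⟩ := RingQuot.mkAlgHom_surjective ℂ (Rel q m) p
  induction a using FreeAlgebra.induction with
  | grade0 c => intro v; simp [Algebra.algebraMap_eq_smul_one]
  | grade1 j => intro v; exact congrArg Prod.fst (LinearMap.congr_fun (leibnizHom_coord q m j) v)
  | mul a b ha hb => intro v; rw [map_mul, map_mul, Module.End.mul_apply, ha, hb, mul_assoc]
  | add a b ha hb => intro v; rw [map_add, map_add, LinearMap.add_apply, Prod.fst_add, ha, hb, add_mul]

theorem partialD_one (q : Set.Ioo (0 : ℝ) 1) (m : ℕ) (i : Fin m) : partialD q m i 1 = 0 := by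
  simp [partialD]

theorem partialD_coord_mul (q : Set.Ioo (0 : ℝ) 1) (m : ℕ) (i j : Fin m) (p : Poly q m) :
    partialD q m i (coord q m j * p) = ((metric q m i j : ℝ) : ℂ) • p +
      ((q : ℝ) : ℂ) • ∑ k, ∑ l, (((rmat (q : ℝ) m)⁻¹ (i, j) (k, l) : ℝ) : ℂ) • (coord q m k * partialD q m l p) := by
  have h : leibnizHom q m (coord q m j * p) (1, 0) = leibniz q m j (leibnizHom q m p (1, 0)) := by
    rw [map_mul, leibnizHom_coord]; rfl
  change (leibnizHom q m (coord q m j * p) (1, 0)).2 i = _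
  rw [h, leibniz_snd, leibnizHom_fst, mul_one]
  rfl

/-- The Laplacian `Δ = ∂^i C_{ij} ∂^j`. -/
noncomputable def laplacian (q : Set.Ioo (0 : ℝ) 1) (m : ℕ) : Module.End ℂ (Poly q m) :=
  ∑ i, ∑ j, ((metric q m i j : ℝ) : ℂ) • (partialD q m i ∘ₗ partialD q m j)

/-- The homogeneous polynomials of degree `k`: the span of the products of `k` coordinates. -/
noncomputable def homog (q : ℝ) (m k : ℕ) : Submodule ℂ (Poly q m) :=
  Submodule.span ℂ (Set.range (coord q m)) ^ k

theorem coord_mul_mem (q : ℝ) (m n : ℕ) (j : Fin m) {p : Poly q m} (hp : p ∈ homog q m n) :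
    coord q m j * p ∈ homog q m (n + 1) := by
  rw [homog, pow_succ']
  exact Submodule.mul_mem_mul (Submodule.subset_span ⟨j, rfl⟩) hp

theorem homog_induction (q : ℝ) (m n : ℕ) (W : Submodule ℂ (Poly q m))
    (h : ∀ j, ∀ p ∈ homog q m n, coord q m j * p ∈ W) : homog q m (n + 1) ≤ W := by
  rw [homog, pow_succ', Submodule.mul_le]
  intro a ha p hp
  refine Submodule.span_induction (p := fun a _ => a * p ∈ W) ?_ (by simp) ?_ ?_ ha
  · rintro _ ⟨j, rfl⟩; exact h j p hp
  · intro x y _ _ hx hy; rw [add_mul]; exact W.add_mem hx hy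
  · intro c x _ hx; rw [smul_mul_assoc]; exact W.smul_mem c hx

theorem partialD_homog_zero (q : Set.Ioo (0 : ℝ) 1) (m : ℕ) (i : Fin m) {p : Poly q m} (hp : p ∈ homog (q : ℝ) m 0) :
    partialD q m i p = 0 := by
  rw [homog, pow_zero, Submodule.mem_one] at hp
  obtain ⟨c, rfl⟩ := hp
  rw [Algebra.algebraMap_eq_smul_one, map_smul, partialD_one, smul_zero]

theorem partialD_homog (q : Set.Ioo (0 : ℝ) 1) (m n : ℕ) : ∀ (i : Fin m) {p : Poly q m}, p ∈ homog (q : ℝ) m (n + 1) →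
    partialD q m i p ∈ homog (q : ℝ) m n := by
  induction n with
  | zero =>
    intro i p hp
    refine homog_induction q m 0 ((homog (q : ℝ) m 0).comap (partialD q m i)) (fun j p hp => ?_) hp
    rw [Submodule.mem_comap, partialD_coord_mul]
    simp only [partialD_homog_zero q m _ hp, mul_zero, smul_zero, sum_const_zero, add_zero]
    exact Submodule.smul_mem _ _ hp
  | succ n ih =>
    intro i p hp
    refine homog_induction q m (n + 1) ((homog (q : ℝ) m (n + 1)).comap (partialD q m i)) (fun j p hp => ?_) hp
    rw [Submodule.mem_comap, partialD_coord_mul]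
    refine Submodule.add_mem _ (Submodule.smul_mem _ _ hp) (Submodule.smul_mem _ _ ?_)
    exact Submodule.sum_mem _ fun k _ => Submodule.sum_mem _ fun l _ =>
      Submodule.smul_mem _ _ (coord_mul_mem q m n k (ih l hp))

theorem laplacian_homog (q : Set.Ioo (0 : ℝ) 1) (m n : ℕ) {p : Poly q m} (hp : p ∈ homog (q : ℝ) m n) :
    laplacian q m p = 0 ∨ ∃ n', n' + 2 = n ∧ laplacian q m p ∈ homog (q : ℝ) m n' := by
  have e : laplacian q m p = ∑ i, ∑ j, ((metric q m i j : ℝ) : ℂ) • partialD q m i (partialD q m j p) := by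
    simp only [laplacian, LinearMap.sum_apply, LinearMap.smul_apply, LinearMap.comp_apply]
  rw [e]
  match n, hp with
  | 0, hp => left; simp [partialD_homog_zero q m _ hp]
  | 1, hp => left; simp [partialD_homog_zero q m _ (partialD_homog q m 0 _ hp)]
  | n + 2, hp =>
    right
    exact ⟨n, rfl, Submodule.sum_mem _ fun i _ => Submodule.sum_mem _ fun j _ => Submodule.smul_mem _ _
      (partialD_homog q m n i (partialD_homog q m (n + 1) j hp))⟩

theorem laplacian_pow_homog (q : Set.Ioo (0 : ℝ) 1) (m : ℕ) (k : ℕ) : ∀ (n : ℕ) {p : Poly q m}, p ∈ homog (q : ℝ) m n →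
    n < k → (laplacian q m ^ k) p = 0 := by
  induction k with
  | zero => intro n p _ h; omega
  | succ k ih =>
    intro n p hp h
    rw [pow_succ, Module.End.mul_apply]
    rcases laplacian_homog q m n hp with h0 | ⟨n', hn, h1⟩
    · rw [h0, map_zero]
    · exact ih n' h1 (by omega)

theorem mem_iSup_homog (q : ℝ) (m : ℕ) (p : Poly q m) : p ∈ ⨆ n, homog q m n := by
  have h : ∀ a : FreeAlgebra ℂ (Fin m), ∀ w ∈ ⨆ n, homog q m n, RingQuot.mkAlgHom ℂ (Rel q m) a * w ∈ ⨆ n, homog q m n := by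
    intro a
    induction a using FreeAlgebra.induction with
    | grade0 c =>
      intro w hw
      rw [AlgHom.commutes, Algebra.algebraMap_eq_smul_one, smul_mul_assoc, one_mul]
      exact Submodule.smul_mem _ _ hw
    | grade1 j =>
      intro w hw
      have : (⨆ n, homog q m n) ≤ (⨆ n, homog q m n).comap (LinearMap.mulLeft ℂ (coord q m j)) :=
        iSup_le fun n p hp => Submodule.mem_iSup_of_mem (n + 1) (coord_mul_mem q m n j hp)
      exact this hw
    | mul a b ha hb => intro w hw; rw [map_mul, mul_assoc]; exact ha _ (hb _ hw)
    | add a b ha hb => intro w hw; rw [map_add, add_mul]; exact Submodule.add_mem _ (ha _ hw) (hb _ hw)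
  obtain ⟨a, rfl⟩ := RingQuot.mkAlgHom_surjective ℂ (Rel q m) p
  have h1 : (1 : Poly q m) ∈ ⨆ n, homog q m n := by
    refine Submodule.mem_iSup_of_mem 0 ?_
    rw [homog, pow_zero]; exact Submodule.one_le.1 le_rfl
  simpa using h a 1 h1

theorem laplacian_nilpotent (q : Set.Ioo (0 : ℝ) 1) (m : ℕ) (p : Poly q m) : ∃ N, ∀ k, N < k → (laplacian q m ^ k) p = 0 := by
  refine Submodule.iSup_induction (fun n => homog (q : ℝ) m n)
    (motive := fun p => ∃ N, ∀ k, N < k → (laplacian q m ^ k) p = 0) (mem_iSup_homog (q : ℝ) m p) ?_ ?_ ?_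
  · intro n p hp; exact ⟨n, fun k hk => laplacian_pow_homog q m k n hp hk⟩
  · exact ⟨0, fun k _ => map_zero _⟩
  · rintro x y ⟨M, hM⟩ ⟨N, hN⟩
    refine ⟨max M N, fun k hk => ?_⟩
    rw [map_add, hM k (lt_of_le_of_lt (le_max_left _ _) hk), hN k (lt_of_le_of_lt (le_max_right _ _) hk), add_zero]

/-- Evaluation at the origin. -/
noncomputable def evalZero (q : ℝ) (m : ℕ) : Poly q m →ₐ[ℂ] ℂ :=
  RingQuot.liftAlgHom ℂ ⟨FreeAlgebra.lift ℂ (fun _ : Fin m => (0 : ℂ)), by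
    rintro x y ⟨a, b⟩
    simp only [map_sum, map_smul, map_mul, map_zero, FreeAlgebra.lift_ι_apply, mul_zero, smul_zero, sum_const_zero]⟩

/-- The factorial `[n]_p!`, where `[u]_p = (p ^ u - 1) / (p - 1)`. -/
noncomputable def qFactorial (p : ℝ) (n : ℕ) : ℝ := ∏ i ∈ range n, (p ^ (i + 1) - 1) / (p - 1)

/-- The q-Gamma function `Γ_p(t) = (p; p)_∞ / (p ^ t; p)_∞ (1 - p) ^ (1 - t)`. -/
noncomputable def qGamma (p t : ℝ) : ℝ :=
  (∏' n : ℕ, (1 - p ^ (n + 1))) / (∏' n : ℕ, (1 - p ^ (t + n))) * (1 - p) ^ (1 - t)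

/-- The first q-Bessel function `J^{(1)}_ν(x | q²)`. -/
noncomputable def qBessel (p ν x : ℝ) : ℝ :=
  (x / (1 + p)) ^ ν * ∑' i : ℕ, (-1) ^ i / (qFactorial (p ^ 2) i * qGamma (p ^ 2) (i + ν + 1)) * (x / (1 + p)) ^ (2 * i)

/-- The constant `μ = 1 + q ^ (2 - m)`. -/
noncomputable def muc (q : ℝ) (m : ℕ) : ℝ := 1 + q ^ (2 - (m : ℝ))

/-- The coefficients of the integral over the quantum sphere. -/
noncomputable def pizzetti (q : ℝ) (m k : ℕ) : ℝ :=
  2 * qGamma (q ^ 2) (1 / 2) ^ m / (muc q m ^ (2 * k) * qFactorial (q ^ 2) k * qGamma (q ^ 2) (k + (m : ℝ) / 2))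

theorem pizzetti_finite (q : Set.Ioo (0 : ℝ) 1) (m : ℕ) (p : Poly q m) :
    (Function.support fun k : ℕ => ((pizzetti q m k : ℝ) : ℂ) * evalZero q m ((laplacian q m ^ k) p)).Finite := by
  obtain ⟨N, hN⟩ := laplacian_nilpotent q m p
  refine (Set.finite_Iic N).subset fun k hk => ?_
  by_contra h
  exact hk (by simp [hN k (not_le.1 h)])

/-- The integral over the quantum unit sphere,
`∫ p = ∑_k 2 Γ_{q²}(1/2) ^ m / (μ ^ (2k) [k]_{q²}! Γ_{q²}(k + m/2)) (Δ^k p)(0)`;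
the sum is finite by `pizzetti_finite`. -/
noncomputable def sphereIntegral (q : Set.Ioo (0 : ℝ) 1) (m : ℕ) : Poly q m →ₗ[ℂ] ℂ where
  toFun p := ∑ᶠ k : ℕ, ((pizzetti q m k : ℝ) : ℂ) * evalZero q m ((laplacian q m ^ k) p)
  map_add' p r := by
    rw [← finsum_add_distrib (pizzetti_finite q m p) (pizzetti_finite q m r)]
    simp only [map_add, mul_add]
  map_smul' c p := by
    simp only [map_smul, smul_eq_mul, RingHom.id_apply]
    rw [mul_finsum]
    exact finsum_congr fun k => by ring

/-- `E` is the braided exponential `exp_R(x|y)`, a formal power series in the coordinates `x` and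
in those of a second copy `y`, whose part of degree `a` in `x` and `b` in `y` is `E a b` (written
with the `x` on the left of the `y`): it satisfies `∂_x^j exp_R(x|y) = exp_R(x|y) y^j` and
`exp_R(0|y) = 1`. -/
structure IsBraidedExp (q : Set.Ioo (0 : ℝ) 1) (m : ℕ) (E : ℕ → ℕ → TensorProduct ℂ (Poly q m) (Poly q m)) : Prop where
  mem : ∀ a b, E a b ∈ LinearMap.range (TensorProduct.map (homog (q : ℝ) m a).subtype (homog (q : ℝ) m b).subtype)
  deriv_zero : ∀ j a, (partialD q m j).rTensor (Poly q m) (E (a + 1) 0) = 0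
  deriv_succ : ∀ j a b, (partialD q m j).rTensor (Poly q m) (E (a + 1) (b + 1)) =
    (LinearMap.mulRight ℂ (coord (q : ℝ) m j)).lTensor (Poly q m) (E a b)
  eval : ∀ b, E 0 b = if b = 0 then 1 else 0

/-- The spherical harmonics of degree `k`. -/
noncomputable def harmonic (q : Set.Ioo (0 : ℝ) 1) (m k : ℕ) : Submodule ℂ (Poly q m) :=
  homog (q : ℝ) m k ⊓ LinearMap.ker (laplacian q m)

/-- The part of degree `b` in `y` of `∫_x S(x) exp_R(ix|y)`, the integral being over the quantum
sphere in the `x` variables and `E` being the exponential. Replacing `x` by `ix` multiplies the part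
of degree `a` in `x` by `i ^ a`. -/
noncomputable def sphereIntegralExp (q : Set.Ioo (0 : ℝ) 1) (m : ℕ)
    (E : ℕ → ℕ → TensorProduct ℂ (Poly q m) (Poly q m)) (S : Poly q m) (b : ℕ) : Poly q m :=
  ∑ᶠ a : ℕ, TensorProduct.lid ℂ (Poly q m) ((sphereIntegral q m).rTensor (Poly q m)
    ((LinearMap.mulLeft ℂ S).rTensor (Poly q m) (Complex.I ^ a • E a b)))

/-- The squared radius `y² = y^i C_{ij} y^j`. -/
noncomputable def normSq (q : ℝ) (m : ℕ) : Poly q m :=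
  ∑ i, ∑ j, ((metric q m i j : ℝ) : ℂ) • (coord q m i * coord q m j)

/-- The formal power series `f(y²) = ∑_n φ_n (y²) ^ n` for a function `f` with Taylor coefficients
`φ_n`. The formal variable of the series records the degree in the coordinates `y`. -/
noncomputable def radial (q : ℝ) (m : ℕ) (φ : ℕ → ℝ) : PowerSeries (Poly q m) :=
  PowerSeries.mk fun b => if Even b then ((φ (b / 2) : ℝ) : ℂ) • normSq q m ^ (b / 2) else 0

end QEuclid

/-! The proof is a calculus of operators on `Poly`, in the notation λ = q - q⁻¹, κ = q^(1-m),
K^{ij}_{kl} = C^{ij} C_{kl}, [n] = 1 + q² + … + q^(2(n-1)). Three facts about R̂ carry it: the braid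
relation; the crossing relation, by which the metric slides past a strand and turns R̂⁻¹ into R̂;
and, on ker P_A, the formulas R̂ = q - (qλκ/μ) K and R̂⁻¹ = q⁻¹ + (λ/μ) K. The last apply to x^i x^j
by definition and to ∂^i ∂^j by `act_pa_partialD`. Contracting Leibniz rules then gives: x² is
central, Δ commutes with every ∂^j, Δ x^k = μ ∂^k + q² x^k Δ and ∂^k x² = μ x^k + q² x² ∂^k.

The decisive identity is a deformed Euler formula (`euler_homog`): on degree n, x^i C_{ij} ∂^j = [n]
+ γ x² Δ with γ = -q²λκ/μ². It recovers a polynomial of positive degree from its derivatives, which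
gives uniqueness of the exponential. Applied to a series with ∂^j E = E y^j, hence Δ E = E y², it
becomes a two-term recursion for the part e_n of bidegree (n, n), [n+1] e_{n+1} = x^i C_{ij} e_n y^j
- γ x² e_{n-1} y², and the solution of this recursion does have the required derivatives
(`derivX_expSeq`). This is existence.

For the integral, (Δ^j (S e_n))(0) is computed for a harmonic S of degree k by induction on k
(`lapPair_harmonic`). The Euler formula writes [k] S = x^i C_{ij} ∂^j S. Evaluating Δ^j at 0 trades
a leading x^i for μ [j] ∂^i and lowers j by one. In ∂^i (∂^j S · e_n) the braided Leibniz rule gives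
one term that contracts to Δ S = 0 and one in which ∂^l falls on e_n and produces y^l. What remains
is the same problem for the components U_l = C_{ij} O^i_l(∂^j S), which are harmonic of degree k - 1
and satisfy U_l x^l = [k] S. The factors [k] cancel, and the value is μ^k [j] [j-1] ⋯ [j-k+1]
(y²)^(j-k) S(y), or zero when degrees do not match. For k = 0 this says that exp_R is an eigenvector
of Δ with eigenvalue y².

Homogeneity leaves a single power of Δ in the integral for each degree in y, and comparing its
coefficient with the Bessel series (`pizzetti_mul`) finishes the proof. -/

namespace QEuclid

open Finset

/-! ### Scalar matrices acting on vectors with entries in a module -/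

section Action
variable {ι V W : Type*} [Fintype ι] [AddCommMonoid V] [Module ℂ V] [AddCommMonoid W] [Module ℂ W]

/-- The action of a matrix on a vector with entries in a module. -/
def act (M : Matrix ι ι ℂ) (F : ι → V) : ι → V := fun x => ∑ y, M x y • F y

theorem act_apply (M : Matrix ι ι ℂ) (F : ι → V) (x : ι) : act M F x = ∑ y, M x y • F y := rfl

theorem act_mul (M N : Matrix ι ι ℂ) (F : ι → V) : act (M * N) F = act M (act N F) := by
  funext x
  simp only [act_apply, Matrix.mul_apply, sum_smul, smul_sum, smul_smul]
  exact sum_comm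

theorem act_one [DecidableEq ι] (F : ι → V) : act (1 : Matrix ι ι ℂ) F = F := by
  funext x
  simp [act_apply, Matrix.one_apply]

theorem act_add_matrix (M N : Matrix ι ι ℂ) (F : ι → V) : act (M + N) F = act M F + act N F := by
  funext x
  simp [act_apply, add_smul, sum_add_distrib]

theorem act_sub_matrix {V : Type*} [AddCommGroup V] [Module ℂ V] (M N : Matrix ι ι ℂ) (F : ι → V) : act (M - N) F = act M F - act N F := by
  funext x
  simp [act_apply, sub_smul, sum_sub_distrib]

theorem act_smul_matrix (c : ℂ) (M : Matrix ι ι ℂ) (F : ι → V) : act (c • M) F = c • act M F := by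
  funext x
  simp [act_apply, smul_sum, smul_smul]

theorem act_add (M : Matrix ι ι ℂ) (F G : ι → V) : act M (F + G) = act M F + act M G := by
  funext x
  simp [act_apply, sum_add_distrib]

theorem act_smul (c : ℂ) (M : Matrix ι ι ℂ) (F : ι → V) : act M (c • F) = c • act M F := by
  funext x
  simp only [act_apply, Pi.smul_apply, smul_sum]
  exact sum_congr rfl fun y _ => smul_comm _ _ _

theorem act_zero (M : Matrix ι ι ℂ) : act M (0 : ι → V) = 0 := by
  funext x
  simp [act_apply]

theorem map_act (f : V →ₗ[ℂ] W) (M : Matrix ι ι ℂ) (F : ι → V) (x : ι) :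
    f (act M F x) = act M (fun y => f (F y)) x := by
  simp [act_apply]

end Action

/-! ### Complexified R-matrix and metric; the crossing relations -/

section Matrices
variable (q : ℝ) (m : ℕ)

/-- The metric with complex entries. -/
noncomputable def cm (i j : Fin m) : ℂ := ((metric q m i j : ℝ) : ℂ)

/-- The R-matrix with complex entries. -/
noncomputable def rc : Matrix (Fin m × Fin m) (Fin m × Fin m) ℂ := (rmat q m).map Complex.ofRealHom

/-- The inverse of the R-matrix with complex entries. -/
noncomputable def ri : Matrix (Fin m × Fin m) (Fin m × Fin m) ℂ := (rmat q m)⁻¹.map Complex.ofRealHom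

/-- The antisymmetrizer with complex entries. -/
noncomputable def pa : Matrix (Fin m × Fin m) (Fin m × Fin m) ℂ := (projA q m).map Complex.ofRealHom

/-- The eigenvalue `q ^ (1 - m)` of the R-matrix on the metric. -/
noncomputable def kap : ℂ := ((q ^ (1 - (m : ℝ)) : ℝ) : ℂ)

/-- The complex number `μ`. -/
noncomputable def mu : ℂ := ((muc q m : ℝ) : ℂ)

variable {q m}

theorem muc_pos (hq : 0 < q) : 0 < muc q m := by
  unfold muc; have := Real.rpow_pos_of_pos hq (2 - (m : ℝ)); linarith

theorem muc_eq (hq : 0 < q) : muc q m = 1 + q * q ^ (1 - (m : ℝ)) := by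
  unfold muc
  rw [show (2 - (m : ℝ)) = 1 + (1 - m) by ring, Real.rpow_add hq, Real.rpow_one]

theorem mu_ne (hq : 0 < q) : mu q m ≠ 0 := by
  unfold mu; exact_mod_cast (muc_pos hq).ne'

theorem mu_eq (hq : 0 < q) : mu q m = 1 + (q : ℂ) * kap q m := by
  unfold mu kap; rw [muc_eq hq]; push_cast; ring

theorem ofReal_ne (hq : 0 < q) : (q : ℂ) ≠ 0 := by exact_mod_cast hq.ne'

theorem rc_mul_ri (hq : 0 < q) : rc q m * ri q m = 1 := by
  rw [rc, ri, ← Matrix.map_mul, rmat_mul_rinv hq]; simp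

theorem ri_mul_rc (hq : 0 < q) : ri q m * rc q m = 1 := by
  rw [rc, ri, ← Matrix.map_mul, rinv_mul_rmat hq]; simp

theorem rc_symm (x y : Fin m × Fin m) : rc q m x y = rc q m y x := by
  have := congrFun (congrFun (rmat_transpose (q := q) (m := m)) y) x
  simp only [Matrix.transpose_apply] at this
  simp [rc, this]

theorem ri_symm (x y : Fin m × Fin m) : ri q m x y = ri q m y x := by
  have h : ((rmat q m)⁻¹).transpose = (rmat q m)⁻¹ := by
    rw [Matrix.transpose_nonsing_inv, rmat_transpose]
  have := congrFun (congrFun h y) x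
  simp only [Matrix.transpose_apply] at this
  simp [ri, this]

theorem cm_mul_cm (hq : 0 < q) (i k : Fin m) : ∑ j, cm q m i j * cm q m j k = if i = k then 1 else 0 := by
  have e : ∀ j, cm q m i j * cm q m j k = if j = i.rev then (if i = k then 1 else 0) else 0 := by
    intro j
    unfold cm metric
    by_cases h : j = i.rev
    · subst h
      by_cases h2 : i = k
      · subst h2
        have := wt_rev hq i
        simp only [Fin.rev_rev, if_true]
        exact_mod_cast this
      · simp [h2, Ne.symm h2]
    · simp [h]
  simp [e]

theorem rc_cm (hq : 0 < q) (x : Fin m × Fin m) :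
    ∑ y, rc q m x y * cm q m y.1 y.2 = kap q m * cm q m x.1 x.2 := by
  -- The eigenvector equation is read off from one column of R̂ K = κ K, chosen so that its common
  -- factor C_{kl} is nonzero and can be cancelled.
  have h := congrFun (congrFun (rmat_kmat (m := m) hq) x) (x.1, x.1.rev)
  have hw : wt q m x.1 ≠ 0 := left_ne_zero_of_mul_eq_one (wt_rev hq x.1)
  simp only [Matrix.mul_apply, kmat, Matrix.of_apply, Matrix.smul_apply, smul_eq_mul, ← mul_assoc, ← sum_mul] at h
  have h2 : metric q m x.1 x.1.rev ≠ 0 := by simpa [metric] using hw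
  have h3 := mul_right_cancel₀ h2 h
  have h4 := congrArg (fun t : ℝ => (t : ℂ)) h3
  simpa [rc, cm, kap] using h4

theorem cm_rc (hq : 0 < q) (y : Fin m × Fin m) :
    ∑ x, cm q m x.1 x.2 * rc q m x y = kap q m * cm q m y.1 y.2 := by
  rw [← rc_cm hq]
  exact sum_congr rfl fun x _ => by rw [rc_symm x y]; ring

theorem cross_complex (hq : 0 < q) (n i j k : Fin m) :
    ∑ l, ri q m (n, i) (k, l) * cm q m l j = ∑ l, cm q m n l * rc q m (i, j) (l, k) := by
  have := congrArg (fun t : ℝ => (t : ℂ)) (cross (m := m) hq n i j k)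
  simpa [rc, cm, ri] using this

/-- This and the next two lemmas are forms of the one crossing relation `cross_complex`, obtained
from the symmetry of R̂ and from C² = 1. Each moves the metric from one index position of R̂⁻¹ to
another at the price of replacing R̂⁻¹ by R̂. -/
theorem ri_upper_second (hq : 0 < q) (k n i j : Fin m) :
    ∑ l, ri q m (k, l) (n, i) * cm q m l j = ∑ l, cm q m n l * rc q m (l, k) (i, j) := by
  have := cross_complex hq n i j k
  simpa only [ri_symm (n, i), rc_symm (i, j)] using this

theorem ri_lower_first (hq : 0 < q) (a i k l : Fin m) :
    ∑ n, cm q m a n * ri q m (n, i) (k, l) = ∑ j, rc q m (i, j) (a, k) * cm q m j l := by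
  -- The identity C² = 1 is inserted on the last index, so that `cross_complex` applies; the metric
  -- it produces cancels the given one.
  have h1 : ∀ n, ri q m (n, i) (k, l) = ∑ j, (∑ b, ri q m (n, i) (k, b) * cm q m b j) * cm q m j l := by
    intro n
    simp only [sum_mul, mul_assoc]
    rw [sum_comm]
    simp only [← mul_sum, cm_mul_cm hq]
    simp
  have h2 : ∀ n, cm q m a n * ri q m (n, i) (k, l) =
      ∑ j, ∑ b, (cm q m a n * cm q m n b) * (rc q m (i, j) (b, k) * cm q m j l) := by
    intro n
    rw [h1, mul_sum]
    refine sum_congr rfl fun j _ => ?_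
    rw [cross_complex hq, sum_mul, mul_sum]
    exact sum_congr rfl fun b _ => by ring
  simp only [h2]
  rw [sum_comm]
  refine sum_congr rfl fun j _ => ?_
  rw [sum_comm]
  simp only [← sum_mul, cm_mul_cm hq]
  simp

theorem ri_lower_third (hq : 0 < q) (a k l i : Fin m) :
    ∑ n, cm q m a n * ri q m (k, l) (n, i) = ∑ j, rc q m (a, k) (i, j) * cm q m j l := by
  have := ri_lower_first hq a i k l
  simpa only [ri_symm _ (k, l), rc_symm _ (a, k)] using this

end Matrices

/-! ### Contraction with the metric and actions on three indices -/

section Indices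
variable {q : ℝ} {m : ℕ} {V : Type*} [AddCommMonoid V] [Module ℂ V]

/-- The contraction of a pair of indices with the metric. -/
noncomputable def contr (q : ℝ) (m : ℕ) (F : Fin m × Fin m → V) : V := ∑ y, cm q m y.1 y.2 • F y

theorem contr_act_rc (hq : 0 < q) (F : Fin m × Fin m → V) :
    contr q m (act (rc q m) F) = kap q m • contr q m F := by
  simp only [contr, act_apply, smul_sum, smul_smul, ← cm_rc hq, sum_smul]
  exact sum_comm

theorem act_kmat (F : Fin m × Fin m → V) (x : Fin m × Fin m) :
    act ((kmat q m).map Complex.ofRealHom) F x = cm q m x.1 x.2 • contr q m F := by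
  simp only [act_apply, contr, kmat, cm, smul_sum, smul_smul, Matrix.map_apply, Matrix.of_apply, map_mul, Complex.ofRealHom_eq_coe]

/-- The action of a matrix on the first two of three indices. -/
noncomputable def act12 (M : Matrix (Fin m × Fin m) (Fin m × Fin m) ℂ) (F : Fin m → Fin m → Fin m → V) :
    Fin m → Fin m → Fin m → V := fun a b d => act M (fun y => F y.1 y.2 d) (a, b)

/-- The action of a matrix on the last two of three indices. -/
noncomputable def act23 (M : Matrix (Fin m × Fin m) (Fin m × Fin m) ℂ) (F : Fin m → Fin m → Fin m → V) :
    Fin m → Fin m → Fin m → V := fun d a b => act M (fun y => F d y.1 y.2) (a, b)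

end Indices

/-! ### R̂ on the kernel of the antisymmetrizer; braid relations with values in a module -/

section Relations
variable {q : ℝ} {m : ℕ} {V : Type*} [AddCommGroup V] [Module ℂ V]

/-- The coefficient of K in P_A, freed from the sum C^{ab} C_{ab}. The value of that sum contains
the factor 1 + qκ = μ, which is how μ enters the whole calculus. -/
theorem csum_complex (hm : 0 < m) (hq : 0 < q) (hq1 : q < 1) :
    ((((q ^ (1 - (m : ℝ)) - q) * (csum q m)⁻¹ : ℝ)) : ℂ) = - ((q : ℂ) * (q - (q : ℂ)⁻¹) * kap q m) / mu q m := by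
  obtain ⟨h0, h1⟩ := csum_eq hm hq hq1
  have hmu := (muc_pos (m := m) hq).ne'
  have : (q ^ (1 - (m : ℝ)) - q) * (csum q m)⁻¹ = - (q * (q - q⁻¹) * q ^ (1 - (m : ℝ))) / muc q m := by
    rw [eq_div_iff hmu]
    rw [mul_right_comm, ← div_eq_mul_inv, div_eq_iff h0, muc_eq hq]
    linear_combination h1
  rw [this]; unfold kap mu; push_cast; ring

theorem pa_eq (hm : 0 < m) (hq : 0 < q) (hq1 : q < 1) : pa q m = ((q : ℂ) + (q : ℂ)⁻¹)⁻¹ • ((q : ℂ) • 1 +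
    (- ((q : ℂ) * (q - (q : ℂ)⁻¹) * kap q m) / mu q m) • (kmat q m).map Complex.ofRealHom - rc q m) := by
  rw [← csum_complex hm hq hq1, pa, projA_eq]
  ext x y
  simp only [Matrix.map_apply, Matrix.smul_apply, Matrix.sub_apply, Matrix.add_apply, smul_eq_mul, rc, Matrix.one_apply]
  split_ifs <;> simp

/-- On the kernel of the antisymmetrizer the R-matrix acts by `q` up to a multiple of the metric. -/
theorem act_rc_of_antisymm (hm : 0 < m) (hq : 0 < q) (hq1 : q < 1) {F : Fin m × Fin m → V} (hF : act (pa q m) F = 0)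
    (x : Fin m × Fin m) : act (rc q m) F x = (q : ℂ) • F x -
      ((q : ℂ) * (q - (q : ℂ)⁻¹) * kap q m / mu q m * cm q m x.1 x.2) • contr q m F := by
  have hs : ((q : ℂ) + (q : ℂ)⁻¹)⁻¹ ≠ 0 := by
    have : 0 < (q + q⁻¹)⁻¹ := by positivity
    exact_mod_cast this.ne'
  rw [pa_eq hm hq hq1, act_smul_matrix, smul_eq_zero_iff_right hs, act_sub_matrix, act_add_matrix, act_smul_matrix, act_smul_matrix,
    act_one, sub_eq_zero] at hF
  rw [← hF, Pi.add_apply, Pi.smul_apply, Pi.smul_apply, act_kmat, smul_smul,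
    sub_eq_add_neg (_ • F x), ← neg_smul]
  congr 2; ring

/-- The skein relation gives R̂⁻¹ = R̂ - λ + λ K. Inserting the value of R̂ on ker P_A, the
coefficient of K becomes λ (1 - qκ/μ) = λ/μ. -/
theorem act_ri_of_antisymm (hm : 0 < m) (hq : 0 < q) (hq1 : q < 1) {F : Fin m × Fin m → V} (hF : act (pa q m) F = 0)
    (x : Fin m × Fin m) : act (ri q m) F x = (q : ℂ)⁻¹ • F x +
      ((q - (q : ℂ)⁻¹) / mu q m * cm q m x.1 x.2) • contr q m F := by
  have e : ri q m = rc q m - ((q : ℂ) - (q : ℂ)⁻¹) • 1 + ((q : ℂ) - (q : ℂ)⁻¹) • (kmat q m).map Complex.ofRealHom := by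
    rw [ri, rmat_inv hq]
    ext x y
    simp only [Matrix.map_apply, Matrix.smul_apply, Matrix.sub_apply, Matrix.add_apply, smul_eq_mul, rc, Matrix.one_apply]
    split_ifs <;> simp
  rw [e, act_add_matrix, act_sub_matrix, act_smul_matrix, act_smul_matrix, act_one]
  simp only [Pi.add_apply, Pi.sub_apply, Pi.smul_apply]
  rw [act_rc_of_antisymm hm hq hq1 hF, act_kmat]
  have hmu := mu_ne (m := m) hq
  have h1 := mu_eq (m := m) hq
  have h2 : ((q : ℂ) - (q : ℂ)⁻¹) * cm q m x.1 x.2 - (q : ℂ) * (q - (q : ℂ)⁻¹) * kap q m / mu q m * cm q m x.1 x.2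
      = ((q - (q : ℂ)⁻¹) / mu q m * cm q m x.1 x.2) := by
    have hq0 := ofReal_ne hq
    field_simp
    rw [h1]; ring
  rw [← h2]
  module

/-- On the image of P_A the R-matrix is -q⁻¹, where 1 + q R̂ vanishes. This removes the
inhomogeneous terms when P_A is applied to ∂^i ∂^j x^k. -/
theorem pa_mul_rc (hm : 0 < m) (hq : 0 < q) (hq1 : q < 1) : pa q m * (1 + (q : ℂ) • rc q m) = 0 := by
  have h := congrArg (fun M : Matrix _ _ ℝ => M.map Complex.ofRealHom) (projA_mul hm hq hq1)
  simp only [Matrix.map_mul] at h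
  have e : (1 + q • rmat q m).map Complex.ofRealHom = 1 + (q : ℂ) • rc q m := by
    ext x y
    simp only [Matrix.map_apply, Matrix.smul_apply, Matrix.add_apply, smul_eq_mul, rc, Matrix.one_apply]
    split_ifs <;> simp
  rw [e] at h
  rw [pa, h]; ext; simp

/-- The matrices have real entries, so a real-linear functional commutes with them. Identities with
values in a module thus reduce to the scalar operators `op12` and `op23`, for which the braid
relation is known. -/
theorem dual_act12 (φ : V →ₗ[ℝ] ℝ) (M : Matrix (Fin m × Fin m) (Fin m × Fin m) ℝ)
    (F : Fin m → Fin m → Fin m → V) (a b d : Fin m) :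
    φ (act12 (M.map Complex.ofRealHom) F a b d) = op12 M (fun a b d => φ (F a b d)) a b d := by
  simp only [act12, act_apply, op12_apply, map_sum, Matrix.map_apply, Complex.ofRealHom_eq_coe, Complex.coe_smul, map_smul, smul_eq_mul]

theorem dual_act23 (φ : V →ₗ[ℝ] ℝ) (M : Matrix (Fin m × Fin m) (Fin m × Fin m) ℝ)
    (F : Fin m → Fin m → Fin m → V) (a b d : Fin m) :
    φ (act23 (M.map Complex.ofRealHom) F a b d) = op23 M (fun a b d => φ (F a b d)) a b d := by
  simp only [act23, act_apply, op23_apply, map_sum, Matrix.map_apply, Complex.ofRealHom_eq_coe, Complex.coe_smul, map_smul, smul_eq_mul]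

theorem eq_of_real_dual {v w : V} (h : ∀ φ : V →ₗ[ℝ] ℝ, φ v = φ w) : v = w :=
  sub_eq_zero.1 ((Module.forall_dual_apply_eq_zero_iff ℝ (v - w)).1 fun φ => by rw [map_sub, h φ, sub_self])

/-- The braid relation for the inverse R-matrix. -/
theorem braid_ri (hq : 0 < q) (F : Fin m → Fin m → Fin m → V) :
    act12 (ri q m) (act23 (ri q m) (act12 (ri q m) F)) = act23 (ri q m) (act12 (ri q m) (act23 (ri q m) F)) := by
  have h := (braid_aux (op12 (rmat q m)) (op23 (rmat q m)) (op12 (rmat q m)⁻¹) (op23 (rmat q m)⁻¹)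
    (by rw [← op12_mul, rmat_mul_rinv hq, op12_one]) (by rw [← op12_mul, rinv_mul_rmat hq, op12_one])
    (by rw [← op23_mul, rmat_mul_rinv hq, op23_one]) (by rw [← op23_mul, rinv_mul_rmat hq, op23_one]) (braid hq)).2
  funext a b d
  refine eq_of_real_dual fun φ => ?_
  simp only [ri, dual_act12, dual_act23]
  exact (congrFun (congrFun (congrFun (LinearMap.congr_fun h fun a b d => φ (F a b d)) a) b) d).symm

/-- The antisymmetrizer can be moved through the braiding. -/
theorem braid_pa (hq : 0 < q) (hq1 : q < 1) (F : Fin m → Fin m → Fin m → V) :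
    act12 (pa q m) (act23 (ri q m) (act12 (ri q m) F)) = act23 (ri q m) (act12 (ri q m) (act23 (pa q m) F)) := by
  -- P_A is a linear combination of 1, R̂ and R̂⁻¹, and each of these passes through the braiding.
  -- This is the mirror image of `projA_braid`, with the roles of the two positions exchanged.
  have h : op12 (projA q m) * (op23 (rmat q m)⁻¹ * op12 (rmat q m)⁻¹) =
      op23 (rmat q m)⁻¹ * (op12 (rmat q m)⁻¹ * op23 (projA q m)) := by
    obtain ⟨r, s, t, h⟩ := projA_poly (m := m) hq hq1
    have h1 := braid_aux (op23 (rmat q m)) (op12 (rmat q m)) (op23 (rmat q m)⁻¹) (op12 (rmat q m)⁻¹)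
      (by rw [← op23_mul, rmat_mul_rinv hq, op23_one]) (by rw [← op23_mul, rinv_mul_rmat hq, op23_one])
      (by rw [← op12_mul, rmat_mul_rinv hq, op12_one]) (by rw [← op12_mul, rinv_mul_rmat hq, op12_one]) (braid hq).symm
    rw [h, op23_lin, op12_lin, op12_one, op23_one]
    simp only [add_mul, mul_add, smul_mul_assoc, mul_smul_comm, one_mul, mul_one, h1.1, h1.2]
  funext a b d
  refine eq_of_real_dual fun φ => ?_
  simp only [ri, pa, dual_act12, dual_act23]
  exact congrFun (congrFun (congrFun (LinearMap.congr_fun h fun a b d => φ (F a b d)) a) b) d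

end Relations

/-! ### Sliding contractions through the braiding -/

section Contractions
variable {q : ℝ} {m : ℕ} {V : Type*} [AddCommMonoid V] [Module ℂ V]

theorem act12_apply (M : Matrix (Fin m × Fin m) (Fin m × Fin m) ℂ) (F : Fin m → Fin m → Fin m → V) (a b d : Fin m) :
    act12 M F a b d = act M (fun y => F y.1 y.2 d) (a, b) := rfl

theorem act23_apply (M : Matrix (Fin m × Fin m) (Fin m × Fin m) ℂ) (F : Fin m → Fin m → Fin m → V) (d a b : Fin m) :
    act23 M F d a b = act M (fun y => F d y.1 y.2) (a, b) := rfl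

theorem contr_apply (F : Fin m × Fin m → V) : contr q m F = ∑ i, ∑ j, cm q m i j • F (i, j) :=
  Fintype.sum_prod_type _

theorem contr_add (F G : Fin m × Fin m → V) : contr q m (fun y => F y + G y) = contr q m F + contr q m G := by
  simp [contr, sum_add_distrib]

theorem contr_sub {V : Type*} [AddCommGroup V] [Module ℂ V] (F G : Fin m × Fin m → V) : contr q m (fun y => F y - G y) = contr q m F - contr q m G := by
  simp [contr, sum_sub_distrib, smul_sub]

theorem contr_smul (c : ℂ) (F : Fin m × Fin m → V) : contr q m (fun y => c • F y) = c • contr q m F := by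
  simp only [contr, smul_sum]
  exact sum_congr rfl fun y _ => smul_comm _ _ _

theorem map_contr {W : Type*} [AddCommMonoid W] [Module ℂ W] (f : V →ₗ[ℂ] W) (F : Fin m × Fin m → V) :
    f (contr q m F) = contr q m (fun y => f (F y)) := by
  simp [contr]

theorem contr_snd (hq : 0 < q) (v : Fin m → V) (k : Fin m) :
    contr q m (fun y => cm q m y.2 k • v y.1) = v k := by
  rw [contr_apply]
  simp only [smul_smul, ← sum_smul, cm_mul_cm hq]
  simp

theorem contr_fst (hq : 0 < q) (v : Fin m → V) (k : Fin m) :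
    contr q m (fun y => cm q m k y.1 • v y.2) = v k := by
  rw [contr_apply, sum_comm]
  simp only [smul_smul, ← sum_smul, mul_comm (cm q m _ _) (cm q m k _), cm_mul_cm hq]
  simp

/-- Pulling a contraction through the braiding, from the left. -/
theorem contr_act23_ri (hq : 0 < q) (F : Fin m → Fin m → Fin m → V) (k : Fin m) :
    contr q m (fun y => act23 (ri q m) F y.1 y.2 k) = contr q m (fun y => act12 (rc q m) F k y.1 y.2) := by
  simp only [contr_apply, act23_apply, act12_apply, act_apply, Fintype.sum_prod_type, smul_sum, smul_smul]
  have e1 : ∀ i, ∑ j, ∑ a, ∑ b, (cm q m i j * ri q m (j, k) (a, b)) • F i a b =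
      ∑ a, ∑ b, ∑ t, (rc q m (k, t) (i, a) * cm q m t b) • F i a b := by
    intro i
    rw [sum_comm]
    refine sum_congr rfl fun a _ => ?_
    rw [sum_comm]
    refine sum_congr rfl fun b _ => ?_
    rw [← sum_smul, ← sum_smul, ri_lower_first hq]
  simp only [e1]
  have e2 : ∀ t b, ∑ i, ∑ a, (cm q m t b * rc q m (k, t) (i, a)) • F i a b =
      ∑ i, ∑ a, (rc q m (k, t) (i, a) * cm q m t b) • F i a b := by
    intro t b; simp only [mul_comm]
  simp only [e2]
  calc _ = ∑ i, ∑ a, ∑ t, ∑ b, (rc q m (k, t) (i, a) * cm q m t b) • F i a b := by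
        refine sum_congr rfl fun i _ => sum_congr rfl fun a _ => sum_comm
    _ = ∑ i, ∑ t, ∑ a, ∑ b, (rc q m (k, t) (i, a) * cm q m t b) • F i a b := by
        refine sum_congr rfl fun i _ => sum_comm
    _ = ∑ t, ∑ i, ∑ a, ∑ b, (rc q m (k, t) (i, a) * cm q m t b) • F i a b := sum_comm
    _ = ∑ t, ∑ i, ∑ b, ∑ a, (rc q m (k, t) (i, a) * cm q m t b) • F i a b := by
        refine sum_congr rfl fun t _ => sum_congr rfl fun i _ => sum_comm
    _ = _ := sum_congr rfl fun t _ => sum_comm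

/-- Pulling a contraction through the braiding, from the right. -/
theorem contr_act12_ri (hq : 0 < q) (F : Fin m → Fin m → Fin m → V) (k : Fin m) :
    contr q m (fun y => act12 (ri q m) F k y.1 y.2) = contr q m (fun y => act23 (rc q m) F y.1 y.2 k) := by
  simp only [contr_apply, act23_apply, act12_apply, act_apply, Fintype.sum_prod_type, smul_sum, smul_smul]
  have e1 : ∀ j, ∑ i, ∑ a, ∑ b, (cm q m i j * ri q m (k, i) (a, b)) • F a b j =
      ∑ a, ∑ b, ∑ s, (cm q m a s * rc q m (s, k) (b, j)) • F a b j := by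
    intro j
    rw [sum_comm]
    refine sum_congr rfl fun a _ => ?_
    rw [sum_comm]
    refine sum_congr rfl fun b _ => ?_
    rw [← sum_smul, ← sum_smul, ← ri_upper_second hq]
    simp only [mul_comm]
  rw [sum_comm]
  simp only [e1]
  calc _ = ∑ a, ∑ j, ∑ b, ∑ s, (cm q m a s * rc q m (s, k) (b, j)) • F a b j := sum_comm
    _ = ∑ a, ∑ b, ∑ j, ∑ s, (cm q m a s * rc q m (s, k) (b, j)) • F a b j :=
        sum_congr rfl fun a _ => sum_comm
    _ = ∑ a, ∑ b, ∑ s, ∑ j, (cm q m a s * rc q m (s, k) (b, j)) • F a b j :=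
        sum_congr rfl fun a _ => sum_congr rfl fun b _ => sum_comm
    _ = _ := sum_congr rfl fun a _ => sum_comm

theorem act12_act12 (M N : Matrix (Fin m × Fin m) (Fin m × Fin m) ℂ) (F : Fin m → Fin m → Fin m → V) :
    act12 M (act12 N F) = act12 (M * N) F := by
  funext a b d
  rw [act12_apply, act12_apply, act_mul]; rfl

theorem act23_act23 (M N : Matrix (Fin m × Fin m) (Fin m × Fin m) ℂ) (F : Fin m → Fin m → Fin m → V) :
    act23 M (act23 N F) = act23 (M * N) F := by
  funext a b d
  rw [act23_apply, act23_apply, act_mul]; rfl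

theorem act12_one (F : Fin m → Fin m → Fin m → V) : act12 1 F = F := by
  funext a b d
  rw [act12_apply, act_one]

theorem act23_one (F : Fin m → Fin m → Fin m → V) : act23 1 F = F := by
  funext a b d
  rw [act23_apply, act_one]

/-- A closed pair of indices passes a third strand freely: pulling the contraction through the outer
R̂⁻¹ turns it into R̂ at the other position, which cancels the inner R̂⁻¹. -/
theorem contr_act23_act12 (hq : 0 < q) (F : Fin m → Fin m → Fin m → V) (k : Fin m) :
    contr q m (fun y => act23 (ri q m) (act12 (ri q m) F) y.1 y.2 k) = contr q m (fun y => F k y.1 y.2) := by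
  rw [contr_act23_ri hq, act12_act12, rc_mul_ri hq, act12_one]

theorem contr_act12_act23 (hq : 0 < q) (F : Fin m → Fin m → Fin m → V) (k : Fin m) :
    contr q m (fun y => act12 (ri q m) (act23 (ri q m) F) k y.1 y.2) = contr q m (fun y => F y.1 y.2 k) := by
  rw [contr_act12_ri hq, act23_act23, rc_mul_ri hq, act23_one]

/-- When the Leibniz rule is applied twice, the second application leaves a metric under R̂⁻¹. In
the form given here that term is R̂ acting on the inhomogeneous term of the first application, so
the two combine to 1 + q R̂. The next lemma is the mirror image. -/
theorem act23_ri_cm (hq : 0 < q) (v : Fin m → V) (i j k : Fin m) :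
    act23 (ri q m) (fun i a b => cm q m i a • v b) i j k = act (rc q m) (fun y => cm q m y.2 k • v y.1) (i, j) := by
  simp only [act23_apply, act_apply, Fintype.sum_prod_type, smul_smul]
  rw [sum_comm]
  refine sum_congr rfl fun b _ => ?_
  rw [← sum_smul, ← sum_smul, ← ri_lower_third hq]
  simp only [mul_comm]

theorem act12_ri_cm (hq : 0 < q) (v : Fin m → V) (k i j : Fin m) :
    act12 (ri q m) (fun a b j => cm q m b j • v a) k i j = act (rc q m) (fun y => cm q m k y.1 • v y.2) (i, j) := by
  simp only [act12_apply, act_apply, Fintype.sum_prod_type, smul_smul]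
  conv_rhs => rw [sum_comm]
  refine sum_congr rfl fun a _ => ?_
  rw [← sum_smul, ← sum_smul, cross_complex hq]
  simp only [mul_comm]

end Contractions

/-! ### Induction on polynomials and centrality of x² -/

section Operators
variable (q : Set.Ioo (0 : ℝ) 1) {m : ℕ}

/-- Derivatives are known through their commutation with left multiplication by a coordinate, so
operator identities are proved by this induction. Unlike `homog_induction` it needs no degree. -/
theorem poly_induction {q : ℝ} {m : ℕ} {motive : Poly q m → Prop} (one : motive 1)
    (coord_mul : ∀ j p, motive p → motive (coord q m j * p)) (add : ∀ p r, motive p → motive r → motive (p + r))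
    (smul : ∀ (c : ℂ) p, motive p → motive (c • p)) (p : Poly q m) : motive p := by
  have h : ∀ a : FreeAlgebra ℂ (Fin m), ∀ w, motive w → motive (RingQuot.mkAlgHom ℂ (Rel q m) a * w) := by
    intro a
    induction a using FreeAlgebra.induction with
    | grade0 c =>
      intro w hw
      rw [AlgHom.commutes, Algebra.algebraMap_eq_smul_one, smul_mul_assoc, one_mul]
      exact smul _ _ hw
    | grade1 j => intro w hw; exact coord_mul j w hw
    | mul a b ha hb => intro w hw; rw [map_mul, mul_assoc]; exact ha _ (hb _ hw)
    | add a b ha hb => intro w hw; rw [map_add, add_mul]; exact add _ _ (ha _ hw) (hb _ hw)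
  obtain ⟨a, rfl⟩ := RingQuot.mkAlgHom_surjective ℂ (Rel q m) p
  simpa using h a 1 one

theorem act_pa_coord (q : ℝ) (m : ℕ) :
    act (pa q m) (fun y => coord q m y.1 * coord q m y.2) = 0 := by
  funext x
  rw [act_apply, Fintype.sum_prod_type]
  exact coord_rel q m x.1 x.2

theorem act_pa_coord_mul (q : ℝ) (m : ℕ) (p : Poly q m) :
    act (pa q m) (fun y => coord q m y.1 * coord q m y.2 * p) = 0 := by
  funext x
  have := congrArg (· * p) (congrFun (act_pa_coord q m) x)
  simpa [act_apply, sum_mul] using this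

theorem normSq_eq (q : ℝ) (m : ℕ) : normSq q m = contr q m (fun y => coord q m y.1 * coord q m y.2) := by
  rw [contr_apply]; rfl

theorem normSq_mul (q : ℝ) (m : ℕ) (p : Poly q m) :
    normSq q m * p = contr q m (fun y => coord q m y.1 * coord q m y.2 * p) := by
  rw [normSq_eq]
  exact map_contr (LinearMap.mulRight ℂ p) _

theorem mul_normSq (q : ℝ) (m : ℕ) (p : Poly q m) :
    p * normSq q m = contr q m (fun y => p * (coord q m y.1 * coord q m y.2)) := by
  rw [normSq_eq]
  exact map_contr (LinearMap.mulLeft ℂ p) _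

theorem partialD_coord_mul_act (i j : Fin m) (p : Poly q m) :
    partialD q m i (coord q m j * p) = cm q m i j • p +
      ((q : ℝ) : ℂ) • act (ri q m) (fun y => coord q m y.1 * partialD q m y.2 p) (i, j) := by
  rw [partialD_coord_mul, act_apply, Fintype.sum_prod_type]; rfl

theorem laplacian_eq (p : Poly q m) :
    laplacian q m p = contr q m (fun y => partialD q m y.1 (partialD q m y.2 p)) := by
  rw [contr_apply]
  simp only [laplacian, LinearMap.sum_apply, LinearMap.smul_apply, LinearMap.comp_apply]
  rfl

/-- The contraction of x x x on the last two indices is also the contraction on the first two after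
two factors R̂⁻¹. Both act on pairs of coordinates, where R̂⁻¹ = q⁻¹ + (λ/μ) K, so the identity
becomes a linear relation between x^k x² and x² x^k. -/
theorem coord_mul_normSq (k : Fin m) : coord q m k * normSq q m = normSq q m * coord q m k := by
  obtain ⟨q, hq, hq1⟩ := q
  have hm := k.pos
  have h := contr_act23_act12 (m := m) hq (fun i a b => coord q m i * coord q m a * coord q m b) k
  have e1 : act12 (ri q m) (fun i a b => coord q m i * coord q m a * coord q m b) = fun i a b =>
      (q : ℂ)⁻¹ • (coord q m i * coord q m a * coord q m b) +
      ((q - (q : ℂ)⁻¹) / mu q m) • (cm q m i a • (normSq q m * coord q m b)) := by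
    funext i a b
    rw [act12_apply, act_ri_of_antisymm hm hq hq1 (act_pa_coord_mul q m _), normSq_mul, smul_smul]
  have e2 : ∀ i j, act23 (ri q m) (fun i a b =>
      (q : ℂ)⁻¹ • (coord q m i * coord q m a * coord q m b) +
      ((q - (q : ℂ)⁻¹) / mu q m) • (cm q m i a • (normSq q m * coord q m b))) i j k =
      (q : ℂ)⁻¹ • ((q : ℂ)⁻¹ • (coord q m i * (coord q m j * coord q m k)) +
        ((q - (q : ℂ)⁻¹) / mu q m) • (cm q m j k • (coord q m i * normSq q m))) +
      ((q - (q : ℂ)⁻¹) / mu q m) • act (rc q m) (fun y => cm q m y.2 k • (normSq q m * coord q m y.1)) (i, j) := by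
    intro i j
    rw [← act23_ri_cm hq (fun b => normSq q m * coord q m b), act23_apply, act23_apply]
    have := act_ri_of_antisymm hm hq hq1 (act_pa_coord q m) (j, k)
    rw [← normSq_eq] at this
    have h2 : act (ri q m) (fun y => coord q m i * coord q m y.1 * coord q m y.2) (j, k) =
      (q : ℂ)⁻¹ • (coord q m i * (coord q m j * coord q m k)) +
        ((q - (q : ℂ)⁻¹) / mu q m) • (cm q m j k • (coord q m i * normSq q m)) := by
      have h3 := congrArg (coord q m i * ·) this
      simp only [mul_add, mul_smul_comm] at h3
      rw [smul_smul, ← h3]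
      have := map_act (LinearMap.mulLeft ℂ (coord q m i)) (ri q m) (fun y => coord q m y.1 * coord q m y.2) (j, k)
      simp only [LinearMap.mulLeft_apply, ← mul_assoc] at this
      exact this.symm
    rw [← h2, ← Pi.smul_apply, ← act_smul, ← Pi.smul_apply, ← act_smul, ← Pi.add_apply, ← act_add]
    rfl
  rw [e1] at h
  simp only [e2] at h
  rw [contr_add, contr_smul, contr_add, contr_smul, contr_smul, contr_smul, contr_act_rc hq,
    contr_snd hq (fun i => coord q m i * normSq q m), contr_snd hq (fun i => normSq q m * coord q m i)] at h
  simp only [mul_assoc] at h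
  rw [← mul_normSq] at h
  simp only [← mul_assoc] at h
  rw [← normSq_mul] at h
  have hmu := mu_ne (m := m) hq
  have h1 := mu_eq (m := m) hq
  have hq0 := ofReal_ne hq
  -- After multiplication by μ q² and the substitution μ = 1 + qκ, both x^k x² and x² x^k carry this
  -- coefficient, which is positive.
  have hne : (1 + (q : ℂ) ^ 3 * kap q m) ≠ 0 := by
    have : 0 < 1 + q ^ 3 * q ^ (1 - (m : ℝ)) := by positivity
    unfold kap; exact_mod_cast this.ne'
  have h4 : (1 + (q : ℂ) ^ 3 * kap q m) • (coord q m k * normSq q m) = (1 + (q : ℂ) ^ 3 * kap q m) • (normSq q m * coord q m k) := by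
    have h5 := congrArg ((mu q m * (q : ℂ) ^ 2) • ·) h
    simp only [smul_add, smul_smul] at h5
    have c1 : mu q m * (q : ℂ) ^ 2 * ((q : ℂ)⁻¹ * (q : ℂ)⁻¹) = mu q m := by field_simp
    have c2 : mu q m * (q : ℂ) ^ 2 * ((q : ℂ)⁻¹ * ((q - (q : ℂ)⁻¹) / mu q m)) = (q : ℂ) ^ 2 - 1 := by field_simp
    have c3 : mu q m * (q : ℂ) ^ 2 * ((q - (q : ℂ)⁻¹) / mu q m * kap q m) = (q : ℂ) * ((q : ℂ) ^ 2 - 1) * kap q m := by field_simp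
    rw [c1, c2, c3, h1] at h5
    rw [← sub_eq_zero] at h5 ⊢
    rw [← neg_eq_zero, ← h5]
    module
  exact smul_right_injective _ hne h4

theorem normSq_comm (p : Poly q m) : p * normSq q m = normSq q m * p := by
  induction p using poly_induction with
  | one => rw [one_mul, mul_one]
  | coord_mul j p hp => rw [mul_assoc, hp, ← mul_assoc, coord_mul_normSq, mul_assoc]
  | add p r hp hr => rw [add_mul, mul_add, hp, hr]
  | smul c p hp => rw [smul_mul_assoc, mul_smul_comm, hp]

end Operators

/-! ### Commutation rules of Δ, ∂, x² and the Euler operator -/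

section Derivatives

theorem mul_act {q : ℝ} {m : ℕ} {ι : Type*} [Fintype ι] (r : Poly q m) (M : Matrix ι ι ℂ) (F : ι → Poly q m) (x : ι) :
    r * act M F x = act M (fun y => r * F y) x :=
  map_act (LinearMap.mulLeft ℂ r) M F x

theorem mul_contr {q : ℝ} {m : ℕ} (r : Poly q m) (F : Fin m × Fin m → Poly q m) :
    r * contr q m F = contr q m (fun y => r * F y) :=
  map_contr (LinearMap.mulLeft ℂ r) F

variable (q : Set.Ioo (0 : ℝ) 1) {m : ℕ}

/-- The Leibniz rule applied twice. The two inhomogeneous terms are v and q R̂ v for the same v =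
C^{jk} ∂^i p, so P_A annihilates their sum and a contraction multiplies it by 1 + qκ = μ. -/
theorem partialD_partialD_coord_mul (i j k : Fin m) (p : Poly q m) :
    partialD q m i (partialD q m j (coord q m k * p)) = cm q m j k • partialD q m i p +
      ((q : ℝ) : ℂ) • act (rc q m) (fun y => cm q m y.2 k • partialD q m y.1 p) (i, j) +
      (((q : ℝ) : ℂ) ^ 2) • act23 (ri q m) (act12 (ri q m)
        (fun c d b => coord q m c * partialD q m d (partialD q m b p))) i j k := by
  rw [partialD_coord_mul_act, map_add, map_smul, map_smul, map_act]
  simp only [partialD_coord_mul_act]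
  rw [← act23_ri_cm q.2.1 (fun i => partialD q m i p), add_assoc]
  congr 1
  rw [pow_two, ← smul_smul, ← smul_add]
  congr 1
  rw [act23_apply, act23_apply, ← Pi.smul_apply, ← act_smul, ← Pi.add_apply, ← act_add]
  rfl

/-- The partial derivatives satisfy the relations of the coordinates. -/
theorem act_pa_partialD (p : Poly q m) :
    act (pa q m) (fun y => partialD q m y.1 (partialD q m y.2 p)) = 0 := by
  induction p using poly_induction with
  | one => funext x; simp [partialD_one, act_apply]
  | coord_mul k p hp =>
    funext x
    have hm := x.1.pos
    -- The first summand dies because P_A (1 + q R̂) = 0. In the second, P_A is moved through the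
    -- braiding by `braid_pa` until it meets the derivatives of p, where the induction hypothesis
    -- applies.
    have e : (fun y : Fin m × Fin m => partialD q m y.1 (partialD q m y.2 (coord q m k * p))) =
        act (1 + ((q : ℝ) : ℂ) • rc q m) (fun y => cm q m y.2 k • partialD q m y.1 p) +
        (((q : ℝ) : ℂ) ^ 2) • fun y => act23 (ri q m) (act12 (ri q m)
        (fun c d b => coord q m c * partialD q m d (partialD q m b p))) y.1 y.2 k := by
      funext y
      rw [partialD_partialD_coord_mul, act_add_matrix, act_one, act_smul_matrix]
      rfl
    rw [e, act_add, ← act_mul, pa_mul_rc hm q.2.1 q.2.2, act_smul]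
    have h2 := congrFun (congrFun (congrFun (braid_pa q.2.1 q.2.2
      (fun c d b => coord q m c * partialD q m d (partialD q m b p))) x.1) x.2) k
    have h3 : act23 (pa q m) (fun c d b => coord q m c * partialD q m d (partialD q m b p)) = 0 := by
      funext c d b
      have := map_act (LinearMap.mulLeft ℂ (coord q m c)) (pa q m) (fun y => partialD q m y.1 (partialD q m y.2 p)) (d, b)
      rw [hp] at this
      rw [act23_apply]
      simpa using this.symm
    have h4 : act12 (ri q m) (0 : Fin m → Fin m → Fin m → Poly q m) = 0 := by
      funext a b d; exact congrFun (act_zero (V := Poly q m) (ri q m)) (a, b)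
    have h5 : act23 (ri q m) (0 : Fin m → Fin m → Fin m → Poly q m) = 0 := by
      funext d a b; exact congrFun (act_zero (V := Poly q m) (ri q m)) (a, b)
    rw [h3, h4, h5, act12_apply] at h2
    simp only [Prod.mk.eta] at h2
    rw [Pi.add_apply, Pi.smul_apply, h2]
    simp [act_apply]
  | add p r hp hr =>
    have : (fun y : Fin m × Fin m => partialD q m y.1 (partialD q m y.2 (p + r))) =
      (fun y => partialD q m y.1 (partialD q m y.2 p)) + fun y => partialD q m y.1 (partialD q m y.2 r) := by
      funext y; simp
    rw [this, act_add, hp, hr, add_zero]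
  | smul c p hp =>
    have : (fun y : Fin m × Fin m => partialD q m y.1 (partialD q m y.2 (c • p))) =
      c • fun y => partialD q m y.1 (partialD q m y.2 p) := by
      funext y; simp
    rw [this, act_smul, hp, smul_zero]

/-- Contract the previous double Leibniz rule: the inhomogeneous terms add up to μ ∂^k p, and the
closed pair of derivatives passes x^k by `contr_act23_act12`. -/
theorem laplacian_coord_mul (k : Fin m) (p : Poly q m) :
    laplacian q m (coord q m k * p) = mu q m • partialD q m k p + (((q : ℝ) : ℂ) ^ 2) • (coord q m k * laplacian q m p) := by
  rw [laplacian_eq]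
  simp only [partialD_partialD_coord_mul, contr_add, contr_smul]
  rw [contr_snd q.2.1 (fun i => partialD q m i p), contr_act_rc q.2.1, contr_snd q.2.1 (fun i => partialD q m i p),
    contr_act23_act12 q.2.1, laplacian_eq, mul_contr, mu_eq q.2.1]
  module

theorem laplacian_one : laplacian q m 1 = 0 := by
  rw [laplacian_eq]; simp [contr, partialD_one]

/-- For the product x^k p, the left side contains R̂⁻¹ acting on ∂∂p, which lies in ker P_A. Its
metric part contributes qλ C^{jk} Δp; together with the C^{jk} Δp already present this is q² C^{jk}
Δp, as on the right side. -/
theorem laplacian_partialD (j : Fin m) (p : Poly q m) :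
    laplacian q m (partialD q m j p) = partialD q m j (laplacian q m p) := by
  induction p using poly_induction generalizing j with
  | one => simp [partialD_one, laplacian_one]
  | coord_mul k p hp =>
    have e : act (ri q m) (fun y => laplacian q m (coord q m y.1 * partialD q m y.2 p)) (j, k) =
        mu q m • act (ri q m) (fun y => partialD q m y.1 (partialD q m y.2 p)) (j, k) +
        (((q : ℝ) : ℂ) ^ 2) • act (ri q m) (fun y => coord q m y.1 * partialD q m y.2 (laplacian q m p)) (j, k) := by
      simp only [laplacian_coord_mul, hp]
      rw [← Pi.smul_apply, ← act_smul, ← Pi.smul_apply, ← act_smul, ← Pi.add_apply, ← act_add]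
      rfl
    have hmu := mu_ne (m := m) q.2.1
    have hq0 := ofReal_ne q.2.1
    rw [partialD_coord_mul_act, map_add, map_smul, map_smul, map_act, e,
      act_ri_of_antisymm j.pos q.2.1 q.2.2 (act_pa_partialD q p), ← laplacian_eq,
      laplacian_coord_mul, map_add, map_smul, map_smul, partialD_coord_mul_act]
    match_scalars <;> field_simp
    ring
  | add p r hp hr => simp only [map_add, hp, hr]
  | smul c p hp => simp only [map_smul, hp]

/-- Iteration of Δ x^i = μ ∂^i + q² x^i Δ; since Δ commutes with ∂^i, the terms with a derivative
collect into the geometric sum [n+1]. -/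
theorem laplacian_pow_coord_mul (i : Fin m) (n : ℕ) (p : Poly q m) :
    (laplacian q m ^ (n + 1)) (coord q m i * p) =
      (((q : ℝ) : ℂ) ^ 2) ^ (n + 1) • (coord q m i * (laplacian q m ^ (n + 1)) p) +
      (mu q m * ∑ r ∈ range (n + 1), (((q : ℝ) : ℂ) ^ 2) ^ r) • (laplacian q m ^ n) (partialD q m i p) := by
  induction n generalizing p with
  | zero => simp [laplacian_coord_mul, add_comm]
  | succ n ih =>
    have e : ∀ r : Poly q m, (laplacian q m ^ (n + 1 + 1)) r = (laplacian q m ^ (n + 1)) (laplacian q m r) := by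
      intro r; rw [pow_succ, Module.End.mul_apply]
    have e' : ∀ r : Poly q m, (laplacian q m ^ (n + 1)) r = (laplacian q m ^ n) (laplacian q m r) := by
      intro r; rw [pow_succ, Module.End.mul_apply]
    rw [e, laplacian_coord_mul, map_add, map_smul, map_smul, ih, ← e p, ← laplacian_partialD, ← e', geom_sum_succ (n := n + 1)]
    module

/-- The mirror image of `laplacian_coord_mul`: one derivative passes a closed pair of coordinates.
-/
theorem partialD_normSq_mul (k : Fin m) (p : Poly q m) :
    partialD q m k (normSq q m * p) = mu q m • (coord q m k * p) +
      (((q : ℝ) : ℂ) ^ 2) • (normSq q m * partialD q m k p) := by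
  have e : ∀ i j, partialD q m k (coord q m i * coord q m j * p) = cm q m k i • (coord q m j * p) +
      ((q : ℝ) : ℂ) • act (rc q m) (fun y => cm q m k y.1 • (coord q m y.2 * p)) (i, j) +
      (((q : ℝ) : ℂ) ^ 2) • act12 (ri q m) (act23 (ri q m)
        (fun a c d => coord q m a * (coord q m c * partialD q m d p))) k i j := by
    intro i j
    rw [mul_assoc, partialD_coord_mul_act, ← act12_ri_cm q.2.1 (fun a => coord q m a * p), add_assoc]
    congr 1
    rw [pow_two, ← smul_smul, ← smul_add]
    congr 1
    rw [act12_apply, act12_apply, ← Pi.smul_apply, ← act_smul, ← Pi.add_apply, ← act_add]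
    congr 1
    funext y
    rw [partialD_coord_mul_act, mul_add, mul_smul_comm, mul_smul_comm, mul_act]
    rfl
  rw [normSq_mul, map_contr]
  simp only [e, contr_add, contr_smul]
  rw [contr_fst q.2.1 (fun j => coord q m j * p), contr_act_rc q.2.1, contr_fst q.2.1 (fun j => coord q m j * p),
    contr_act12_act23 q.2.1, normSq_mul, mu_eq q.2.1]
  simp only [mul_assoc]
  module

/-- The operator `x^i C_{ij} ∂^j`. -/
noncomputable def euler (m : ℕ) : Poly q m →ₗ[ℂ] Poly q m :=
  ∑ y : Fin m × Fin m, cm q m y.1 y.2 • (LinearMap.mulLeft ℂ (coord q m y.1) ∘ₗ partialD q m y.2)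

theorem euler_apply (p : Poly q m) : euler q m p = contr q m (fun y => coord q m y.1 * partialD q m y.2 p) := by
  simp [euler, contr]

/-- Sliding the contraction past x^k leaves R̂ acting on a product of two coordinates, where it is q
minus a multiple of the metric. The metric part is the term with x² ∂^k, the obstruction to x^i
C_{ij} ∂^j being a pure degree operator. -/
theorem euler_coord_mul (k : Fin m) (p : Poly q m) : euler q m (coord q m k * p) = coord q m k * p +
    (((q : ℝ) : ℂ) ^ 2) • (coord q m k * euler q m p) -
    (((q : ℝ) : ℂ) ^ 2 * ((q : ℝ) - ((q : ℝ) : ℂ)⁻¹) * kap q m / mu q m) • (normSq q m * partialD q m k p) := by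
  have e : ∀ i j, coord q m i * partialD q m j (coord q m k * p) = cm q m j k • (coord q m i * p) +
      ((q : ℝ) : ℂ) • act23 (ri q m) (fun i a b => coord q m i * coord q m a * partialD q m b p) i j k := by
    intro i j
    rw [partialD_coord_mul_act, mul_add, mul_smul_comm, mul_smul_comm, mul_act]
    simp only [← mul_assoc]
    rfl
  have e2 : ∀ t b, act12 (rc q m) (fun i a b => coord q m i * coord q m a * partialD q m b p) k t b =
      ((q : ℝ) : ℂ) • (coord q m k * (coord q m t * partialD q m b p)) -
      (((q : ℝ) : ℂ) * ((q : ℝ) - ((q : ℝ) : ℂ)⁻¹) * kap q m / mu q m) • (cm q m k t • (normSq q m * partialD q m b p)) := by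
    intro t b
    rw [act12_apply, act_rc_of_antisymm k.pos q.2.1 q.2.2 (act_pa_coord_mul q m _), normSq_mul, smul_smul]
    simp only [mul_assoc]
  rw [euler_apply, euler_apply]
  simp only [e, contr_add, contr_smul]
  rw [contr_snd q.2.1 (fun i => coord q m i * p), contr_act23_ri q.2.1]
  simp only [e2, contr_sub, contr_smul]
  rw [contr_fst q.2.1 (fun b => normSq q m * partialD q m b p), mul_contr]
  module

/-- The number `[n]` in base `q²`. -/
noncomputable def qnum (q : ℝ) (n : ℕ) : ℂ := ∑ r ∈ range n, ((q : ℂ) ^ 2) ^ r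

theorem qnum_succ (q : ℝ) (n : ℕ) : qnum q (n + 1) = (q : ℂ) ^ 2 * qnum q n + 1 := geom_sum_succ

theorem qnum_ne {q : ℝ} (hq : 0 < q) (n : ℕ) : qnum q (n + 1) ≠ 0 := by
  have : 0 < ∑ r ∈ range (n + 1), (q ^ 2) ^ r := sum_pos (fun r _ => by positivity) (by simp)
  unfold qnum; exact_mod_cast this.ne'

/-- The coefficient of `x² Δ` in the Euler operator. -/
noncomputable def gam (q : ℝ) (m : ℕ) : ℂ := - ((q : ℂ) ^ 2 * (q - (q : ℂ)⁻¹) * kap q m / mu q m ^ 2)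

/-- On homogeneous polynomials the Euler operator is the degree up to a multiple of `x² Δ`. -/
theorem euler_homog (n : ℕ) {p : Poly q m} (hp : p ∈ homog (q : ℝ) m n) :
    euler q m p = qnum q n • p + gam q m • (normSq q m * laplacian q m p) := by
  induction n generalizing p with
  | zero =>
    rw [homog, pow_zero, Submodule.mem_one] at hp
    obtain ⟨c, rfl⟩ := hp
    rw [Algebra.algebraMap_eq_smul_one, map_smul, map_smul, laplacian_one, euler_apply]
    simp [partialD_one, contr, qnum]
  | succ n ih =>
    have h := homog_induction q m n (LinearMap.ker (euler q m - (qnum q (n + 1) • LinearMap.id +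
      gam q m • (LinearMap.mulLeft ℂ (normSq (q : ℝ) m) ∘ₗ laplacian q m)))) (fun k p hp => ?_) hp
    · simpa [sub_eq_zero] using h
    · simp only [LinearMap.mem_ker, LinearMap.sub_apply, LinearMap.add_apply, LinearMap.smul_apply, LinearMap.id_apply,
        LinearMap.comp_apply, LinearMap.mulLeft_apply]
      have hmu := mu_ne (m := m) q.2.1
      -- The unwanted term x² ∂^k p is absorbed into x² Δ(x^k p), which contains μ x² ∂^k p. This
      -- requires μ γ = -q²λκ/μ and fixes γ; the rest is [n+1] = 1 + q² [n].
      rw [euler_coord_mul, ih hp, laplacian_coord_mul, qnum_succ, mul_add, mul_add, mul_smul_comm, mul_smul_comm, mul_smul_comm, mul_smul_comm,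
        ← mul_assoc _ (normSq _ _), normSq_comm, mul_assoc, mul_assoc, gam]
      match_scalars <;> field_simp <;> ring

end Derivatives

/-! ### The braided Leibniz rule and the lowering of harmonics -/

section Braiding
variable (q : Set.Ioo (0 : ℝ) 1) {m : ℕ}

/-- The coefficients `O^i_l(p)` of the commutation rule `∂^i p = ∂^i(p) + O^i_l(p) ∂^l`. -/
noncomputable def braidO (i l : Fin m) : Poly q m →ₗ[ℂ] Poly q m where
  toFun p := (leibnizHom q m p (0, Pi.single l 1)).2 i
  map_add' p r := by simp
  map_smul' c p := by simp

theorem braidO_one (i l : Fin m) : braidO q i l 1 = if i = l then 1 else 0 := by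
  simp [braidO, Pi.single_apply]

theorem braidO_coord_mul (i l j : Fin m) (p : Poly q m) : braidO q i l (coord q m j * p) =
    ((q : ℝ) : ℂ) • act (ri q m) (fun y => coord q m y.1 * braidO q y.2 l p) (i, j) := by
  change (leibnizHom q m (coord q m j * p) (0, Pi.single l 1)).2 i = _
  rw [map_mul, leibnizHom_coord, Module.End.mul_apply, leibniz_snd, leibnizHom_fst, mul_zero, smul_zero, zero_add,
    act_apply, Fintype.sum_prod_type]
  rfl

theorem sum_braidO_coord_mul (i j : Fin m) (p : Poly q m) (v : Fin m → Poly q m) :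
    ∑ l, braidO q i l (coord q m j * p) * v l =
    ((q : ℝ) : ℂ) • act (ri q m) (fun y => coord q m y.1 * ∑ l, braidO q y.2 l p * v l) (i, j) := by
  simp only [braidO_coord_mul, act_apply, smul_mul_assoc, sum_mul, mul_sum, smul_sum, mul_assoc]
  exact sum_comm

/-- The given Leibniz rule has a coordinate as left factor; iterating it over the letters of p
produces the operators O^i_l. They come from the same action `leibnizHom`, started from the gradient
e_l over the zero polynomial. -/
theorem partialD_mul (i : Fin m) (p r : Poly q m) :
    partialD q m i (p * r) = partialD q m i p * r + ∑ l, braidO q i l p * partialD q m l r := by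
  induction p using poly_induction generalizing i with
  | one => simp [braidO_one, partialD_one]
  | coord_mul j p hp =>
    rw [mul_assoc, partialD_coord_mul_act, sum_braidO_coord_mul, partialD_coord_mul_act]
    simp only [hp, mul_add]
    rw [add_mul, smul_mul_assoc, smul_mul_assoc, ← LinearMap.mulRight_apply ℂ r (act _ _ _), map_act, add_assoc, ← smul_add,
      ← Pi.add_apply, ← act_add]
    simp only [LinearMap.mulRight_apply, mul_assoc]
    rfl
  | add p s hp hs =>
    simp only [add_mul, map_add, hp, hs, sum_add_distrib]; abel
  | smul c p hp => simp only [map_smul, smul_mul_assoc, hp, smul_add, smul_sum]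

/-- The derivative in the braided Leibniz rule is replaced by a coordinate. In the induction, R̂⁻¹
on x^i x^j yields x^i x^j itself and a metric term, and the latter is exactly the inhomogeneous term
of x² ∂^i(x^j p). -/
theorem sum_braidO_coord (i : Fin m) (p : Poly q m) : ∑ l, braidO q i l p * coord q m l = coord q m i * p +
    (((q : ℝ) : ℂ) * ((q : ℝ) - ((q : ℝ) : ℂ)⁻¹) / mu q m) • (normSq q m * partialD q m i p) := by
  induction p using poly_induction generalizing i with
  | one => simp [braidO_one, partialD_one]
  | coord_mul j p hp =>
    have e : act (ri q m) (fun y => coord q m y.1 * (coord q m y.2 * p +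
        (((q : ℝ) : ℂ) * ((q : ℝ) - ((q : ℝ) : ℂ)⁻¹) / mu q m) • (normSq q m * partialD q m y.2 p))) (i, j) =
        act (ri q m) (fun y => coord q m y.1 * coord q m y.2 * p) (i, j) +
        (((q : ℝ) : ℂ) * ((q : ℝ) - ((q : ℝ) : ℂ)⁻¹) / mu q m) •
          (normSq q m * act (ri q m) (fun y => coord q m y.1 * partialD q m y.2 p) (i, j)) := by
      rw [mul_act, ← Pi.smul_apply, ← act_smul, ← Pi.add_apply, ← act_add]
      congr 1
      funext y
      simp only [Pi.add_apply, Pi.smul_apply, mul_add, mul_smul_comm, ← mul_assoc, normSq_comm]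
    have hmu := mu_ne (m := m) q.2.1
    have hq0 := ofReal_ne q.2.1
    rw [sum_braidO_coord_mul]
    simp only [hp]
    rw [e, act_ri_of_antisymm i.pos q.2.1 q.2.2 (act_pa_coord_mul q m p), ← normSq_mul, partialD_coord_mul_act, mul_add, mul_smul_comm,
      mul_smul_comm, mul_assoc]
    match_scalars <;> field_simp
  | add p s hp hs => simp only [map_add, add_mul, sum_add_distrib, hp, hs, mul_add]; module
  | smul c p hp => simp only [map_smul, smul_mul_assoc, ← smul_sum, hp, mul_smul_comm]; module

/-- The exchange rule for derivatives and the operators O. In the induction R̂⁻¹ cancels the R̂ of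
the inhomogeneous term, and the braid relation for R̂⁻¹ lets the induction hypothesis act on the
rest. -/
theorem act_ri_partialD_braidO (i j l : Fin m) (p : Poly q m) :
    act (ri q m) (fun y => partialD q m y.1 (braidO q y.2 l p)) (i, j) =
      ((q : ℝ) : ℂ) • braidO q i l (partialD q m j p) := by
  induction p using poly_induction generalizing i j with
  | one =>
    have : ∀ a b : Fin m, partialD q m a (braidO q b l 1) = 0 := by
      intro a b; rw [braidO_one]; split_ifs <;> simp [partialD_one]
    simp [this, act_apply, partialD_one]
  | coord_mul b p hp =>
    have e : (fun y : Fin m × Fin m => partialD q m y.1 (braidO q y.2 l (coord q m b * p))) =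
        ((q : ℝ) : ℂ) • act (rc q m) (fun y => cm q m y.2 b • braidO q y.1 l p) +
        (((q : ℝ) : ℂ) ^ 2) • fun y => act23 (ri q m) (act12 (ri q m)
          (fun u v t => coord q m u * partialD q m v (braidO q t l p))) y.1 y.2 b := by
      funext y
      rw [braidO_coord_mul, map_smul, map_act]
      simp only [partialD_coord_mul_act]
      rw [Pi.add_apply, Pi.smul_apply, Pi.smul_apply, ← Prod.mk.eta (p := y), ← act23_ri_cm q.2.1 (fun i => braidO q i l p),
        pow_two, ← smul_smul, ← smul_add]
      congr 1
      rw [act23_apply, act23_apply, ← Pi.smul_apply, ← act_smul, ← Pi.add_apply, ← act_add]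
      rfl
    have h2 := congrFun (congrFun (congrFun (braid_ri q.2.1
      (fun u v t => coord q m u * partialD q m v (braidO q t l p))) i) j) b
    have h3 : act23 (ri q m) (fun u v t => coord q m u * partialD q m v (braidO q t l p)) =
        fun u c d => ((q : ℝ) : ℂ) • (coord q m u * braidO q c l (partialD q m d p)) := by
      funext u c d
      rw [act23_apply, ← mul_smul_comm, ← hp, mul_act]
    have h4 : act12 (ri q m) (fun u c d => ((q : ℝ) : ℂ) • (coord q m u * braidO q c l (partialD q m d p))) =
        fun i c d => braidO q i l (coord q m c * partialD q m d p) := by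
      funext i c d
      rw [act12_apply, braidO_coord_mul, ← Pi.smul_apply, ← act_smul]
      rfl
    rw [h3, h4, act12_apply, act23_apply] at h2
    rw [e, act_add, act_smul, act_smul, ← act_mul, ri_mul_rc q.2.1, act_one, partialD_coord_mul_act, Pi.add_apply, Pi.smul_apply, Pi.smul_apply, h2,
      map_add, map_smul, map_smul, map_act]
    simp only [smul_smul]
    module
  | add p r hp hr =>
    simp only [map_add, smul_add, ← hp, ← hr]
    rw [← Pi.add_apply, ← act_add]; rfl
  | smul c p hp =>
    simp only [map_smul]
    rw [smul_comm, ← hp, ← Pi.smul_apply, ← act_smul]; rfl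

/-- The operators O^i_l preserve ker Δ; without this the induction on the degree of a harmonic could
not be repeated. -/
theorem laplacian_braidO (i l : Fin m) (p : Poly q m) :
    laplacian q m (braidO q i l p) = (((q : ℝ) : ℂ) ^ 2) • braidO q i l (laplacian q m p) := by
  induction p using poly_induction generalizing i with
  | one => rw [braidO_one]; split_ifs <;> simp [laplacian_one]
  | coord_mul j p hp =>
    have e : act (ri q m) (fun y => laplacian q m (coord q m y.1 * braidO q y.2 l p)) (i, j) =
        mu q m • act (ri q m) (fun y => partialD q m y.1 (braidO q y.2 l p)) (i, j) +
        (((q : ℝ) : ℂ) ^ 2 * ((q : ℝ) : ℂ) ^ 2) • act (ri q m) (fun y => coord q m y.1 * braidO q y.2 l (laplacian q m p)) (i, j) := by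
      simp only [laplacian_coord_mul, hp]
      rw [← Pi.smul_apply, ← act_smul, ← Pi.smul_apply, ← act_smul, ← Pi.add_apply, ← act_add]
      simp only [mul_smul_comm, smul_smul]
      rfl
    rw [braidO_coord_mul, map_smul, map_act, e, act_ri_partialD_braidO, laplacian_coord_mul, map_add, map_smul, map_smul, braidO_coord_mul]
    module
  | add p r hp hr => simp only [map_add, hp, hr, smul_add]
  | smul c p hp => simp only [map_smul, hp]; rw [smul_comm]

theorem braidO_homog (n : ℕ) (i l : Fin m) {p : Poly q m} (hp : p ∈ homog (q : ℝ) m n) : braidO q i l p ∈ homog (q : ℝ) m n := by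
  induction n generalizing i p with
  | zero =>
    rw [homog, pow_zero, Submodule.mem_one] at hp ⊢
    obtain ⟨c, rfl⟩ := hp
    refine ⟨if i = l then c else 0, ?_⟩
    rw [Algebra.algebraMap_eq_smul_one, Algebra.algebraMap_eq_smul_one, map_smul, braidO_one]
    split_ifs <;> simp
  | succ n ih =>
    refine homog_induction q m n ((homog (q : ℝ) m (n + 1)).comap (braidO q i l)) (fun j p hp => ?_) hp
    rw [Submodule.mem_comap, braidO_coord_mul]
    exact Submodule.smul_mem _ _ (Submodule.sum_mem _ fun y _ => Submodule.smul_mem _ _ (coord_mul_mem q m n _ (ih _ hp)))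

/-- The components of `S` in the decomposition `[k] S = U_l x^l` of a spherical harmonic. -/
noncomputable def lower (l : Fin m) (S : Poly q m) : Poly q m :=
  contr q m (fun y => braidO q y.1 l (partialD q m y.2 S))

theorem lower_mem (k : ℕ) (l : Fin m) {S : Poly q m} (hS : S ∈ harmonic q m (k + 1)) : lower q l S ∈ harmonic q m k := by
  obtain ⟨h1, h2⟩ := hS
  rw [SetLike.mem_coe, LinearMap.mem_ker] at h2
  refine ⟨?_, ?_⟩
  · exact Submodule.sum_mem _ fun y _ => Submodule.smul_mem _ _ (braidO_homog q k _ _ (partialD_homog q m k _ h1))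
  · rw [SetLike.mem_coe, LinearMap.mem_ker, lower, map_contr]
    simp [laplacian_braidO, laplacian_partialD, h2, contr]

/-- By `sum_braidO_coord` the sum is the Euler operator applied to S plus a multiple of x² ΔS. For
harmonic S the second term vanishes and the Euler operator is [k]. -/
theorem sum_lower_mul_coord (k : ℕ) {S : Poly q m} (hS : S ∈ harmonic q m k) :
    ∑ l, lower q l S * coord q m l = qnum q k • S := by
  obtain ⟨h1, h2⟩ := hS
  rw [SetLike.mem_coe, LinearMap.mem_ker] at h2
  have e : ∑ l, lower q l S * coord q m l =
      contr q m (fun y => ∑ l, braidO q y.1 l (partialD q m y.2 S) * coord q m l) := by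
    simp only [lower, contr, sum_mul, smul_sum, smul_mul_assoc]
    exact sum_comm
  rw [e]
  simp only [sum_braidO_coord, contr_add, contr_smul]
  rw [← euler_apply, euler_homog q k h1, h2]
  have : contr q m (fun y => normSq q m * partialD q m y.1 (partialD q m y.2 S)) = 0 := by
    rw [← mul_contr, ← laplacian_eq, h2, mul_zero]
  rw [this]; simp

end Braiding

open TensorProduct

/-! ### Existence and uniqueness of the braided exponential -/

section Tensor
variable (q : Set.Ioo (0 : ℝ) 1) {m : ℕ}

theorem evalZero_coord (q : ℝ) (m : ℕ) (i : Fin m) : evalZero q m (coord q m i) = 0 := by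
  simp [evalZero, coord]

/-- Multiplication by a polynomial in `x` from the left. -/
noncomputable def mulX {q : ℝ} {m : ℕ} (p : Poly q m) : Poly q m ⊗[ℂ] Poly q m →ₗ[ℂ] Poly q m ⊗[ℂ] Poly q m :=
  (LinearMap.mulLeft ℂ p).rTensor (Poly q m)

/-- Multiplication by a polynomial in `y` from the right. -/
noncomputable def mulY {q : ℝ} {m : ℕ} (p : Poly q m) : Poly q m ⊗[ℂ] Poly q m →ₗ[ℂ] Poly q m ⊗[ℂ] Poly q m :=
  (LinearMap.mulRight ℂ p).lTensor (Poly q m)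

/-- The partial derivative in the variables `x`. -/
noncomputable def derivX (i : Fin m) : Poly q m ⊗[ℂ] Poly q m →ₗ[ℂ] Poly q m ⊗[ℂ] Poly q m :=
  (partialD q m i).rTensor (Poly q m)

/-- The pairing of a functional with the first tensor factor. -/
noncomputable def pairX {q : ℝ} {m : ℕ} (L : Poly q m →ₗ[ℂ] ℂ) : Poly q m ⊗[ℂ] Poly q m →ₗ[ℂ] Poly q m :=
  (TensorProduct.lid ℂ (Poly q m)).toLinearMap ∘ₗ L.rTensor (Poly q m)

/-- The action of an operator on the first tensor factor, as a function of the operator. -/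
noncomputable def applyX {q : ℝ} {m : ℕ} (t : Poly q m ⊗[ℂ] Poly q m) :
    (Poly q m →ₗ[ℂ] Poly q m) →ₗ[ℂ] Poly q m ⊗[ℂ] Poly q m :=
  LinearMap.applyₗ t ∘ₗ LinearMap.rTensorHom (Poly q m)

theorem applyX_apply {q : ℝ} {m : ℕ} (t : Poly q m ⊗[ℂ] Poly q m) (f : Poly q m →ₗ[ℂ] Poly q m) :
    applyX t f = f.rTensor (Poly q m) t := rfl

/-- Multiplication from the right by a polynomial in `y`, as a function of the polynomial. -/
noncomputable def applyY {q : ℝ} {m : ℕ} (t : Poly q m ⊗[ℂ] Poly q m) :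
    Poly q m →ₗ[ℂ] Poly q m ⊗[ℂ] Poly q m :=
  LinearMap.applyₗ t ∘ₗ LinearMap.lTensorHom (Poly q m) ∘ₗ (LinearMap.mul ℂ (Poly q m)).flip

theorem applyY_apply {q : ℝ} {m : ℕ} (t : Poly q m ⊗[ℂ] Poly q m) (p : Poly q m) :
    applyY t p = mulY p t := rfl

theorem rTensor_lTensor_comm {q : ℝ} {m : ℕ} (f g : Poly q m →ₗ[ℂ] Poly q m) (t : Poly q m ⊗[ℂ] Poly q m) :
    f.rTensor (Poly q m) (g.lTensor (Poly q m) t) = g.lTensor (Poly q m) (f.rTensor (Poly q m) t) := by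
  rw [← LinearMap.comp_apply, ← LinearMap.comp_apply, LinearMap.rTensor_comp_lTensor, LinearMap.lTensor_comp_rTensor]

theorem mulX_mulY {q : ℝ} {m : ℕ} (p r : Poly q m) (t : Poly q m ⊗[ℂ] Poly q m) : mulX p (mulY r t) = mulY r (mulX p t) :=
  rTensor_lTensor_comm _ _ t

theorem derivX_mulY (i : Fin m) (r : Poly q m) (t : Poly q m ⊗[ℂ] Poly q m) : derivX q i (mulY r t) = mulY r (derivX q i t) :=
  rTensor_lTensor_comm _ _ t

theorem mulY_mulY {q : ℝ} {m : ℕ} (p r : Poly q m) (t : Poly q m ⊗[ℂ] Poly q m) : mulY r (mulY p t) = mulY (p * r) t := by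
  rw [mulY, mulY, mulY, LinearMap.mulRight_mul, LinearMap.lTensor_comp]; rfl

theorem pairX_mulY {q : ℝ} {m : ℕ} (L : Poly q m →ₗ[ℂ] ℂ) (r : Poly q m) (t : Poly q m ⊗[ℂ] Poly q m) :
    pairX L (mulY r t) = pairX L t * r := by
  induction t using TensorProduct.induction_on with
  | zero => simp
  | tmul a b => simp [pairX, mulY]
  | add a b ha hb => rw [map_add, map_add, map_add, ha, hb, add_mul]

theorem pairX_comp {q : ℝ} {m : ℕ} (L : Poly q m →ₗ[ℂ] ℂ) (f : Poly q m →ₗ[ℂ] Poly q m) (t : Poly q m ⊗[ℂ] Poly q m) :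
    pairX (L ∘ₗ f) t = pairX L (f.rTensor (Poly q m) t) := by
  rw [pairX, LinearMap.rTensor_comp]; rfl

/-- The pairing as a function of the functional. -/
noncomputable def pairHom {q : ℝ} {m : ℕ} (t : Poly q m ⊗[ℂ] Poly q m) : (Poly q m →ₗ[ℂ] ℂ) →ₗ[ℂ] Poly q m :=
  (TensorProduct.lid ℂ (Poly q m)).toLinearMap ∘ₗ LinearMap.applyₗ t ∘ₗ LinearMap.rTensorHom (Poly q m)

theorem pairHom_apply {q : ℝ} {m : ℕ} (t : Poly q m ⊗[ℂ] Poly q m) (L : Poly q m →ₗ[ℂ] ℂ) : pairHom t L = pairX L t := rfl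

theorem derivX_mulX_coord (k i : Fin m) (t : Poly q m ⊗[ℂ] Poly q m) : derivX q k (mulX (coord q m i) t) = cm q m k i • t +
    ((q : ℝ) : ℂ) • act (ri q m) (fun y => mulX (coord q m y.1) (derivX q y.2 t)) (k, i) := by
  -- The rule is stated as an equality of operators on `Poly`; the linear map f ↦ (f ⊗ 1) t then
  -- transports it to tensors.
  have h : partialD q m k ∘ₗ LinearMap.mulLeft ℂ (coord (q : ℝ) m i) = cm q m k i • LinearMap.id +
      ((q : ℝ) : ℂ) • act (ri q m) (fun y => LinearMap.mulLeft ℂ (coord (q : ℝ) m y.1) ∘ₗ partialD q m y.2) (k, i) := by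
    ext p
    have := map_act (LinearMap.applyₗ p) (ri q m) (fun y => LinearMap.mulLeft ℂ (coord (q : ℝ) m y.1) ∘ₗ partialD q m y.2) (k, i)
    simp only [LinearMap.applyₗ_apply_apply] at this
    rw [LinearMap.add_apply, LinearMap.smul_apply, LinearMap.smul_apply, this]
    exact partialD_coord_mul_act q k i p
  have h2 := congrArg (applyX t) h
  rw [map_add, map_smul, map_smul, map_act] at h2
  simp only [applyX_apply, LinearMap.rTensor_comp, LinearMap.rTensor_id, LinearMap.comp_apply, LinearMap.id_apply] at h2
  exact h2

theorem derivX_mulX_normSq (k : Fin m) (t : Poly q m ⊗[ℂ] Poly q m) : derivX q k (mulX (normSq q m) t) =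
    mu q m • mulX (coord q m k) t + (((q : ℝ) : ℂ) ^ 2) • mulX (normSq q m) (derivX q k t) := by
  have h : partialD q m k ∘ₗ LinearMap.mulLeft ℂ (normSq (q : ℝ) m) = mu q m • LinearMap.mulLeft ℂ (coord (q : ℝ) m k) +
      (((q : ℝ) : ℂ) ^ 2) • (LinearMap.mulLeft ℂ (normSq (q : ℝ) m) ∘ₗ partialD q m k) := by
    ext p
    exact partialD_normSq_mul q k p
  have h2 := congrArg (applyX t) h
  rw [map_add, map_smul, map_smul] at h2
  simp only [applyX_apply, LinearMap.rTensor_comp, LinearMap.comp_apply] at h2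
  exact h2

/-- The derivative passes x^i by the Leibniz rule, and sliding the contraction leaves R̂ acting on a
product of two coordinates y. These satisfy the same relations as the x, so R̂ is again q minus a
metric term; the latter gives the summand with μγ, since -q²λκ/μ = μγ. -/
theorem derivX_contr {t t' : Poly q m ⊗[ℂ] Poly q m} (h : ∀ b, derivX q b t = mulY (coord q m b) t') (k : Fin m) :
    derivX q k (contr q m (fun y => mulX (coord q m y.1) (mulY (coord q m y.2) t))) = mulY (coord q m k) t +
      (((q : ℝ) : ℂ) ^ 2) • mulY (coord q m k) (contr q m (fun y => mulX (coord q m y.1) (mulY (coord q m y.2) t'))) +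
      (mu q m * gam q m) • mulX (coord q m k) (mulY (normSq q m) t') := by
  have e : ∀ i j, derivX q k (mulX (coord q m i) (mulY (coord q m j) t)) = cm q m k i • mulY (coord q m j) t +
      ((q : ℝ) : ℂ) • act12 (ri q m) (fun a b j => mulX (coord q m a) (applyY t' (coord q m b * coord q m j))) k i j := by
    intro i j
    rw [derivX_mulX_coord, act12_apply]
    simp only [derivX_mulY, h, mulY_mulY, applyY_apply]
  have e2 : ∀ a s, act23 (rc q m) (fun a b j => mulX (coord q m a) (applyY t' (coord q m b * coord q m j))) a s k =
      ((q : ℝ) : ℂ) • mulY (coord q m k) (mulX (coord q m a) (mulY (coord q m s) t')) +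
      (-(((q : ℝ) : ℂ) * ((q : ℝ) - ((q : ℝ) : ℂ)⁻¹) * kap q m / mu q m)) •
        (cm q m s k • mulX (coord q m a) (mulY (normSq q m) t')) := by
    intro a s
    rw [act23_apply]
    have := map_act (mulX (coord (q : ℝ) m a) ∘ₗ applyY t') (rc q m) (fun y => coord (q : ℝ) m y.1 * coord (q : ℝ) m y.2) (s, k)
    simp only [LinearMap.comp_apply] at this
    rw [← this, act_rc_of_antisymm k.pos q.2.1 q.2.2 (act_pa_coord q m), ← normSq_eq, sub_eq_add_neg, ← neg_smul, ← neg_mul]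
    simp only [map_add, map_smul, applyY_apply, smul_smul]
    rw [mulX_mulY, ← mulY_mulY, mulX_mulY, mulX_mulY]
  rw [map_contr]
  simp only [e, contr_add, contr_smul]
  rw [contr_fst q.2.1 (fun j => mulY (coord q m j) t), contr_act12_ri q.2.1]
  simp only [e2, contr_add, contr_smul]
  rw [contr_snd q.2.1 (fun a => mulX (coord q m a) (mulY (normSq q m) t')), map_contr, gam]
  have hmu := mu_ne (m := m) q.2.1
  match_scalars <;> field_simp

/-- The homogeneous parts of the braided exponential, with a zero put in front. -/
noncomputable def expSeq (m : ℕ) : ℕ → Poly q m ⊗[ℂ] Poly q m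
  | 0 => 0
  | 1 => 1
  | n + 2 => (qnum q (n + 1))⁻¹ • (contr q m (fun y => mulX (coord q m y.1) (mulY (coord q m y.2) (expSeq m (n + 1)))) +
      (-gam q m) • mulX (normSq q m) (mulY (normSq q m) (expSeq m n)))

/-- The recursion is forced: it is the Euler formula [n+1] e = x^i C_{ij} ∂^j e - γ x² Δe with ∂^j
and Δ acting as multiplication by y^j and y². The sequence is shifted by one, `expSeq (n + 1)`
having degree n, so that the term two steps back exists at the start. -/
theorem expSeq_succ_succ (n : ℕ) : expSeq q m (n + 2) = (qnum q (n + 1))⁻¹ •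
    (contr q m (fun y => mulX (coord q m y.1) (mulY (coord q m y.2) (expSeq q m (n + 1)))) +
      (-gam q m) • mulX (normSq q m) (mulY (normSq q m) (expSeq q m n))) := by
  rw [expSeq]

theorem contr_expSeq (n : ℕ) : contr q m (fun y => mulX (coord q m y.1) (mulY (coord q m y.2) (expSeq q m (n + 1)))) =
    qnum q (n + 1) • expSeq q m (n + 2) + gam q m • mulX (normSq q m) (mulY (normSq q m) (expSeq q m n)) := by
  rw [expSeq_succ_succ, smul_inv_smul₀ (qnum_ne q.2.1 n)]; module

/-- Differentiating the recursion, the term μγ x^k e y² from `derivX_contr` cancels against the one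
from ∂^k x² = μ x^k + q² x² ∂^k. By the recursion one step earlier the remaining terms add up to 1 +
q² [n] = [n+1] times the claim. -/
theorem derivX_expSeq (k : Fin m) (n : ℕ) : derivX q k (expSeq q m (n + 1)) = mulY (coord q m k) (expSeq q m n) := by
  induction n using Nat.strong_induction_on generalizing k with
  | _ n ih =>
    match n, ih with
    | 0, _ => simp [expSeq, derivX, Algebra.TensorProduct.one_def, partialD_one]
    | n + 1, ih =>
      have h := derivX_contr q (fun b => ih n (by omega) b) k
      rw [expSeq_succ_succ, map_smul, map_add, map_smul, h, derivX_mulX_normSq, derivX_mulY]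
      match n, ih with
      | 0, _ => simp [expSeq, qnum, contr]
      | n + 1, ih =>
        rw [ih n (by omega), contr_expSeq, map_add, map_smul, map_smul, inv_smul_eq_iff₀ (qnum_ne q.2.1 _), qnum_succ _ (n + 1),
          mulY_mulY, normSq_comm, mulX_mulY, mulX_mulY, mulX_mulY, mulY_mulY]
        module

/-- The tensors of degree `a` in `x` and `b` in `y`. -/
noncomputable def bihomog (q : ℝ) (m a b : ℕ) : Submodule ℂ (Poly q m ⊗[ℂ] Poly q m) :=
  LinearMap.range (TensorProduct.map (homog q m a).subtype (homog q m b).subtype)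

theorem tmul_mem_bihomog {q : ℝ} {m a b : ℕ} {p r : Poly q m} (hp : p ∈ homog q m a) (hr : r ∈ homog q m b) :
    p ⊗ₜ r ∈ bihomog q m a b := ⟨⟨p, hp⟩ ⊗ₜ ⟨r, hr⟩, rfl⟩

theorem bihomog_le {q : ℝ} {m a b : ℕ} {W : Submodule ℂ (Poly q m ⊗[ℂ] Poly q m)}
    (h : ∀ p ∈ homog q m a, ∀ r ∈ homog q m b, p ⊗ₜ r ∈ W) : bihomog q m a b ≤ W := by
  rintro _ ⟨t, rfl⟩
  induction t using TensorProduct.induction_on with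
  | zero => simp
  | tmul p r => exact h p p.2 r r.2
  | add s t hs ht => rw [map_add]; exact W.add_mem hs ht

theorem mulX_mem {q : ℝ} {m a b c : ℕ} {s : Poly q m} (h : ∀ p ∈ homog q m a, s * p ∈ homog q m c) {t : Poly q m ⊗[ℂ] Poly q m}
    (ht : t ∈ bihomog q m a b) : mulX s t ∈ bihomog q m c b :=
  bihomog_le (W := (bihomog q m c b).comap (mulX s)) (fun p hp _ hr => tmul_mem_bihomog (h p hp) hr) ht

theorem mulY_mem {q : ℝ} {m a b c : ℕ} {s : Poly q m} (h : ∀ p ∈ homog q m b, p * s ∈ homog q m c) {t : Poly q m ⊗[ℂ] Poly q m}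
    (ht : t ∈ bihomog q m a b) : mulY s t ∈ bihomog q m a c :=
  bihomog_le (W := (bihomog q m a c).comap (mulY s)) (fun _ hp r hr => tmul_mem_bihomog hp (h r hr)) ht

theorem mul_mem_homog {q : ℝ} {m a b : ℕ} {p r : Poly q m} (hp : p ∈ homog q m a) (hr : r ∈ homog q m b) :
    p * r ∈ homog q m (a + b) := by
  rw [homog, pow_add]; exact Submodule.mul_mem_mul hp hr

theorem coord_mem {q : ℝ} {m : ℕ} (i : Fin m) : coord q m i ∈ homog q m 1 := by
  rw [homog, pow_one]; exact Submodule.subset_span ⟨i, rfl⟩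

theorem one_mem_homog {q : ℝ} {m : ℕ} : (1 : Poly q m) ∈ homog q m 0 := by
  rw [homog, pow_zero]; exact Submodule.one_le.1 le_rfl

theorem normSq_mem {q : ℝ} {m : ℕ} : normSq q m ∈ homog q m 2 :=
  Submodule.sum_mem _ fun _ _ => Submodule.sum_mem _ fun _ _ =>
    Submodule.smul_mem _ _ (mul_mem_homog (coord_mem _) (coord_mem _))

theorem expSeq_mem (n : ℕ) : expSeq q m (n + 1) ∈ bihomog (q : ℝ) m n n := by
  have hX : ∀ {c d a b : ℕ} {s r : Poly q m}, s ∈ homog (q : ℝ) m c → r ∈ homog (q : ℝ) m c → c + a = d → a + c = d →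
      ∀ {t}, t ∈ bihomog (q : ℝ) m a a → mulX s (mulY r t) ∈ bihomog (q : ℝ) m d d := by
    intro c d a b s r hs hr h1 h2 t ht
    refine mulX_mem (fun p hp => h1 ▸ mul_mem_homog hs hp) (mulY_mem (fun p hp => h2 ▸ mul_mem_homog hp hr) ht)
  induction n using Nat.strong_induction_on with
  | _ n ih =>
    match n, ih with
    | 0, _ => exact tmul_mem_bihomog one_mem_homog one_mem_homog
    | n + 1, ih =>
      rw [expSeq_succ_succ]
      refine Submodule.smul_mem _ _ (Submodule.add_mem _ (Submodule.sum_mem _ fun y _ => Submodule.smul_mem _ _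
        (hX (b := 0) (coord_mem _) (coord_mem _) (by omega) rfl (ih n (by omega)))) (Submodule.smul_mem _ _ ?_))
      match n, ih with
      | 0, _ => simp [expSeq]
      | n + 1, ih => exact hX (b := 0) normSq_mem normSq_mem (by omega) rfl (ih n (by omega))

/-- The Euler formula in the variables x alone, solved for t: its right side depends on t only
through the derivatives of t. -/
theorem euler_bihomog (n b : ℕ) {t : Poly q m ⊗[ℂ] Poly q m} (ht : t ∈ bihomog (q : ℝ) m n b) :
    qnum q n • t = contr q m (fun y => mulX (coord q m y.1) (derivX q y.2 t)) +
      (-gam q m) • mulX (normSq q m) (contr q m (fun y => derivX q y.1 (derivX q y.2 t))) := by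
  have h : bihomog (q : ℝ) m n b ≤ LinearMap.eqLocus (qnum q n • LinearMap.id) ((euler q m).rTensor (Poly q m) +
      (-gam q m) • ((LinearMap.mulLeft ℂ (normSq (q : ℝ) m) ∘ₗ laplacian q m).rTensor (Poly q m))) := by
    refine bihomog_le fun p hp r _ => ?_
    rw [LinearMap.mem_eqLocus, LinearMap.add_apply, LinearMap.smul_apply, LinearMap.smul_apply, LinearMap.rTensor_tmul, LinearMap.rTensor_tmul,
      euler_homog q n hp, LinearMap.id_apply, LinearMap.comp_apply, LinearMap.mulLeft_apply, add_tmul, ← smul_tmul', ← smul_tmul']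
    module
  have h2 := h ht
  rw [LinearMap.mem_eqLocus, LinearMap.add_apply, LinearMap.smul_apply, LinearMap.smul_apply, LinearMap.id_apply,
    LinearMap.rTensor_comp, LinearMap.comp_apply] at h2
  have e1 : euler q m = contr q m (fun y => LinearMap.mulLeft ℂ (coord (q : ℝ) m y.1) ∘ₗ partialD q m y.2) := rfl
  have e2 : laplacian q m = contr q m (fun y => partialD q m y.1 ∘ₗ partialD q m y.2) := by
    rw [contr_apply]; rfl
  rw [← applyX_apply, ← applyX_apply t (laplacian q m), e1, e2, map_contr, map_contr] at h2
  simp only [applyX_apply, LinearMap.rTensor_comp, LinearMap.comp_apply] at h2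
  exact h2

/-- In positive degree there are no constants of integration, because [n+1] ≠ 0. -/
theorem eq_of_derivX (n b : ℕ) {t t' : Poly q m ⊗[ℂ] Poly q m} (ht : t ∈ bihomog (q : ℝ) m (n + 1) b)
    (ht' : t' ∈ bihomog (q : ℝ) m (n + 1) b) (h : ∀ k, derivX q k t = derivX q k t') : t = t' := by
  have := euler_bihomog q (n + 1) b ht
  simp only [h] at this
  rw [← euler_bihomog q (n + 1) b ht'] at this
  exact smul_right_injective _ (qnum_ne q.2.1 n) this

/-- The braided exponential. -/
noncomputable def bexp (m a b : ℕ) : Poly q m ⊗[ℂ] Poly q m := if a = b then expSeq q m (a + 1) else 0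

theorem isBraidedExp_bexp : IsBraidedExp q m (bexp q m) where
  mem a b := by
    unfold bexp
    split_ifs with h
    · subst h; exact expSeq_mem q a
    · exact Submodule.zero_mem _
  deriv_zero j a := by simp [bexp]
  deriv_succ j a b := by
    unfold bexp
    by_cases h : a = b
    · subst h; simp only [if_true]; exact derivX_expSeq q j (a + 1)
    · simp [h]
  eval b := by
    unfold bexp
    by_cases h : b = 0
    · subst h; simp [expSeq]
    · simp [h, Ne.symm h]

/-- Induction on the degree in x: the value at x = 0 is prescribed, and the derivatives of each
further part are determined by the part before it. -/
theorem IsBraidedExp.unique {E E' : ℕ → ℕ → Poly q m ⊗[ℂ] Poly q m} (h : IsBraidedExp q m E) (h' : IsBraidedExp q m E') : E = E' := by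
  funext a
  induction a with
  | zero => funext b; rw [h.eval, h'.eval]
  | succ a ih =>
    funext b
    refine eq_of_derivX q a b (h.mem _ _) (h'.mem _ _) fun k => ?_
    cases b with
    | zero => exact (h.deriv_zero k a).trans (h'.deriv_zero k a).symm
    | succ b => exact (h.deriv_succ k a b).trans (by rw [ih]; exact (h'.deriv_succ k a b).symm)

end Tensor

/-! ### The integral of a harmonic against the exponential -/

section Pairing
variable (q : Set.Ioo (0 : ℝ) 1) {m : ℕ}

theorem evalZero_homog {q : ℝ} {m n : ℕ} {p : Poly q m} (hp : p ∈ homog q m (n + 1)) : evalZero q m p = 0 :=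
  homog_induction q m n (LinearMap.ker (evalZero q m).toLinearMap)
    (fun j p _ => by simp [evalZero_coord]) hp

/-- The functional `p ↦ (Δ^j p)(0)`. -/
noncomputable def lapEval (m j : ℕ) : Poly q m →ₗ[ℂ] ℂ := (evalZero (q : ℝ) m).toLinearMap ∘ₗ (laplacian q m ^ j)

theorem lapEval_apply (j : ℕ) (p : Poly q m) : lapEval q m j p = evalZero (q : ℝ) m ((laplacian q m ^ j) p) := rfl

theorem lapEval_succ (j : ℕ) : lapEval q m (j + 1) = lapEval q m j ∘ₗ laplacian q m := by
  rw [lapEval, pow_succ]; rfl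

/-- An integration by parts: in the commutation of Δ^(j+1) with x^i, the term that keeps x^i in
front vanishes at the origin. -/
theorem lapEval_coord_mul (j : ℕ) (i : Fin m) (p : Poly q m) :
    lapEval q m (j + 1) (coord q m i * p) = mu q m * qnum q (j + 1) * lapEval q m j (partialD q m i p) := by
  rw [lapEval_apply, laplacian_pow_coord_mul, map_add, map_smul, map_smul, map_mul, evalZero_coord, zero_mul, smul_zero, zero_add]
  rfl

theorem pairX_evalZero_mulX (p : Poly q m) (t : Poly q m ⊗[ℂ] Poly q m) :
    pairX (evalZero (q : ℝ) m).toLinearMap (mulX p t) = evalZero (q : ℝ) m p • pairX (evalZero (q : ℝ) m).toLinearMap t := by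
  induction t using TensorProduct.induction_on with
  | zero => simp
  | tmul a b => simp [pairX, mulX, mul_smul]
  | add a b ha hb => rw [map_add, map_add, map_add, ha, hb, smul_add]

theorem pairX_evalZero_expSeq (n : ℕ) :
    pairX (evalZero (q : ℝ) m).toLinearMap (expSeq q m n) = if n = 1 then 1 else 0 := by
  match n with
  | 0 => simp [expSeq]
  | 1 => simp [expSeq, pairX, Algebra.TensorProduct.one_def]
  | n + 2 =>
    rw [expSeq_succ_succ, map_smul, map_add, map_smul, map_contr]
    simp only [pairX_evalZero_mulX, evalZero_coord, evalZero_homog (n := 1) normSq_mem, zero_smul]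
    simp [contr]

theorem laplacian_rTensor (t : Poly q m ⊗[ℂ] Poly q m) :
    (laplacian q m).rTensor (Poly q m) t = contr q m (fun y => derivX q y.1 (derivX q y.2 t)) := by
  have e : laplacian q m = contr q m (fun y => partialD q m y.1 ∘ₗ partialD q m y.2) := by
    rw [contr_apply]; rfl
  rw [← applyX_apply, e, map_contr]
  simp only [applyX_apply, LinearMap.rTensor_comp, LinearMap.comp_apply]
  rfl

/-- Two derivatives multiply by y^i y^j from the right, and the contraction of these is y². -/
theorem laplacian_expSeq (n : ℕ) :
    (laplacian q m).rTensor (Poly q m) (expSeq q m (n + 2)) = mulY (normSq q m) (expSeq q m n) := by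
  rw [laplacian_rTensor]
  simp only [derivX_expSeq, derivX_mulY, mulY_mulY]
  rw [normSq_eq, ← applyY_apply, map_contr]
  rfl

theorem laplacian_expSeq_one : (laplacian q m).rTensor (Poly q m) (expSeq q m 1) = 0 := by
  have h : ∀ k, derivX q k (expSeq q m 1) = 0 := fun k => (derivX_expSeq q k 0).trans (by simp [expSeq])
  rw [laplacian_rTensor]
  simp [h, contr]

theorem pairX_lapEval_expSeq (j n : ℕ) :
    pairX (lapEval q m j) (expSeq q m n) = if n = 2 * j + 1 then normSq q m ^ j else 0 := by
  induction j generalizing n with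
  | zero =>
    rw [lapEval, pow_zero, Module.End.one_eq_id, LinearMap.comp_id, pow_zero]
    exact pairX_evalZero_expSeq q n
  | succ j ih =>
    rw [lapEval_succ, pairX_comp]
    match n with
    | 0 => simp [expSeq]
    | 1 => rw [laplacian_expSeq_one, map_zero, if_neg (by omega)]
    | n + 2 =>
      rw [laplacian_expSeq, pairX_mulY, ih]
      by_cases h : n = 2 * j + 1
      · rw [if_pos h, if_pos (by omega), pow_succ]
      · rw [if_neg h, if_neg (by omega), zero_mul]

/-- The pairing of `p ↦ (Δ^j (S p))(0)` with a homogeneous part of the exponential, as a function of `S`. -/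
noncomputable def lapPair (m j n : ℕ) : Poly q m →ₗ[ℂ] Poly q m :=
  pairHom (expSeq q m n) ∘ₗ (LinearMap.mul ℂ (Poly q m)).compr₂ (lapEval q m j)

theorem lapPair_apply (j n : ℕ) (S : Poly q m) :
    lapPair q m j n S = pairX (lapEval q m j ∘ₗ LinearMap.mulLeft ℂ S) (expSeq q m n) := rfl

/-- The leading x^i becomes a derivative of p times the exponential, split by the braided Leibniz
rule. Where the derivative falls on the exponential it produces y^l and lowers the degree by one. -/
theorem lapPair_coord_mul (j n : ℕ) (i : Fin m) (p : Poly q m) : lapPair q m (j + 1) (n + 1) (coord q m i * p) =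
    (mu q m * qnum q (j + 1)) • (lapPair q m j (n + 1) (partialD q m i p) +
      ∑ l, lapPair q m j n (braidO q i l p) * coord q m l) := by
  have e : lapEval q m (j + 1) ∘ₗ LinearMap.mulLeft ℂ (coord (q : ℝ) m i * p) = (mu q m * qnum q (j + 1)) •
      (lapEval q m j ∘ₗ LinearMap.mulLeft ℂ (partialD q m i p) +
        ∑ l, (lapEval q m j ∘ₗ LinearMap.mulLeft ℂ (braidO q i l p)) ∘ₗ partialD q m l) := by
    ext r
    simp only [LinearMap.comp_apply, LinearMap.smul_apply, LinearMap.add_apply, LinearMap.sum_apply, LinearMap.mulLeft_apply,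
      mul_assoc (coord _ _ _), lapEval_coord_mul, partialD_mul, map_add, map_sum, smul_eq_mul]
  rw [lapPair_apply, e, ← pairHom_apply, map_smul, map_add, map_sum]
  congr 2
  refine sum_congr rfl fun l _ => ?_
  rw [pairHom_apply, pairX_comp]
  have := derivX_expSeq q l n
  rw [derivX] at this
  rw [this, pairX_mulY, lapPair_apply]

/-- The core computation, by induction on k through [k] S = x^i C_{ij} ∂^j S. Because of the shift
in `expSeq`, the condition n + k = 2j + 1 says that the product of S and the part of degree n - 1
has degree 2j. -/
theorem lapPair_harmonic (k j n : ℕ) {S : Poly q m} (hS : S ∈ harmonic q m k) : lapPair q m j n S =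
    if k ≤ j ∧ n + k = 2 * j + 1 then
      (mu q m ^ k * ∏ i ∈ range k, qnum q (j - i)) • (normSq q m ^ (j - k) * S) else 0 := by
  induction k generalizing j n S with
  | zero =>
    have h := hS.1
    rw [SetLike.mem_coe, homog, pow_zero, Submodule.mem_one] at h
    obtain ⟨c, rfl⟩ := h
    have e : lapPair q m j n 1 = pairX (lapEval q m j) (expSeq q m n) := by
      rw [lapPair_apply, LinearMap.mulLeft_one]; rfl
    rw [Algebra.algebraMap_eq_smul_one, map_smul, e, pairX_lapEval_expSeq]
    by_cases h : n = 2 * j + 1 <;> simp [h]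
  | succ k ih =>
    match j, n with
    | 0, n =>
      -- With no Laplacian left, a factor of positive degree vanishes at the origin.
      have : lapEval q m 0 ∘ₗ LinearMap.mulLeft ℂ S = 0 := by
        ext r
        simp [lapEval, evalZero_homog hS.1]
      rw [if_neg (by omega), lapPair_apply, this, ← pairHom_apply, map_zero]
    | j + 1, 0 =>
      rw [lapPair_apply, expSeq, map_zero]
      split_ifs with h
      · omega
      · rfl
    | j + 1, n + 1 =>
      have h2 : laplacian q m S = 0 := hS.2
      have h1 := euler_homog q (k + 1) hS.1
      rw [h2, mul_zero, smul_zero, add_zero, euler_apply] at h1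
      have h3 := congrArg (lapPair q m (j + 1) (n + 1)) h1
      rw [map_contr, map_smul] at h3
      simp only [lapPair_coord_mul, contr_smul, contr_add] at h3
      -- The terms in which the derivative falls on ∂^j S contract to ΔS = 0. Only the components
      -- `lower q l S` survive, to which the induction hypothesis applies.
      rw [← map_contr (lapPair q m j (n + 1)) (fun y => partialD q m y.1 (partialD q m y.2 S)), ← laplacian_eq, h2, map_zero, zero_add] at h3
      have e : contr q m (fun y => ∑ l, lapPair q m j n (braidO q y.1 l (partialD q m y.2 S)) * coord q m l) =
          ∑ l, lapPair q m j n (lower q l S) * coord q m l := by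
        simp only [lower, contr, map_sum, map_smul, smul_sum, sum_mul, smul_mul_assoc]
        exact sum_comm
      rw [e] at h3
      simp only [ih _ _ (lower_mem q k _ hS)] at h3
      -- The claim is proved after multiplication by [k+1]: this factor comes from the Euler formula
      -- on one side and from reassembling S(y) by `sum_lower_mul_coord` on the other.
      refine smul_right_injective _ (qnum_ne q.2.1 k) ?_
      refine h3.symm.trans ?_
      by_cases h : k ≤ j ∧ n + k = 2 * j + 1
      · have hs := sum_lower_mul_coord q (k + 1) hS
        have e2 : ∏ i ∈ range (k + 1), qnum q (j + 1 - i) = qnum q (j + 1) * ∏ i ∈ range k, qnum q (j - i) := by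
          rw [prod_range_succ', mul_comm]
          congr 1
          exact prod_congr rfl fun i _ => by congr 1; omega
        simp only [if_pos h]
        rw [if_pos (by omega), e2, show j + 1 - (k + 1) = j - k by omega]
        simp only [smul_mul_assoc, ← smul_sum, mul_assoc (normSq _ _ ^ _), ← mul_sum, hs, mul_smul_comm, smul_smul]
        congr 1
        ring
      · simp only [if_neg h]
        rw [if_neg (by omega)]
        simp

theorem laplacian_pow_mem (n N : ℕ) {p : Poly q m} (hp : p ∈ homog (q : ℝ) m N) :
    (laplacian q m ^ n) p = 0 ∨ ∃ N', N' + 2 * n = N ∧ (laplacian q m ^ n) p ∈ homog (q : ℝ) m N' := by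
  induction n with
  | zero => exact Or.inr ⟨N, rfl, hp⟩
  | succ n ih =>
    rw [pow_succ', Module.End.mul_apply]
    rcases ih with h | ⟨N', h1, h2⟩
    · left; rw [h, map_zero]
    · rcases laplacian_homog q m N' h2 with h | ⟨N'', h3, h4⟩
      · exact Or.inl h
      · exact Or.inr ⟨N'', by omega, h4⟩

theorem lapEval_homog (j N : ℕ) {p : Poly q m} (hp : p ∈ homog (q : ℝ) m N) (h : N ≠ 2 * j) : lapEval q m j p = 0 := by
  rw [lapEval_apply]
  rcases laplacian_pow_mem q j N hp with h0 | ⟨N', h1, h2⟩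
  · rw [h0, map_zero]
  · obtain ⟨n, rfl⟩ : ∃ n, N' = n + 1 := ⟨N' - 1, by omega⟩
    exact evalZero_homog h2

theorem sphereIntegral_homog (N : ℕ) {p : Poly q m} (hp : p ∈ homog (q : ℝ) m N) :
    sphereIntegral q m p = if Even N then ((pizzetti q m (N / 2) : ℝ) : ℂ) * lapEval q m (N / 2) p else 0 := by
  change (∑ᶠ k : ℕ, ((pizzetti q m k : ℝ) : ℂ) * lapEval q m k p) = _
  rw [finsum_eq_single _ (N / 2)]
  · split_ifs with h
    · rfl
    · rw [lapEval_homog q _ N hp, mul_zero]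
      intro h2; exact h (h2 ▸ even_two_mul _)
  · intro j hj
    rw [lapEval_homog q _ N hp, mul_zero]
    omega

/-- On degree N only Δ^(N/2) can reach a nonzero constant, so the integral reduces to one term, and
to none for odd N. -/
theorem pairX_sphereIntegral (N b : ℕ) {t : Poly q m ⊗[ℂ] Poly q m} (ht : t ∈ bihomog (q : ℝ) m N b) :
    pairX (sphereIntegral q m) t =
      if Even N then ((pizzetti q m (N / 2) : ℝ) : ℂ) • pairX (lapEval q m (N / 2)) t else 0 := by
  refine bihomog_le (W := LinearMap.eqLocus (pairX (sphereIntegral q m))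
    (if Even N then ((pizzetti q m (N / 2) : ℝ) : ℂ) • pairX (lapEval q m (N / 2)) else 0)) (fun p hp r _ => ?_) ht |>.trans ?_
  · rw [LinearMap.mem_eqLocus]
    split_ifs with h <;> simp [pairX, sphereIntegral_homog q N hp, h, mul_smul]
  · split_ifs <;> rfl

/-- The exponential has equal degrees in x and y, so the part of degree b in y comes from a = b
alone, and the integrand has degree k + b in x. -/
theorem sphereIntegralExp_bexp (k b : ℕ) {S : Poly q m} (hS : S ∈ harmonic q m k) :
    sphereIntegralExp q m (bexp q m) S b = if Even (k + b) ∧ k ≤ b then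
      (Complex.I ^ b * (((pizzetti q m ((k + b) / 2) : ℝ) : ℂ) * (mu q m ^ k * ∏ i ∈ range k, qnum q ((k + b) / 2 - i)))) •
        (normSq q m ^ ((b - k) / 2) * S) else 0 := by
  have e : ∀ a, TensorProduct.lid ℂ (Poly q m) ((sphereIntegral q m).rTensor (Poly q m)
    ((LinearMap.mulLeft ℂ S).rTensor (Poly q m) (Complex.I ^ a • bexp q m a b))) =
    Complex.I ^ a • pairX (sphereIntegral q m) (mulX S (bexp q m a b)) := by
    intro a; rw [map_smul, map_smul, map_smul]; rfl
  rw [sphereIntegralExp, finsum_eq_single _ b]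
  · rw [e, bexp, if_pos rfl, pairX_sphereIntegral q (k + b) b (mulX_mem (fun p hp => mul_mem_homog hS.1 hp) (expSeq_mem q b)),
      mulX, ← pairX_comp, ← lapPair_apply, lapPair_harmonic q k _ _ hS]
    by_cases h : Even (k + b)
    · obtain ⟨r, hr⟩ := h
      have h2 : Even (k + b) := ⟨r, hr⟩
      by_cases h3 : k ≤ b
      · rw [if_pos h2, if_pos (by omega), if_pos ⟨h2, h3⟩, smul_smul, smul_smul, mul_assoc, show (k + b) / 2 - k = (b - k) / 2 by omega]
      · rw [if_pos h2, if_neg (by omega), if_neg (by tauto)]; simp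
    · rw [if_neg h, if_neg (by tauto), smul_zero]
  · intro a ha
    rw [e, bexp, if_neg ha, map_zero, map_zero, smul_zero]

end Pairing

/-! ### q-factorials and convergence of the q-Bessel series -/

section Bessel

theorem qFactorial_succ (p : ℝ) (n : ℕ) : qFactorial p (n + 1) = qFactorial p n * ((p ^ (n + 1) - 1) / (p - 1)) :=
  prod_range_succ _ _

/-- The factors collected in `lapPair_harmonic` turn the [k+r]! in the denominator of the integral
into the [r]! of the Bessel series. -/
theorem prod_qnum (q : Set.Ioo (0 : ℝ) 1) (k r : ℕ) :
    (∏ i ∈ range k, qnum q (k + r - i)) * ((qFactorial ((q : ℝ) ^ 2) r : ℝ) : ℂ) = ((qFactorial ((q : ℝ) ^ 2) (k + r) : ℝ) : ℂ) := by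
  have hq : (q : ℝ) ^ 2 ≠ 1 := (pow_lt_one₀ q.2.1.le q.2.2 two_ne_zero).ne
  have e : ∀ n, qnum q n = ((((q : ℝ) ^ 2) ^ n - 1) / ((q : ℝ) ^ 2 - 1) : ℝ) := by
    intro n
    rw [← geom_sum_eq hq, qnum]; push_cast; rfl
  induction k with
  | zero => simp
  | succ k ih =>
    rw [prod_range_succ', show k + 1 + r = (k + r) + 1 by omega, qFactorial_succ, Complex.ofReal_mul, ← ih, tsub_zero, e]
    have : ∀ i, k + r + 1 - (i + 1) = k + r - i := fun i => by omega
    simp only [this]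
    ring

theorem qFactorial_ne {p : ℝ} (hp : 0 < p) (hp1 : p < 1) (n : ℕ) : qFactorial p n ≠ 0 := by
  refine prod_ne_zero_iff.2 fun i _ => div_ne_zero ?_ (by linarith)
  have := pow_lt_one₀ hp.le hp1 (Nat.succ_ne_zero i)
  simp only [Nat.succ_eq_add_one] at this
  linarith

theorem tprod_one_sub_mem {p s : ℝ} (hp : 0 < p) (hp1 : p < 1) (hs : 0 < s) :
    0 ≤ ∏' n : ℕ, (1 - p ^ (s + n)) ∧ ∏' n : ℕ, (1 - p ^ (s + n)) ≤ 1 := by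
  have h0 : ∀ n : ℕ, 0 ≤ 1 - p ^ (s + n) := fun n => sub_nonneg.2 (Real.rpow_le_one hp.le hp1.le (by positivity))
  have h1 : ∀ n : ℕ, 1 - p ^ (s + n) ≤ 1 := fun n => sub_le_self _ (Real.rpow_nonneg hp.le _)
  by_cases h : Multipliable fun n : ℕ => 1 - p ^ (s + n)
  · have := h.hasProd.tendsto_prod_nat
    exact ⟨ge_of_tendsto' this fun n => prod_nonneg fun i _ => h0 i, le_of_tendsto' this fun n => prod_le_one (fun i _ => h0 i) fun i _ => h1 i⟩
  -- The default value 1 also obeys the bounds, so multipliability need not be established.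
  · rw [tprod_eq_one_of_not_multipliable h]; simp

/-- The series of the first q-Bessel function converges. -/
theorem summable_qBessel {p ν r : ℝ} (hp : 0 < p) (hp1 : p < 1) (hν : -1 < ν) (hr : 0 < r) (hr1 : (1 - p) * r < 1) :
    Summable fun i : ℕ => (-1) ^ i / (qFactorial p i * qGamma p (i + ν + 1)) * r ^ (2 * i) := by
  set P := ∏' n : ℕ, (1 - p ^ (n + 1)) with hP
  have hp1' : 0 < 1 - p := by linarith
  have hpos : ∀ j : ℕ, 0 < 1 - p ^ (j + 1) := fun j => sub_pos.2 (pow_lt_one₀ hp.le hp1 (Nat.succ_ne_zero j))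
  -- The majorant: one power (1 - p)^i comes from [i]! and another from the last factor of Γ_p,
  -- while the product in the denominator of Γ_p is bounded by 1. The ratio of consecutive terms
  -- tends to ((1 - p) r)² < 1.
  set B : ℕ → ℝ := fun i => (((1 - p) * r) ^ 2) ^ i / ∏ j ∈ range i, (1 - p ^ (j + 1)) with hB
  have hBpos : ∀ i, 0 < B i := fun i => div_pos (by positivity) (prod_pos fun j _ => hpos j)
  have hsum : Summable B := by
    refine summable_of_ratio_test_tendsto_lt_one (l := ((1 - p) * r) ^ 2) (pow_lt_one₀ (by positivity) hr1 two_ne_zero)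
      (Filter.Eventually.of_forall fun i => (hBpos i).ne') ?_
    have e : ∀ i, ‖B (i + 1)‖ / ‖B i‖ = ((1 - p) * r) ^ 2 / (1 - p ^ (i + 1)) := by
      intro i
      rw [Real.norm_of_nonneg (hBpos _).le, Real.norm_of_nonneg (hBpos _).le]
      simp only [hB, prod_range_succ]
      have h1 := (hpos i).ne'
      have h2 : ∏ j ∈ range i, (1 - p ^ (j + 1)) ≠ 0 := (prod_pos fun j _ => hpos j).ne'
      have h3 : (1 - p) * r ≠ 0 := by positivity
      rw [pow_succ _ i]
      field_simp
    simp only [e]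
    have : Filter.Tendsto (fun i : ℕ => p ^ (i + 1)) Filter.atTop (nhds 0) :=
      (tendsto_pow_atTop_nhds_zero_of_lt_one hp.le hp1).comp (Filter.tendsto_add_atTop_nat 1)
    have h2 := (tendsto_const_nhds (x := ((1 - p) * r) ^ 2)).div (tendsto_const_nhds.sub this) (by simp : (1 : ℝ) - 0 ≠ 0)
    rw [sub_zero, div_one] at h2
    exact h2
  refine Summable.of_norm_bounded (hsum.mul_left (|P|⁻¹ * (1 - p) ^ ν)) fun i => ?_
  have hF : qFactorial p i = (∏ j ∈ range i, (1 - p ^ (j + 1))) / (1 - p) ^ i := by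
    rw [qFactorial, prod_div_distrib, prod_const, card_range, ← neg_sub 1 p, neg_pow, ← prod_congr rfl fun j _ => neg_sub 1 (p ^ (j + 1)),
      prod_neg, card_range]
    field_simp
  obtain ⟨t0, t1⟩ := tprod_one_sub_mem hp hp1 (s := i + ν + 1) (by have : (0 : ℝ) ≤ i := Nat.cast_nonneg i; linarith)
  have hrp : (1 - p) ^ (1 - ((i : ℝ) + ν + 1)) = ((1 - p) ^ i * (1 - p) ^ ν)⁻¹ := by
    rw [show 1 - ((i : ℝ) + ν + 1) = -(i + ν) by ring, Real.rpow_neg hp1'.le, Real.rpow_add hp1', Real.rpow_natCast]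
  rw [qGamma, hrp, hF, ← hP]
  set T := ∏' n : ℕ, (1 - p ^ ((i : ℝ) + ν + 1 + n))
  have hQ : 0 < ∏ j ∈ range i, (1 - p ^ (j + 1)) := prod_pos fun j _ => hpos j
  simp only [hB]
  set Q := ∏ j ∈ range i, (1 - p ^ (j + 1))
  have hpν : 0 < (1 - p) ^ ν := Real.rpow_pos_of_pos hp1' ν
  -- The constant P occurs only through its inverse, so it does not have to be shown nonzero.
  have e : ‖(-1) ^ i / (Q / (1 - p) ^ i * (P / T * ((1 - p) ^ i * (1 - p) ^ ν)⁻¹)) * r ^ (2 * i)‖ =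
      T * (|P|⁻¹ * (1 - p) ^ ν * ((((1 - p) * r) ^ 2) ^ i / Q)) := by
    simp only [norm_mul, norm_div, norm_pow, norm_neg, norm_one, one_pow, norm_inv, Real.norm_eq_abs, abs_of_pos hr, abs_of_pos hp1', abs_of_pos hQ,
      abs_of_nonneg t0, abs_of_pos hpν]
    simp only [div_eq_mul_inv, mul_inv, inv_inv, mul_pow, ← pow_mul, one_mul]
    rw [two_mul, pow_add (1 - p)]
    ring
  rw [e]
  exact mul_le_of_le_one_left (by positivity) t1

/-- The Taylor coefficients of `J_ν((1 + q) t / μ | q²) / t ^ ν` in the variable `t²`. -/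
noncomputable def besselCoeff (q : ℝ) (m : ℕ) (ν : ℝ) (n : ℕ) : ℝ :=
  (muc q m ^ ν)⁻¹ * ((-1) ^ n / (qFactorial (q ^ 2) n * qGamma (q ^ 2) (n + ν + 1)) * (muc q m)⁻¹ ^ (2 * n))

theorem hasSum_besselCoeff (q : Set.Ioo (0 : ℝ) 1) (m : ℕ) {ν t : ℝ} (hν : -1 < ν) (ht : 0 < t)
    (h : (1 + (q : ℝ)) / muc q m * t < 1 / (1 - (q : ℝ))) :
    HasSum (fun n : ℕ => besselCoeff q m ν n * t ^ (2 * n)) (qBessel q ν ((1 + (q : ℝ)) / muc q m * t) / t ^ ν) := by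
  obtain ⟨q, hq, hq1⟩ := q
  simp only at *
  have hmu := muc_pos (m := m) hq
  have h1q : 0 < 1 - q := by linarith
  have hx : (1 + q) / muc q m * t / (1 + q) = t / muc q m := by field_simp
  -- In base p = q² the condition (1 - p) t/μ < 1 is the assumed bound on the argument, as 1 - q² =
  -- (1 + q)(1 - q).
  have hs := (summable_qBessel (p := q ^ 2) (r := t / muc q m) (by positivity) (pow_lt_one₀ hq.le hq1 two_ne_zero) hν (by positivity) (by
    rw [lt_div_iff₀ h1q] at h
    calc (1 - q ^ 2) * (t / muc q m) = (1 + q) / muc q m * t * (1 - q) := by ring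
      _ < 1 := h)).hasSum.mul_left (muc q m ^ ν)⁻¹
  have e : qBessel q ν ((1 + q) / muc q m * t) / t ^ ν = (muc q m ^ ν)⁻¹ *
      ∑' i : ℕ, (-1) ^ i / (qFactorial (q ^ 2) i * qGamma (q ^ 2) (i + ν + 1)) * (t / muc q m) ^ (2 * i) := by
    rw [qBessel, hx, Real.div_rpow ht.le hmu.le]
    have := (Real.rpow_pos_of_pos ht ν).ne'
    field_simp
  rw [e]
  have e2 : (fun n : ℕ => besselCoeff q m ν n * t ^ (2 * n)) = fun n : ℕ => (muc q m ^ ν)⁻¹ *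
      ((-1) ^ n / (qFactorial (q ^ 2) n * qGamma (q ^ 2) (n + ν + 1)) * (t / muc q m) ^ (2 * n)) := by
    funext n
    rw [besselCoeff, div_pow, inv_pow]
    ring
  rw [e2]
  exact hs

end Bessel

/-! ### Comparison of coefficients and conclusion -/

theorem coeff_radial_mul_monomial (q : ℝ) (m : ℕ) (φ : ℕ → ℝ) (k b : ℕ) (S : Poly q m) :
    PowerSeries.coeff b (radial q m φ * PowerSeries.monomial k S) = if Even (k + b) ∧ k ≤ b then
      ((φ ((b - k) / 2) : ℝ) : ℂ) • (normSq q m ^ ((b - k) / 2) * S) else 0 := by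
  rw [PowerSeries.coeff_mul]
  by_cases h : k ≤ b
  · rw [sum_eq_single (b - k, k)]
    · rw [PowerSeries.coeff_monomial_same, radial, PowerSeries.coeff_mk]
      have : Even (k + b) ↔ Even (b - k) := by rw [Nat.even_sub h, Nat.even_add]; tauto
      simp only [this, h, and_true]
      split_ifs
      · rw [smul_mul_assoc]
      · rw [zero_mul]
    · rintro ⟨a, c⟩ h1 h2
      rw [HasAntidiagonal.mem_antidiagonal] at h1
      simp only at h1 ⊢
      rw [PowerSeries.coeff_monomial, if_neg, mul_zero]
      rintro rfl
      exact h2 (by rw [← h1, Nat.add_sub_cancel])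
    · intro h1; exact absurd (HasAntidiagonal.mem_antidiagonal.2 (Nat.sub_add_cancel h)) h1
  · rw [if_neg (by tauto)]
    refine sum_eq_zero fun x hx => ?_
    rw [HasAntidiagonal.mem_antidiagonal] at hx
    rw [PowerSeries.coeff_monomial, if_neg (by omega), mul_zero]

/-- The coefficients of the integral, multiplied by the factors from the differentiations. -/
theorem pizzetti_mul (q : Set.Ioo (0 : ℝ) 1) (m k r : ℕ) :
    ((pizzetti q m (k + r) : ℝ) : ℂ) * (mu q m ^ k * ∏ i ∈ range k, qnum q (k + r - i)) =
    ((2 * muc q m ^ ((m : ℝ) / 2 - 1) * qGamma ((q : ℝ) ^ 2) (1 / 2) ^ m : ℝ) : ℂ) * (-1) ^ r *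
      ((besselCoeff q m ((m : ℝ) / 2 + k - 1) r : ℝ) : ℂ) := by
  have hmu := muc_pos (m := m) q.2.1
  have hF := fun n => qFactorial_ne (p := (q : ℝ) ^ 2) (by have := q.2.1; positivity) (pow_lt_one₀ q.2.1.le q.2.2 two_ne_zero) n
  have e : ∏ i ∈ range k, qnum q (k + r - i) = ((qFactorial ((q : ℝ) ^ 2) (k + r) / qFactorial ((q : ℝ) ^ 2) r : ℝ) : ℂ) := by
    rw [Complex.ofReal_div, eq_div_iff (by exact_mod_cast hF r), prod_qnum]
  -- Here μ^(-ν) with ν = m/2 + k - 1 is split. One μ^k on the left comes from the differentiations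
  -- and the prefactor μ^(m/2-1) on the right cancels, which leaves μ^(-k-2r) on both sides.
  have e2 : (muc q m ^ ((m : ℝ) / 2 + k - 1))⁻¹ = (muc q m ^ ((m : ℝ) / 2 - 1))⁻¹ * (muc q m ^ k)⁻¹ := by
    rw [← mul_inv, ← Real.rpow_natCast _ k, ← Real.rpow_add hmu]
    congr 2; ring
  have e3 : ((r : ℝ) + ((m : ℝ) / 2 + k - 1) + 1) = ((k + r : ℕ) : ℝ) + (m : ℝ) / 2 := by push_cast; ring
  have h1 := (Real.rpow_pos_of_pos hmu ((m : ℝ) / 2 - 1)).ne'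
  have key : pizzetti q m (k + r) * (muc q m ^ k * (qFactorial ((q : ℝ) ^ 2) (k + r) / qFactorial ((q : ℝ) ^ 2) r)) =
      2 * muc q m ^ ((m : ℝ) / 2 - 1) * qGamma ((q : ℝ) ^ 2) (1 / 2) ^ m * (-1) ^ r * besselCoeff q m ((m : ℝ) / 2 + k - 1) r := by
    rw [pizzetti, besselCoeff, e2, e3]
    have h2 : ((-1 : ℝ) ^ r) * (-1) ^ r = 1 := by rw [← mul_pow]; simp
    have h3 := hF (k + r)
    have h4 := hF r
    have h5 := hmu.ne'
    generalize qGamma ((q : ℝ) ^ 2) (((k + r : ℕ) : ℝ) + (m : ℝ) / 2) = G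
    generalize muc (q : ℝ) m ^ ((m : ℝ) / 2 - 1) = A at *
    simp only [div_eq_mul_inv, mul_inv, inv_pow]
    -- The same value Γ_{q²}(k + r + m/2) occurs on both sides and only inverted, so its
    -- nonvanishing plays no role.
    generalize G⁻¹ = G'
    field_simp
    linear_combination (qGamma ((q : ℝ) ^ 2) (1 / 2) ^ m * G' * (muc (q : ℝ) m ^ k) ^ 2 * muc (q : ℝ) m ^ (2 * r)) * (-h2)
  have := congrArg (fun t : ℝ => (t : ℂ)) key
  rw [e, mu]
  push_cast at this ⊢
  linear_combination this

end QEuclid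

theorem theorem4p6 (q : Set.Ioo (0 : ℝ) 1) (m : ℕ) (hm : 0 < m) :
    (∃! E, QEuclid.IsBraidedExp q m E) ∧
    ∀ k : ℕ, ∃ φ : ℕ → ℝ,
      (∀ t : ℝ, 0 < t → (1 + (q : ℝ)) / QEuclid.muc q m * t < 1 / (1 - (q : ℝ)) →
        HasSum (fun n : ℕ => φ n * t ^ (2 * n))
          (QEuclid.qBessel q ((m : ℝ) / 2 + k - 1) ((1 + (q : ℝ)) / QEuclid.muc q m * t) /
            t ^ ((m : ℝ) / 2 + k - 1))) ∧
      ∀ E, QEuclid.IsBraidedExp q m E → ∀ S ∈ QEuclid.harmonic q m k,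
        PowerSeries.mk (QEuclid.sphereIntegralExp q m E S) =
          (((2 * QEuclid.muc q m ^ ((m : ℝ) / 2 - 1) * QEuclid.qGamma ((q : ℝ) ^ 2) (1 / 2) ^ m : ℝ) : ℂ) *
              Complex.I ^ k) •
            (QEuclid.radial q m φ * PowerSeries.monomial k S) := by
  refine ⟨⟨QEuclid.bexp q m, QEuclid.isBraidedExp_bexp q, fun E hE => hE.unique q (QEuclid.isBraidedExp_bexp q)⟩, fun k => ?_⟩
  have hν : -1 < (m : ℝ) / 2 + k - 1 := by
    have : (0 : ℝ) < m := by exact_mod_cast hm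
    have : (0 : ℝ) ≤ k := Nat.cast_nonneg k
    linarith
  refine ⟨QEuclid.besselCoeff q m ((m : ℝ) / 2 + k - 1), fun t ht h => QEuclid.hasSum_besselCoeff q m hν ht h, fun E hE S hS => ?_⟩
  rw [hE.unique q (QEuclid.isBraidedExp_bexp q)]
  ext b
  rw [PowerSeries.coeff_mk, QEuclid.sphereIntegralExp_bexp q k b hS, PowerSeries.coeff_smul, QEuclid.coeff_radial_mul_monomial]
  split_ifs with h
  · obtain ⟨⟨s, hs⟩, hk⟩ := h
    -- With b = k + 2r the integral involves Δ^(k+r), and i^b = i^k (-1)^r. This sign cancels the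
    -- (-1)^r of `pizzetti_mul`, leaving the alternating sign inside the Bessel coefficient.
    obtain ⟨r, rfl⟩ : ∃ r, b = k + 2 * r := ⟨s - k, by omega⟩
    rw [show (k + (k + 2 * r)) / 2 = k + r by omega, show (k + 2 * r - k) / 2 = r by omega, QEuclid.pizzetti_mul, smul_smul,
      pow_add, pow_mul, Complex.I_sq]
    congr 1
    have h2 : ((-1 : ℂ) ^ r) * (-1) ^ r = 1 := by rw [← mul_pow]; simp
    linear_combination (((2 * QEuclid.muc q m ^ ((m : ℝ) / 2 - 1) * QEuclid.qGamma ((q : ℝ) ^ 2) (1 / 2) ^ m : ℝ) : ℂ) *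
      Complex.I ^ k * ((QEuclid.besselCoeff q m ((m : ℝ) / 2 + k - 1) r : ℝ) : ℂ)) * h2
  · rw [smul_zero]
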